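/- **Setting.** Let $d\ge 3$, $\theta^\star\in\mathbb S^{d-1}$ and $f:[-1,1]\to[-1,1]$ non-decreasing, differentiable on $[0,1]$, with $0<\gamma_1\le f'(x)\le\gamma_2$ for $x\in[1-\gamma_0,1]$, where $0<\gamma_0\le 0.1$. For learning rates $\eta_t$ and exploration levels $\sigma_t\in[0,1]$, SGD starts from $\theta_1\in\mathbb S^{d-1}$ and, for $t=1,2,\dots$, draws $Z_t$ uniformly (given the past) from the unit vectors orthogonal to $\theta_t$, plays $a_t=\sqrt{1-\sigma_t^2}\,\theta_t+\sigma_tZ_t$, observes $r_t=f(\langle\theta^\star,a_t\rangle)+\varepsilon_t$ with $\varepsilon_t$ zero-mean and $1$-subGaussian given the past and $a_t$, and sets $$\theta_{t+1/2}=\theta_t-\eta_t\big(f(\langle\theta_t,a_t\rangle)-r_t\big)f'(\langle\theta_t,a_t\rangle)(I-\theta_t\theta_t^\top)a_t,\qquad \theta_{t+1}=\frac{\theta_{t+1/2}}{\|\theta_{t+1/2}\|}.$$ Let $m_t=\langle\theta_t,\theta^\star\rangle$, $0<\delta<1$, and assume $m_1\ge 1/\sqrt d$ almost surely. Take $\sigma_t^2=\gamma_0$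 for all $t$. **Theorem (burn-in phase).** 1. For every $c_0>0$ there are $c,C>0$ depending only on $\gamma_0,\gamma_1,\gamma_2,c_0$ such that the following holds. If $f'\ge c_0$ on $[0,1]$ and $\eta_t=\dfrac{c}{d\log^2(d/\delta)}$ for all $t$ (so $\eta_t=\widetilde\Theta(1/d)$), then $m_T\ge 1-\gamma_0/4$ with probability at least $1-\delta T$, where $T=\lceil C d^2\log^2(d/\delta)\rceil=\widetilde O(d^2)$. 2. There are $c,C,K>0$ depending only on $\gamma_0,\gamma_1,\gamma_2$ such that the following holds. Suppose that $f$ is convex on $[0,1]$ and $I:=\int_{1/(2\sqrt d)}^{1-\gamma_0/4}\frac{m}{f'(m)^2}\,\mathrm dm<\infty$. Put $\underline m_k=(1-\gamma_0)^2\sqrt{k/d}$, and run $d-1$ consecutive epochs $k=1,\dots,d-1$, where the $k$-th epoch uses the constant learning rate $\eta^{(k)}=\dfrac{c\,f'(\underline m_k)}{d\,\underline m_k\log^2(d/\delta)}$ and consists of $\Delta_k=\Big\lceil \dfrac{C d(\underline m_{k+1}-\underline m_k)}{\eta^{(k)}f'(\underline m_k)}\Big\rceil$ rounds. Then $T:=1+\sum_{k=1}^{d-1}\Delta_k$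 satisfies $T\le K d^2\log^2(d/\delta)\, I=\widetilde O(d^2 I)$, and $m_T\ge 1-\gamma_0/4$ with probability at least $1-\delta T$. -/

import Mathlib

open MeasureTheory ProbabilityTheory Set
open scoped ENNReal

noncomputable section

/-- The derivative of the link function on `[0,1]` (one-sided at the two endpoints). The stochastic
gradient update below only evaluates it at `⟪θ_t, a_t⟫ = √(1 - σ_t²) ∈ [0,1]`. -/
def linkDeriv (f : ℝ → ℝ) (x : ℝ) : ℝ := derivWithin f (Icc 0 1) x

/-- The standing assumption on the link function `f : [-1,1] → [-1,1]`: it is non-decreasing,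
bounded by one, and `γ₁ ≤ f' ≤ γ₂` on `[1 - γ₀, 1]`. Differentiability is asked on `[0,1]` only,
where the derivative is used. -/
structure LinkAssumption (f : ℝ → ℝ) (γ₀ γ₁ γ₂ : ℝ) : Prop where
  mono : MonotoneOn f (Icc (-1) 1)
  bound : ∀ x ∈ Icc (-1 : ℝ) 1, |f x| ≤ 1
  diff : DifferentiableOn ℝ f (Icc 0 1)
  locallyLinear : ∀ x ∈ Icc (1 - γ₀) 1, γ₁ ≤ linkDeriv f x ∧ linkDeriv f x ≤ γ₂

/-- The uniform distribution on the unit sphere `{z : ‖z‖ = 1, ⟪z, θ⟫ = 0}` of the orthogonal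
complement of `θ`: the normalized surface measure, seen as a measure on the ambient space. -/
def uniformOrthSphere {d : ℕ} (θ : EuclideanSpace ℝ (Fin d)) :
    Measure (EuclideanSpace ℝ (Fin d)) :=
  (((volume : Measure (ℝ ∙ θ)ᗮ).toSphere univ)⁻¹ • (volume : Measure (ℝ ∙ θ)ᗮ).toSphere).map
    (fun z : Metric.sphere (0 : (ℝ ∙ θ)ᗮ) 1 => ((z : (ℝ ∙ θ)ᗮ) : EuclideanSpace ℝ (Fin d)))

/-- Interactive stochastic gradient descent in the single-index model with link `f` and parameter
`θs`, learning rates `η t` and exploration levels `σ t`; rounds are numbered from `t = 1`.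
`ℱ t` is the information available before round `t`, `θ t` the iterate, `Z t` the exploration
direction, `a t` the action, `ε t` the noise and `r t` the reward. The noise is conditionally
centred and 1-subGaussian given the past and the current action, which covers the case of noise
that is independent of everything else. -/
structure IsSGD {d : ℕ} {Ω : Type*} {mΩ : MeasurableSpace Ω} (μ : Measure Ω)
    (f : ℝ → ℝ) (θs : EuclideanSpace ℝ (Fin d)) (η σ : ℕ → ℝ) (ℱ : Filtration ℕ mΩ)
    (θ Z a : ℕ → Ω → EuclideanSpace ℝ (Fin d)) (ε r : ℕ → Ω → ℝ) : Prop where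
  /-- the initial iterate is on the unit sphere -/
  init_norm : ∀ᵐ ω ∂μ, ‖θ 1 ω‖ = 1
  measurable_iterate : ∀ t, 1 ≤ t → Measurable[ℱ t] (θ t)
  measurable_direction : ∀ t, 1 ≤ t → Measurable[ℱ (t + 1)] (Z t)
  measurable_noise : ∀ t, 1 ≤ t → Measurable[ℱ (t + 1)] (ε t)
  /-- given the past, `Z t` is uniform on the unit sphere orthogonal to `θ t` -/
  direction_law : ∀ t, 1 ≤ t → ∀ A : Set Ω, MeasurableSet[ℱ t] A →
    ∀ B : Set (EuclideanSpace ℝ (Fin d)), MeasurableSet B →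
      μ (A ∩ Z t ⁻¹' B) = ∫⁻ ω in A, uniformOrthSphere (θ t ω) B ∂μ
  noise_integrable : ∀ t, 1 ≤ t → ∀ l : ℝ, Integrable (fun ω => Real.exp (l * ε t ω)) μ
  noise_mean : ∀ t, 1 ≤ t →
    μ[ε t | ℱ t ⊔ MeasurableSpace.comap (Z t) inferInstance] =ᵐ[μ] fun _ => 0
  noise_subGaussian : ∀ t, 1 ≤ t → ∀ l : ℝ,
    μ[fun ω => Real.exp (l * ε t ω) | ℱ t ⊔ MeasurableSpace.comap (Z t) inferInstance]
      ≤ᵐ[μ] fun _ => Real.exp (l ^ 2 / 2)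
  action : ∀ t, 1 ≤ t → ∀ ω, a t ω = √(1 - σ t ^ 2) • θ t ω + σ t • Z t ω
  reward : ∀ t, 1 ≤ t → ∀ ω, r t ω = f (inner ℝ θs (a t ω)) + ε t ω
  /-- the gradient step, followed by normalization -/
  update : ∀ t, 1 ≤ t → ∀ ω, ∃ θhalf : EuclideanSpace ℝ (Fin d),
    θhalf = θ t ω
      - (η t * (f (inner ℝ (θ t ω) (a t ω)) - r t ω) * linkDeriv f (inner ℝ (θ t ω) (a t ω)))
        • (a t ω - inner ℝ (θ t ω) (a t ω) • θ t ω) ∧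
    θ (t + 1) ω = ‖θhalf‖⁻¹ • θhalf

/-- The correlation level `(1 - γ₀)² √(k/d)` attached to the `k`-th epoch. -/
def epochLevel (γ₀ : ℝ) (d k : ℕ) : ℝ := (1 - γ₀) ^ 2 * √((k : ℝ) / d)

/-- The learning rate used during the `k`-th epoch. -/
def epochRate (f : ℝ → ℝ) (γ₀ c δ : ℝ) (d k : ℕ) : ℝ :=
  c * linkDeriv f (epochLevel γ₀ d k) / (Real.log (d / δ) ^ 2 * d * epochLevel γ₀ d k)

/-- The number of rounds of the `k`-th epoch. -/
def epochLength (f : ℝ → ℝ) (γ₀ c C δ : ℝ) (d k : ℕ) : ℕ :=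
  ⌈C * d * (epochLevel γ₀ d (k + 1) - epochLevel γ₀ d k) /
    (epochRate f γ₀ c δ d k * linkDeriv f (epochLevel γ₀ d k))⌉₊

/-- The first round of the `k`-th epoch; the first epoch starts at round `1`. -/
def epochStart (f : ℝ → ℝ) (γ₀ c C δ : ℝ) (d k : ℕ) : ℕ :=
  1 + ∑ j ∈ Finset.Ico 1 k, epochLength f γ₀ c C δ d j

/-- The epoch `k ∈ {1, …, d - 1}` that contains round `t`. -/
def epochIndex (f : ℝ → ℝ) (γ₀ c C δ : ℝ) (d t : ℕ) : ℕ :=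
  Nat.findGreatest (fun k => epochStart f γ₀ c C δ d k ≤ t) (d - 1)

/-- The learning rate schedule that is constant on each of the epochs `1, …, d - 1`. -/
def epochSchedule (f : ℝ → ℝ) (γ₀ c C δ : ℝ) (d t : ℕ) : ℝ :=
  epochRate f γ₀ c δ d (epochIndex f γ₀ c C δ d t)

/-- `∫ m / f'(m)² dm` over `[1/(2√d), 1 - γ₀/4]`, with value `∞` where it diverges (here
`f' ≥ 0`, and `m / 0 = ∞` for `m > 0`). -/
def burnInIntegral (f : ℝ → ℝ) (γ₀ : ℝ) (d : ℕ) : ℝ≥0∞ :=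
  ∫⁻ m in Icc (1 / (2 * √(d : ℝ))) (1 - γ₀ / 4),
    ENNReal.ofReal m / ENNReal.ofReal (linkDeriv f m) ^ 2

end

/-!
With `σ² = γ₀` the gradient step moves the iterate `θ` only along the exploration direction `Z`,
by `η G (b + ε) Z` with the gain `G = f'(√(1 - γ₀)) √γ₀` and the noiseless residual `b`. So the
correlation `m = ⟪θ, θs⟫` changes by `η G (b + ε) ⟪Z, θs⟫`, up to the normalization, which is of
second order in `η`.

*Drift.* The law of `Z` is symmetric, and `f` is monotone, so pairing `Z` with `-Z` shows that the
mean of `b ⟪Z, θs⟫` is never negative, and at least of order `κ / d` when `f` has slope at least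
`κ` to the right of `√(1 - γ₀) m` and `m` is not yet close to one (`signal_lower_bound`). The
second moment `(1 - m²) / (d - 1)` of `⟪Z, θs⟫` comes from reflections that preserve the law.

*Fluctuations.* The noise enters multiplied by `⟪Z, θs⟫`, which is of size `1 / √d`. An exponential
supermartingale (`lintegral_mul_exp_progress_le`, `measure_sum_lt_le`) shows that the fluctuations
over any block of rounds stay above `-γ₀ / (32 √d)`, provided `Σ η²` is at most of order
`1 / log (d / δ)`. A union bound over blocks, and over the tails of the noise that bound the
quadratic loss, costs probability `δ T` (`IsSGD.exists_good_event`; nothing is to prove when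
`δ T ≥ 1`).

*Barrier.* On the good event the argument is deterministic. The loss from normalization is
`O(η² log (d / δ)) (1 / √d + m)`, hence dominated by the drift up to a cap `h`; beyond the cap
a round can at worst bring `m` back to slightly below `h`. Such a sequence stays above every
target that lies below the gains accumulated since the start and since each possible return
(`barrier_bound`, `IsSGD.burn_in`).

*Schedules.* If `f' ≥ c₀`, the cap is `1 - γ₀ / 8`, the target is zero until the last round, and
the total gain is one. If `f` is convex, the slope to the right of the level `ℓ_k` is `f'(ℓ_k)`,
the cap in epoch `k` is `4 ℓ_k`, the gain of the epoch is at least `4 (ℓ_{k+1} - ℓ_k)`, and the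
target is `ℓ_k / √(1 - γ₀)`. There `Σ η²` is a harmonic sum, and since `f'` is monotone, the number
of rounds is a lower Riemann sum of the burn-in integral (`sum_cells_le_burnInIntegral`), whose
finiteness also forces `f'(ℓ_k) > 0`.
-/

/-! ### Uniform distribution on the sphere orthogonal to a vector -/

open scoped Pointwise in
/-- A linear isometry carries the surface measure of the unit sphere to the surface measure. -/
theorem map_toSphere_volume {V W : Type*} [NormedAddCommGroup V] [InnerProductSpace ℝ V]
    [FiniteDimensional ℝ V] [MeasurableSpace V] [BorelSpace V]
    [NormedAddCommGroup W] [InnerProductSpace ℝ W]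
    [FiniteDimensional ℝ W] [MeasurableSpace W] [BorelSpace W] (Φ : V ≃ₗᵢ[ℝ] W) :
    ((volume : Measure V).toSphere).map
      (fun z : Metric.sphere (0 : V) 1 => (⟨Φ z, by simp⟩ : Metric.sphere (0 : W) 1)) =
    (volume : Measure W).toSphere := by
  have hmeas : Measurable
      (fun z : Metric.sphere (0 : V) 1 => (⟨Φ z, by simp⟩ : Metric.sphere (0 : W) 1)) := by
    refine Measurable.subtype_mk ?_
    exact Φ.continuous.measurable.comp measurable_subtype_coe
  ext s hs
  rw [Measure.map_apply hmeas hs, Measure.toSphere_apply' _ (hmeas hs),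
    Measure.toSphere_apply' _ hs, Φ.toLinearEquiv.finrank_eq,
    ← (Φ.measurePreserving).measure_preimage_emb Φ.toHomeomorph.measurableEmbedding]
  congr 2
  ext v
  simp only [mem_smul, mem_image, mem_preimage, Subtype.exists, exists_and_right, exists_eq_right]
  constructor
  · rintro ⟨t, ht, z, ⟨hz, hzs⟩, rfl⟩
    exact ⟨t, ht, Φ z, ⟨by simpa using hz, hzs⟩, by simp⟩
  · rintro ⟨t, ht, z, ⟨hz, hzs⟩, hv⟩
    refine ⟨t, ht, Φ.symm z, ⟨by simpa using hz, by simpa using hzs⟩, ?_⟩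
    apply Φ.injective
    simpa using hv

/-- The normalized surface measure on the unit sphere of a subspace, as a measure on the ambient
space. -/
noncomputable def uniformSphereOf {d : ℕ} (V : Submodule ℝ (EuclideanSpace ℝ (Fin d))) :
    Measure (EuclideanSpace ℝ (Fin d)) :=
  (((volume : Measure V).toSphere univ)⁻¹ • (volume : Measure V).toSphere).map
    (fun z : Metric.sphere (0 : V) 1 => ((z : V) : EuclideanSpace ℝ (Fin d)))

theorem uniformOrthSphere_eq {d : ℕ} (θ : EuclideanSpace ℝ (Fin d)) :
    uniformOrthSphere θ = uniformSphereOf (ℝ ∙ θ)ᗮ := rfl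

theorem measurable_coe_sphere {d : ℕ} (V : Submodule ℝ (EuclideanSpace ℝ (Fin d))) :
    Measurable (fun z : Metric.sphere (0 : V) 1 => ((z : V) : EuclideanSpace ℝ (Fin d))) :=
  measurable_subtype_coe.comp measurable_subtype_coe

theorem map_uniformSphereOf {d : ℕ} (V : Submodule ℝ (EuclideanSpace ℝ (Fin d)))
    (R : EuclideanSpace ℝ (Fin d) ≃ₗᵢ[ℝ] EuclideanSpace ℝ (Fin d)) :
    (uniformSphereOf V).map R = uniformSphereOf (V.map R.toLinearEquiv.toLinearMap) := by
  set W := V.map R.toLinearEquiv.toLinearMap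
  let Φ : V ≃ₗᵢ[ℝ] W := R.submoduleMap V
  have hmeas : Measurable
      (fun z : Metric.sphere (0 : V) 1 => (⟨Φ z, by simp⟩ : Metric.sphere (0 : W) 1)) :=
    Measurable.subtype_mk (Φ.continuous.measurable.comp measurable_subtype_coe)
  have htot : (volume : Measure W).toSphere univ = (volume : Measure V).toSphere univ := by
    rw [← map_toSphere_volume Φ, Measure.map_apply hmeas .univ, preimage_univ]
  unfold uniformSphereOf
  rw [htot, ← map_toSphere_volume Φ, ← Measure.map_smul, Measure.map_map
    R.continuous.measurable (measurable_coe_sphere V), Measure.map_map (measurable_coe_sphere W)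
    hmeas]
  rfl

theorem map_uniformOrthSphere {d : ℕ} (θ : EuclideanSpace ℝ (Fin d))
    (R : EuclideanSpace ℝ (Fin d) ≃ₗᵢ[ℝ] EuclideanSpace ℝ (Fin d)) :
    (uniformOrthSphere θ).map R = uniformOrthSphere (R θ) := by
  rw [uniformOrthSphere_eq, map_uniformSphereOf, uniformOrthSphere_eq]
  congr 1
  rw [Submodule.map_orthogonal_equiv]
  simp [Submodule.map_span]

theorem finrank_orth_span_singleton {d : ℕ} {θ : EuclideanSpace ℝ (Fin d)} (hθ : ‖θ‖ = 1) :
    Module.finrank ℝ (ℝ ∙ θ)ᗮ + 1 = d := by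
  have h0 : θ ≠ 0 := by rintro rfl; simp at hθ
  have h := (ℝ ∙ θ).finrank_add_finrank_orthogonal
  rw [finrank_span_singleton h0, finrank_euclideanSpace_fin] at h
  omega

theorem isProbabilityMeasure_uniformOrthSphere {d : ℕ} (hd : 3 ≤ d)
    {θ : EuclideanSpace ℝ (Fin d)} (hθ : ‖θ‖ = 1) :
    IsProbabilityMeasure (uniformOrthSphere θ) := by
  have hfr := finrank_orth_span_singleton hθ
  have : Nontrivial (ℝ ∙ θ)ᗮ := Module.nontrivial_of_finrank_pos (R := ℝ) (by omega)
  have hne : (volume : Measure (ℝ ∙ θ)ᗮ).toSphere univ ≠ 0 := by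
    rw [Ne, Measure.measure_univ_eq_zero]
    exact Measure.toSphere_ne_zero _
  constructor
  rw [uniformOrthSphere, Measure.map_apply (measurable_coe_sphere _) .univ, preimage_univ,
    Measure.smul_apply, smul_eq_mul, ENNReal.inv_mul_cancel hne (measure_ne_top _ _)]

theorem ae_uniformOrthSphere {d : ℕ} (θ : EuclideanSpace ℝ (Fin d)) :
    ∀ᵐ z ∂(uniformOrthSphere θ), ‖z‖ = 1 ∧ inner ℝ θ z = 0 := by
  have hms : MeasurableSet {z : EuclideanSpace ℝ (Fin d) | ‖z‖ = 1 ∧ inner ℝ θ z = 0} :=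
    (measurableSet_eq_fun (by fun_prop) (by fun_prop)).inter
      (measurableSet_eq_fun (by fun_prop) (by fun_prop))
  rw [uniformOrthSphere, ae_map_iff (measurable_coe_sphere _).aemeasurable hms]
  refine Filter.Eventually.of_forall fun z => ⟨?_, ?_⟩
  · exact mem_sphere_zero_iff_norm.1 z.2
  · exact (Submodule.mem_orthogonal_singleton_iff_inner_right).1 z.1.2

section moments
variable {d : ℕ} {θ : EuclideanSpace ℝ (Fin d)}

theorem integral_comp_uniformOrthSphere
    (R : EuclideanSpace ℝ (Fin d) ≃ₗᵢ[ℝ] EuclideanSpace ℝ (Fin d)) (hR : R θ = θ)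
    (g : EuclideanSpace ℝ (Fin d) → ℝ) :
    ∫ z, g (R z) ∂(uniformOrthSphere θ) = ∫ z, g z ∂(uniformOrthSphere θ) := by
  conv_rhs => rw [← hR, ← map_uniformOrthSphere]
  exact (R.toHomeomorph.measurableEmbedding.integral_map g).symm

/-- The uniform distribution on the sphere orthogonal to `θ` is symmetric. -/
theorem integral_neg_uniformOrthSphere (g : EuclideanSpace ℝ (Fin d) → ℝ) :
    ∫ z, g (-z) ∂(uniformOrthSphere θ) = ∫ z, g z ∂(uniformOrthSphere θ) := by
  have h : (-θ) = (LinearIsometryEquiv.neg ℝ) θ := rfl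
  have hs : uniformOrthSphere (-θ) = uniformOrthSphere θ := by
    rw [uniformOrthSphere_eq, uniformOrthSphere_eq]
    congr 2
    rw [← neg_one_smul ℝ θ]
    exact Submodule.span_singleton_smul_eq (by simp) _
  conv_rhs => rw [← hs, h, ← map_uniformOrthSphere]
  exact ((LinearIsometryEquiv.neg ℝ).toHomeomorph.measurableEmbedding.integral_map g).symm

theorem integrable_of_bdd_on_uniformOrthSphere (hd : 3 ≤ d) (hθ : ‖θ‖ = 1)
    {g : EuclideanSpace ℝ (Fin d) → ℝ} (hg : Measurable g) (K : ℝ)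
    (hK : ∀ z, ‖z‖ = 1 → inner ℝ θ z = 0 → |g z| ≤ K) :
    Integrable g (uniformOrthSphere θ) := by
  have := isProbabilityMeasure_uniformOrthSphere hd hθ
  refine Integrable.of_bound hg.aestronglyMeasurable K ?_
  filter_upwards [ae_uniformOrthSphere θ] with z hz
  exact hK z hz.1 hz.2

theorem abs_inner_le_one {z w : EuclideanSpace ℝ (Fin d)} (hz : ‖z‖ = 1) (hw : ‖w‖ = 1) :
    |inner ℝ z w| ≤ 1 := by
  simpa [hz, hw] using abs_real_inner_le_norm z w

theorem integrable_sq_inner_uniformOrthSphere (hd : 3 ≤ d) (hθ : ‖θ‖ = 1)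
    (w : EuclideanSpace ℝ (Fin d)) :
    Integrable (fun z => inner ℝ z w ^ 2) (uniformOrthSphere θ) := by
  refine integrable_of_bdd_on_uniformOrthSphere hd hθ (by fun_prop) (‖w‖ ^ 2) fun z hz _ => ?_
  rw [abs_pow]
  refine pow_le_pow_left₀ (abs_nonneg _) ?_ 2
  simpa [hz] using abs_real_inner_le_norm z w

/-- All unit vectors orthogonal to `θ` have the same second moment: swap them by a reflection. -/
theorem integral_sq_inner_eq_of_norm_eq {v w : EuclideanSpace ℝ (Fin d)} (hvw : ‖v‖ = ‖w‖)
    (hv : inner ℝ θ v = 0) (hw : inner ℝ θ w = 0) :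
    ∫ z, inner ℝ z v ^ 2 ∂(uniformOrthSphere θ) =
      ∫ z, inner ℝ z w ^ 2 ∂(uniformOrthSphere θ) := by
  set R := (ℝ ∙ (v - w))ᗮ.reflection
  have hRv : R v = w := Submodule.reflection_sub hvw
  have hRθ : R θ = θ := by
    refine Submodule.reflection_mem_subspace_eq_self ?_
    rw [Submodule.mem_orthogonal_singleton_iff_inner_left, inner_sub_right, hv, hw, sub_zero]
  rw [← integral_comp_uniformOrthSphere R hRθ (fun z => inner ℝ z w ^ 2)]
  refine integral_congr_ae (Filter.Eventually.of_forall fun z => ?_)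
  simp only [← hRv, LinearIsometryEquiv.inner_map_map]

theorem integral_sq_inner_of_orth (hd : 3 ≤ d) (hθ : ‖θ‖ = 1) {v : EuclideanSpace ℝ (Fin d)}
    (hv : inner ℝ θ v = 0) :
    ∫ z, inner ℝ z v ^ 2 ∂(uniformOrthSphere θ) = ‖v‖ ^ 2 / (d - 1) := by
  have hP := isProbabilityMeasure_uniformOrthSphere hd hθ
  have hfr := finrank_orth_span_singleton hθ
  have hd1 : (0 : ℝ) < d - 1 := by
    have : (3 : ℝ) ≤ d := by exact_mod_cast hd
    linarith
  set b := stdOrthonormalBasis ℝ (ℝ ∙ θ)ᗮ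
  have horth : ∀ i, inner ℝ θ (b i : EuclideanSpace ℝ (Fin d)) = 0 := fun i =>
    (Submodule.mem_orthogonal_singleton_iff_inner_right).1 (b i).2
  have hnorm : ∀ i, ‖(b i : EuclideanSpace ℝ (Fin d))‖ = 1 := fun i => by
    rw [← Submodule.coe_norm, b.norm_eq_one]
  have hsum : ∑ i, ∫ z, inner ℝ z (b i : EuclideanSpace ℝ (Fin d)) ^ 2 ∂(uniformOrthSphere θ)
      = 1 := by
    rw [← integral_finsetSum _ fun i _ => integrable_sq_inner_uniformOrthSphere hd hθ _]
    have : (fun z => ∑ i, inner ℝ z (b i : EuclideanSpace ℝ (Fin d)) ^ 2)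
        =ᵐ[uniformOrthSphere θ] fun _ => (1 : ℝ) := by
      filter_upwards [ae_uniformOrthSphere θ] with z hz
      have hzV : z ∈ (ℝ ∙ θ)ᗮ := (Submodule.mem_orthogonal_singleton_iff_inner_right).2 hz.2
      have h := b.sum_sq_inner_left ⟨z, hzV⟩
      simp only [Submodule.coe_inner, Submodule.coe_norm, hz.1] at h
      simpa using h
    rw [integral_congr_ae this]
    simp
  have hall : ∀ i, (∫ z, inner ℝ z (b i : EuclideanSpace ℝ (Fin d)) ^ 2 ∂(uniformOrthSphere θ))
      * ‖v‖ ^ 2 = ∫ z, inner ℝ z v ^ 2 ∂(uniformOrthSphere θ) := fun i => by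
    have h := integral_sq_inner_eq_of_norm_eq (θ := θ)
      (v := ‖v‖ • (b i : EuclideanSpace ℝ (Fin d))) (w := v)
      (by rw [norm_smul, hnorm]; simp) (by rw [inner_smul_right, horth, mul_zero]) hv
    rw [← h, ← integral_mul_const]
    refine integral_congr_ae (Filter.Eventually.of_forall fun z => ?_)
    simp only [inner_smul_right]
    ring
  have hfin : (d - 1 : ℝ) * ∫ z, inner ℝ z v ^ 2 ∂(uniformOrthSphere θ) = ‖v‖ ^ 2 := by
    have h2 := congrArg (· * ‖v‖ ^ 2) hsum
    simp only [Finset.sum_mul, hall, one_mul] at h2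
    rw [Finset.sum_const, Finset.card_univ, Fintype.card_fin, nsmul_eq_mul] at h2
    rw [← h2]
    congr 1
    rw [← Nat.cast_one, ← Nat.cast_sub (by omega)]
    congr 1
    omega
  rw [← hfin]
  field_simp

theorem integral_sq_inner_uniformOrthSphere (hd : 3 ≤ d) (hθ : ‖θ‖ = 1)
    {w : EuclideanSpace ℝ (Fin d)} (hw : ‖w‖ = 1) :
    ∫ z, inner ℝ z w ^ 2 ∂(uniformOrthSphere θ) = (1 - inner ℝ θ w ^ 2) / (d - 1) := by
  set m : ℝ := inner ℝ θ w
  have horth : inner ℝ θ (w - m • θ) = 0 := by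
    rw [inner_sub_right, inner_smul_right, real_inner_self_eq_norm_sq, hθ]
    simp [m]
  have hn : ‖w - m • θ‖ ^ 2 = 1 - m ^ 2 := by
    rw [norm_sub_sq_real, inner_smul_right, norm_smul, hθ, hw, real_inner_comm]
    simp only [Real.norm_eq_abs, mul_one, sq_abs]
    change 1 ^ 2 - 2 * (m * m) + m ^ 2 = _
    ring
  rw [← hn, ← integral_sq_inner_of_orth hd hθ horth]
  refine integral_congr_ae ?_
  filter_upwards [ae_uniformOrthSphere θ] with z hz
  have : inner ℝ z θ = 0 := by rw [real_inner_comm]; exact hz.2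
  simp only [inner_sub_right, inner_smul_right, this, mul_zero, sub_zero]

theorem integral_inner_uniformOrthSphere (w : EuclideanSpace ℝ (Fin d)) :
    ∫ z, inner ℝ z w ∂(uniformOrthSphere θ) = 0 := by
  have h := integral_neg_uniformOrthSphere (θ := θ) (fun z => inner ℝ z w)
  simp only [inner_neg_left, integral_neg] at h
  linarith

/-- First absolute moment, bounded through the second one. -/
theorem integral_abs_inner_uniformOrthSphere_le (hd : 3 ≤ d) (hθ : ‖θ‖ = 1)
    {w : EuclideanSpace ℝ (Fin d)} (hw : ‖w‖ = 1) :
    ∫ z, |inner ℝ z w| ∂(uniformOrthSphere θ) ≤ 1 / √(d - 1 : ℝ) := by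
  have hP := isProbabilityMeasure_uniformOrthSphere hd hθ
  have hd1 : (0 : ℝ) < d - 1 := by
    have : (3 : ℝ) ≤ d := by exact_mod_cast hd
    linarith
  have hs : 0 < √(d - 1 : ℝ) := Real.sqrt_pos.2 hd1
  have hss : √(d - 1 : ℝ) ^ 2 = d - 1 := Real.sq_sqrt hd1.le
  have hi := integrable_sq_inner_uniformOrthSphere hd hθ w
  -- the inequality `2|x| ≤ q x² + 1/q` with `q = √(d-1)`
  have hle : ∀ z : EuclideanSpace ℝ (Fin d), |inner ℝ z w| ≤
      √(d - 1 : ℝ) / 2 * inner ℝ z w ^ 2 + 1 / (2 * √(d - 1 : ℝ)) := fun z => by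
    rw [← sq_abs (inner ℝ z w)]
    set x := |(inner ℝ z w : ℝ)|
    have : √(d - 1 : ℝ) / 2 * x ^ 2 + 1 / (2 * √(d - 1 : ℝ)) - x
        = (√(d - 1 : ℝ) * x - 1) ^ 2 / (2 * √(d - 1 : ℝ)) := by
      field_simp
      ring
    have h2 : 0 ≤ (√(d - 1 : ℝ) * x - 1) ^ 2 / (2 * √(d - 1 : ℝ)) := by positivity
    linarith
  have h1 : ∫ z, |inner ℝ z w| ∂(uniformOrthSphere θ) ≤
      ∫ z, (√(d - 1 : ℝ) / 2 * inner ℝ z w ^ 2 + 1 / (2 * √(d - 1 : ℝ)))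
        ∂(uniformOrthSphere θ) := by
    refine integral_mono ?_ ((hi.const_mul _).add (integrable_const _)) hle
    exact integrable_of_bdd_on_uniformOrthSphere hd hθ (by fun_prop) 1
      fun z hz _ => by rw [abs_abs]; exact abs_inner_le_one hz hw
  rw [integral_add (hi.const_mul _) (integrable_const _), integral_const_mul,
    integral_sq_inner_uniformOrthSphere hd hθ hw] at h1
  simp only [integral_const, probReal_univ, smul_eq_mul, one_mul] at h1
  refine h1.trans ?_
  have h3 : √(d - 1 : ℝ) / 2 * ((1 - inner ℝ θ w ^ 2) / (d - 1)) ≤ 1 / (2 * √(d - 1 : ℝ)) := by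
    rw [div_mul_div_comm, div_le_div_iff₀ (by positivity) (by positivity)]
    nlinarith [mul_nonneg hd1.le (sq_nonneg (inner ℝ θ w : ℝ))]
  have h4 : 1 / (2 * √(d - 1 : ℝ)) + 1 / (2 * √(d - 1 : ℝ)) = 1 / √(d - 1 : ℝ) := by
    field_simp
    norm_num
  linarith

end moments

/-! ### Conditioning on the past: random directions and sub-Gaussian noise -/

/-- The reflection that swaps the unit vectors `e` and `θ`, as an explicit formula that is jointly
measurable in `θ` and `z`. For `θ = e` it is the identity because `x / 0 = 0`. -/
noncomputable def swapReflection {d : ℕ} (e θ z : EuclideanSpace ℝ (Fin d)) :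
    EuclideanSpace ℝ (Fin d) :=
  z - (2 * (inner ℝ (e - θ) z / ‖e - θ‖ ^ 2)) • (e - θ)

theorem measurable_swapReflection {d : ℕ} (e : EuclideanSpace ℝ (Fin d)) :
    Measurable fun q : EuclideanSpace ℝ (Fin d) × EuclideanSpace ℝ (Fin d) =>
      swapReflection e q.1 q.2 := by
  unfold swapReflection
  fun_prop

theorem measurable_swapReflection_right {d : ℕ} (e θ : EuclideanSpace ℝ (Fin d)) :
    Measurable (swapReflection e θ) := by
  unfold swapReflection
  fun_prop

theorem map_swapReflection_uniformOrthSphere {d : ℕ} {e θ : EuclideanSpace ℝ (Fin d)}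
    (he : ‖e‖ = 1) (hθ : ‖θ‖ = 1) :
    (uniformOrthSphere e).map (swapReflection e θ) = uniformOrthSphere θ := by
  have h1 := map_uniformOrthSphere e (ℝ ∙ (e - θ))ᗮ.reflection
  rw [Submodule.reflection_sub (he.trans hθ.symm)] at h1
  rw [← h1]
  congr 1
  funext z
  rw [Submodule.reflection_orthogonal_apply, Submodule.reflection_singleton_apply, swapReflection,
    neg_sub, ← Nat.cast_smul_eq_nsmul ℝ, smul_smul]
  simp

section disintegration
variable {d : ℕ} {Ω α : Type*} {m mΩ : MeasurableSpace Ω} [MeasurableSpace α] {μ : Measure Ω}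
  [IsProbabilityMeasure μ]
  {θ Z : Ω → EuclideanSpace ℝ (Fin d)} {Q : Ω → α}

/-- If `Z` is uniform given the past, then the joint law of a past observable `(Q, θ)` and `Z` is
the image of a product measure, obtained by rotating a fixed uniform vector to `θ`. -/
theorem map_eq_map_prod_swapReflection (hd : 3 ≤ d) (hm : m ≤ mΩ) (hθm : Measurable[m] θ)
    (hZ : Measurable Z) (hQ : Measurable[m] Q) (hθ : ∀ᵐ ω ∂μ, ‖θ ω‖ = 1)
    (hlaw : ∀ A : Set Ω, MeasurableSet[m] A → ∀ B : Set (EuclideanSpace ℝ (Fin d)),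
      MeasurableSet B → μ (A ∩ Z ⁻¹' B) = ∫⁻ ω in A, uniformOrthSphere (θ ω) B ∂μ)
    {e : EuclideanSpace ℝ (Fin d)} (he : ‖e‖ = 1) :
    μ.map (fun ω => ((Q ω, θ ω), Z ω)) =
      ((μ.map (fun ω => (Q ω, θ ω))).prod (uniformOrthSphere e)).map
        (fun q => (q.1, swapReflection e q.1.2 q.2)) := by
  have hPe := isProbabilityMeasure_uniformOrthSphere hd he
  have hQθ : Measurable[m] (fun ω => (Q ω, θ ω)) := hQ.prodMk hθm
  have hQθ' : Measurable (fun ω => (Q ω, θ ω)) := hQθ.mono hm le_rfl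
  have hR : Measurable (fun q : (α × EuclideanSpace ℝ (Fin d)) × EuclideanSpace ℝ (Fin d) =>
      (q.1, swapReflection e q.1.2 q.2)) :=
    measurable_fst.prodMk ((measurable_swapReflection e).comp
      ((measurable_snd.comp measurable_fst).prodMk measurable_snd))
  have : IsProbabilityMeasure (μ.map (fun ω => (Q ω, θ ω))) :=
    Measure.isProbabilityMeasure_map hQθ'.aemeasurable
  have : IsProbabilityMeasure (μ.map (fun ω => ((Q ω, θ ω), Z ω))) :=
    Measure.isProbabilityMeasure_map (hQθ'.prodMk hZ).aemeasurable
  refine Measure.ext_prod fun {s t} hs ht => ?_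
  rw [Measure.map_apply (hQθ'.prodMk hZ) (hs.prod ht), Measure.map_apply hR (hs.prod ht),
    Measure.prod_apply (hR (hs.prod ht)), lintegral_map
      (measurable_measure_prodMk_left (hR (hs.prod ht))) hQθ']
  have h1 : (fun ω => ((Q ω, θ ω), Z ω)) ⁻¹' s ×ˢ t =
      ((fun ω => (Q ω, θ ω)) ⁻¹' s) ∩ Z ⁻¹' t := by
    ext ω; simp
  rw [h1, hlaw _ (hQθ hs) _ ht, ← lintegral_indicator (hQθ' hs)]
  refine lintegral_congr_ae ?_
  filter_upwards [hθ] with ω hω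
  by_cases hmem : (Q ω, θ ω) ∈ s
  · rw [indicator_of_mem (by exact hmem), ← map_swapReflection_uniformOrthSphere he hω,
      Measure.map_apply (measurable_swapReflection_right e _) ht]
    congr 1
    ext z
    simp [hmem]
  · rw [indicator_of_notMem (by exact hmem)]
    symm
    convert measure_empty (μ := uniformOrthSphere e)
    ext z
    simp [hmem]

/-- Fubini for a uniform direction: `Z` may be integrated out with the past held fixed. The fixed
unit vector `e` only serves to realize all the laws `uniformOrthSphere (θ ω)` as images of one. -/
theorem lintegral_disintegrate (hd : 3 ≤ d) (hm : m ≤ mΩ) (hθm : Measurable[m] θ)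
    (hZ : Measurable Z) (hQ : Measurable[m] Q) (hθ : ∀ᵐ ω ∂μ, ‖θ ω‖ = 1)
    (hlaw : ∀ A : Set Ω, MeasurableSet[m] A → ∀ B : Set (EuclideanSpace ℝ (Fin d)),
      MeasurableSet B → μ (A ∩ Z ⁻¹' B) = ∫⁻ ω in A, uniformOrthSphere (θ ω) B ∂μ)
    {e : EuclideanSpace ℝ (Fin d)} (he : ‖e‖ = 1)
    {Φ : (α × EuclideanSpace ℝ (Fin d)) × EuclideanSpace ℝ (Fin d) → ℝ≥0∞} (hΦ : Measurable Φ) :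
    ∫⁻ ω, Φ ((Q ω, θ ω), Z ω) ∂μ =
      ∫⁻ ω, ∫⁻ z, Φ ((Q ω, θ ω), z) ∂(uniformOrthSphere (θ ω)) ∂μ := by
  have hPe := isProbabilityMeasure_uniformOrthSphere hd he
  have hQθ' : Measurable (fun ω => (Q ω, θ ω)) := (hQ.prodMk hθm).mono hm le_rfl
  have hR : Measurable (fun q : (α × EuclideanSpace ℝ (Fin d)) × EuclideanSpace ℝ (Fin d) =>
      (q.1, swapReflection e q.1.2 q.2)) :=
    measurable_fst.prodMk ((measurable_swapReflection e).comp
      ((measurable_snd.comp measurable_fst).prodMk measurable_snd))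
  have hΦR : Measurable (fun q : (α × EuclideanSpace ℝ (Fin d)) × EuclideanSpace ℝ (Fin d) =>
      Φ (q.1, swapReflection e q.1.2 q.2)) := hΦ.comp hR
  rw [← lintegral_map hΦ (hQθ'.prodMk hZ),
    map_eq_map_prod_swapReflection hd hm hθm hZ hQ hθ hlaw he, lintegral_map hΦ hR,
    lintegral_prod _ hΦR.aemeasurable, lintegral_map hΦR.lintegral_prod_right' hQθ']
  refine lintegral_congr_ae ?_
  filter_upwards [hθ] with ω hω
  rw [← map_swapReflection_uniformOrthSphere he hω]
  exact (lintegral_map (f := fun z => Φ ((Q ω, θ ω), z)) (hΦ.comp measurable_prodMk_left)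
    (measurable_swapReflection_right e _)).symm

/-- The law of `Z` given the past puts `Z` almost surely on the unit sphere orthogonal to `θ`. The
observable `Q` of the disintegration is trivial here. -/
theorem ae_direction (hd : 3 ≤ d) (hm : m ≤ mΩ) (hθm : Measurable[m] θ)
    (hZ : Measurable Z) (hθ : ∀ᵐ ω ∂μ, ‖θ ω‖ = 1)
    (hlaw : ∀ A : Set Ω, MeasurableSet[m] A → ∀ B : Set (EuclideanSpace ℝ (Fin d)),
      MeasurableSet B → μ (A ∩ Z ⁻¹' B) = ∫⁻ ω in A, uniformOrthSphere (θ ω) B ∂μ)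
    {e : EuclideanSpace ℝ (Fin d)} (he : ‖e‖ = 1) :
    ∀ᵐ ω ∂μ, ‖Z ω‖ = 1 ∧ inner ℝ (θ ω) (Z ω) = 0 := by
  set S : Set ((Unit × EuclideanSpace ℝ (Fin d)) × EuclideanSpace ℝ (Fin d)) :=
    {q | ‖q.2‖ = 1 ∧ inner ℝ q.1.2 q.2 = 0}
  have hS : MeasurableSet S :=
    (measurableSet_eq_fun (by fun_prop) (by fun_prop)).inter
      (measurableSet_eq_fun (by fun_prop) (by fun_prop))
  have h := lintegral_disintegrate (Q := fun _ : Ω => ()) hd hm hθm hZ measurable_const hθ hlaw he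
    (Φ := Sᶜ.indicator (fun _ => 1)) (measurable_one.indicator hS.compl)
  have h0 : ∀ ω, ∫⁻ z, Sᶜ.indicator (fun _ => 1) (((), θ ω), z) ∂(uniformOrthSphere (θ ω)) =
      (0 : ℝ≥0∞) := fun ω => by
      rw [← lintegral_zero]
      refine lintegral_congr_ae ?_
      filter_upwards [ae_uniformOrthSphere (θ ω)] with z hz
      exact indicator_of_notMem (by simpa [S] using hz) _
  simp only [h0, lintegral_zero] at h
  have hmeas : Measurable fun ω => Sᶜ.indicator (fun _ => (1 : ℝ≥0∞)) (((), θ ω), Z ω) :=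
    (measurable_const.indicator hS.compl).comp
      ((measurable_const.prodMk (hθm.mono hm le_rfl)).prodMk hZ)
  rw [lintegral_eq_zero_iff hmeas] at h
  filter_upwards [h] with ω hω
  by_contra hn
  have : (((), θ ω), Z ω) ∈ Sᶜ := hn
  simp [indicator_of_mem this] at hω

end disintegration

section noise
variable {Ω : Type*} {m mΩ : MeasurableSpace Ω} {μ : Measure Ω} [IsProbabilityMeasure μ]
  {ε : Ω → ℝ}

/-- The conditional sub-Gaussian bound at a fixed exponent, integrated against a nonnegative
observable of the conditioning `σ`-algebra. -/
theorem lintegral_mul_exp_le (hm : m ≤ mΩ) (l : ℝ)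
    (hint : Integrable (fun ω => Real.exp (l * ε ω)) μ)
    (hsub : μ[fun ω => Real.exp (l * ε ω) | m] ≤ᵐ[μ] fun _ => Real.exp (l ^ 2 / 2))
    {H : Ω → ℝ≥0∞} (hH : Measurable[m] H) :
    ∫⁻ ω, H ω * ENNReal.ofReal (Real.exp (l * ε ω)) ∂μ ≤
      ∫⁻ ω, H ω * ENNReal.ofReal (Real.exp (l ^ 2 / 2)) ∂μ := by
  have hset : ∀ A, MeasurableSet[m] A → ∫⁻ ω in A, ENNReal.ofReal (Real.exp (l * ε ω)) ∂μ ≤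
      ENNReal.ofReal (Real.exp (l ^ 2 / 2)) * μ A := fun A hA => by
    rw [← ofReal_integral_eq_lintegral_ofReal hint.integrableOn
      (Filter.Eventually.of_forall fun _ => (Real.exp_pos _).le),
      ← setIntegral_condExp hm hint hA, ← ofReal_measureReal,
      ← ENNReal.ofReal_mul (Real.exp_pos _).le]
    refine ENNReal.ofReal_le_ofReal ?_
    calc _ ≤ ∫ ω in A, Real.exp (l ^ 2 / 2) ∂μ :=
          setIntegral_mono_ae integrable_condExp.integrableOn
            (integrable_const _).integrableOn hsub
      _ = _ := by simp [mul_comm]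
  have hmeas : AEMeasurable (fun ω => ENNReal.ofReal (Real.exp (l * ε ω))) μ :=
    hint.aestronglyMeasurable.aemeasurable.ennreal_ofReal
  set ν := μ.withDensity (fun ω => ENNReal.ofReal (Real.exp (l * ε ω)))
  have hle : ν.trim hm ≤ ENNReal.ofReal (Real.exp (l ^ 2 / 2)) • μ.trim hm := by
    refine Measure.le_iff.2 fun A hA => ?_
    rw [Measure.smul_apply, trim_measurableSet_eq hm hA, trim_measurableSet_eq hm hA,
      withDensity_apply _ (hm _ hA), smul_eq_mul]
    exact hset A hA
  calc ∫⁻ ω, H ω * ENNReal.ofReal (Real.exp (l * ε ω)) ∂μ = ∫⁻ ω, H ω ∂ν := by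
        rw [lintegral_withDensity_eq_lintegral_mul₀ hmeas (hH.mono hm le_rfl).aemeasurable]
        simp only [Pi.mul_apply, mul_comm]
    _ = ∫⁻ ω, H ω ∂(ν.trim hm) := (lintegral_trim hm hH).symm
    _ ≤ ∫⁻ ω, H ω ∂(ENNReal.ofReal (Real.exp (l ^ 2 / 2)) • μ.trim hm) :=
        lintegral_mono' hle le_rfl
    _ = _ := by
        rw [lintegral_smul_measure, lintegral_trim hm hH, smul_eq_mul, mul_comm,
          lintegral_mul_const _ (hH.mono hm le_rfl)]

/-- Rounding towards zero to a multiple of `1 / (n + 1)`. -/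
noncomputable def roundToZero (n : ℕ) (x : ℝ) : ℤ :=
  if 0 ≤ x then ⌊(n + 1) * x⌋ else ⌈(n + 1) * x⌉

theorem measurable_roundToZero (n : ℕ) : Measurable (roundToZero n) :=
  Measurable.ite measurableSet_Ici (Int.measurable_floor.comp (by fun_prop))
    (Int.measurable_ceil.comp (by fun_prop))

theorem sq_roundToZero_div_le (n : ℕ) (x : ℝ) :
    ((roundToZero n x : ℝ) / (n + 1)) ^ 2 ≤ x ^ 2 := by
  have hn : (0 : ℝ) < n + 1 := by positivity
  rw [sq_le_sq, abs_div, abs_of_pos hn, div_le_iff₀ hn]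
  unfold roundToZero
  split_ifs with h
  · rw [abs_of_nonneg h, abs_of_nonneg (by exact_mod_cast Int.floor_nonneg.2 (by positivity)),
      mul_comm]
    exact Int.floor_le _
  · push Not at h
    have h1 : ((n : ℝ) + 1) * x ≤ 0 := by nlinarith
    rw [abs_of_neg h, abs_of_nonpos (by exact_mod_cast Int.ceil_le.2 (by simpa using h1))]
    have := Int.le_ceil (((n : ℝ) + 1) * x)
    linarith

theorem tendsto_roundToZero_div (x : ℝ) :
    Filter.Tendsto (fun n : ℕ => (roundToZero n x : ℝ) / (n + 1)) Filter.atTop (nhds x) := by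
  rw [tendsto_iff_norm_sub_tendsto_zero]
  refine squeeze_zero (fun _ => norm_nonneg _) (fun n => ?_)
    (tendsto_one_div_add_atTop_nhds_zero_nat (𝕜 := ℝ))
  have hn : (0 : ℝ) < n + 1 := by positivity
  have : (roundToZero n x : ℝ) / (n + 1) - x = (roundToZero n x - (n + 1) * x) / (n + 1) := by
    field_simp
  rw [this, norm_div, Real.norm_eq_abs, Real.norm_eq_abs, abs_of_pos hn]
  gcongr
  unfold roundToZero
  rw [abs_le]
  split_ifs with h
  · constructor
    · linarith [Int.lt_floor_add_one (((n : ℝ) + 1) * x)]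
    · linarith [Int.floor_le (((n : ℝ) + 1) * x)]
  · constructor
    · linarith [Int.le_ceil (((n : ℝ) + 1) * x)]
    · linarith [Int.ceil_lt_add_one (((n : ℝ) + 1) * x)]

/-- The conditional sub-Gaussian bound at a random exponent `W` that is known at the time of
conditioning. Rounding `W` towards zero reduces it to countably many fixed exponents; Fatou's lemma
passes to the limit, and no integrability is needed because rounding decreases `W²`. -/
theorem lintegral_mul_exp_mul_le (hm : m ≤ mΩ) (hε : Measurable ε)
    (hint : ∀ l : ℝ, Integrable (fun ω => Real.exp (l * ε ω)) μ)
    (hsub : ∀ l : ℝ, μ[fun ω => Real.exp (l * ε ω) | m] ≤ᵐ[μ] fun _ => Real.exp (l ^ 2 / 2))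
    {H : Ω → ℝ≥0∞} (hH : Measurable[m] H) {W : Ω → ℝ} (hW : Measurable[m] W) :
    ∫⁻ ω, H ω * ENNReal.ofReal (Real.exp (W ω * ε ω)) ∂μ ≤
      ∫⁻ ω, H ω * ENNReal.ofReal (Real.exp (W ω ^ 2 / 2)) ∂μ := by
  have hH' : Measurable H := hH.mono hm le_rfl
  have hW' : Measurable W := hW.mono hm le_rfl
  have hκ : ∀ n, Measurable[m] (fun ω => roundToZero n (W ω)) := fun n =>
    (measurable_roundToZero n).comp hW
  have hκ' : ∀ n, Measurable (fun ω => roundToZero n (W ω)) := fun n => (hκ n).mono hm le_rfl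
  have hreal : ∀ n, Measurable (fun ω => (roundToZero n (W ω) : ℝ) / (n + 1)) := fun n =>
    ((measurable_of_countable _).comp (hκ' n)).div_const _
  have hfun : ∀ (n : ℕ) (F : ℝ → Ω → ℝ≥0∞),
      ∫⁻ ω, H ω * F ((roundToZero n (W ω) : ℝ) / (n + 1)) ω ∂μ =
      ∑' k : ℤ, ∫⁻ ω, ((fun ω => roundToZero n (W ω)) ⁻¹' {k}).indicator H ω
        * F ((k : ℝ) / (n + 1)) ω ∂μ := fun n F => by
    have huniv : (univ : Set Ω) = ⋃ k : ℤ, (fun ω => roundToZero n (W ω)) ⁻¹' {k} := by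
      ext ω; simp
    rw [← setLIntegral_univ, huniv, lintegral_iUnion (fun k => hκ' n (measurableSet_singleton k))
      (fun i j hij => Disjoint.preimage _ (by simpa using hij))]
    refine tsum_congr fun k => ?_
    rw [← lintegral_indicator (hκ' n (measurableSet_singleton k))]
    refine lintegral_congr fun ω => ?_
    by_cases h : roundToZero n (W ω) = k
    · rw [indicator_of_mem (by exact h), indicator_of_mem (by exact h), h]
    · rw [indicator_of_notMem (by exact h), indicator_of_notMem (by exact h), zero_mul]
  have hn : ∀ n : ℕ, ∫⁻ ω, H ω *
      ENNReal.ofReal (Real.exp ((roundToZero n (W ω) : ℝ) / (n + 1) * ε ω)) ∂μ ≤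
      ∫⁻ ω, H ω * ENNReal.ofReal (Real.exp (W ω ^ 2 / 2)) ∂μ := fun n => by
    calc _ = ∑' k : ℤ, ∫⁻ ω, ((fun ω => roundToZero n (W ω)) ⁻¹' {k}).indicator H ω *
          ENNReal.ofReal (Real.exp ((k : ℝ) / (n + 1) * ε ω)) ∂μ :=
          hfun n fun x ω => ENNReal.ofReal (Real.exp (x * ε ω))
      _ ≤ ∑' k : ℤ, ∫⁻ ω, ((fun ω => roundToZero n (W ω)) ⁻¹' {k}).indicator H ω *
          ENNReal.ofReal (Real.exp (((k : ℝ) / (n + 1)) ^ 2 / 2)) ∂μ :=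
          ENNReal.tsum_le_tsum fun k => lintegral_mul_exp_le hm _ (hint _) (hsub _)
            (hH.indicator (hκ n (measurableSet_singleton k)))
      _ = ∫⁻ ω, H ω *
          ENNReal.ofReal (Real.exp (((roundToZero n (W ω) : ℝ) / (n + 1)) ^ 2 / 2)) ∂μ :=
          (hfun n fun x _ => ENNReal.ofReal (Real.exp (x ^ 2 / 2))).symm
      _ ≤ _ := by
          refine lintegral_mono fun ω => ?_
          gcongr H ω * ENNReal.ofReal (Real.exp (?_ / 2))
          exact sq_roundToZero_div_le n (W ω)
  have hlim : ∀ ω, Filter.Tendsto (fun n : ℕ => H ω *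
      ENNReal.ofReal (Real.exp ((roundToZero n (W ω) : ℝ) / (n + 1) * ε ω))) Filter.atTop
      (nhds (H ω * ENNReal.ofReal (Real.exp (W ω * ε ω)))) := fun ω => by
    refine ENNReal.Tendsto.const_mul (ENNReal.tendsto_ofReal ?_)
      (Or.inl (ENNReal.ofReal_pos.2 (Real.exp_pos _)).ne')
    exact (Real.continuous_exp.tendsto _).comp ((tendsto_roundToZero_div (W ω)).mul_const _)
  calc ∫⁻ ω, H ω * ENNReal.ofReal (Real.exp (W ω * ε ω)) ∂μ
      = ∫⁻ ω, Filter.liminf (fun n : ℕ => H ω *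
        ENNReal.ofReal (Real.exp ((roundToZero n (W ω) : ℝ) / (n + 1) * ε ω))) Filter.atTop ∂μ :=
        lintegral_congr fun ω => (hlim ω).liminf_eq.symm
    _ ≤ Filter.liminf (fun n : ℕ => ∫⁻ ω, H ω *
        ENNReal.ofReal (Real.exp ((roundToZero n (W ω) : ℝ) / (n + 1) * ε ω)) ∂μ) Filter.atTop :=
        lintegral_liminf_le fun n => hH'.mul
          (Real.measurable_exp.comp ((hreal n).mul hε)).ennreal_ofReal
    _ ≤ _ := Filter.liminf_le_of_le (by isBoundedDefault) fun b hb => by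
        obtain ⟨n, h⟩ := hb.exists
        exact h.trans (hn n)

/-- Two-sided tail bound of the noise. -/
theorem measure_lt_abs_noise_le (hm : m ≤ mΩ) (hε : Measurable ε)
    (hint : ∀ l : ℝ, Integrable (fun ω => Real.exp (l * ε ω)) μ)
    (hsub : ∀ l : ℝ, μ[fun ω => Real.exp (l * ε ω) | m] ≤ᵐ[μ] fun _ => Real.exp (l ^ 2 / 2))
    {L : ℝ} (hL : 0 ≤ L) :
    μ {ω | L < |ε ω|} ≤ ENNReal.ofReal (2 * Real.exp (-(L ^ 2 / 2))) := by
  have hone : ∀ l : ℝ, l ^ 2 = L ^ 2 → μ {ω | L ^ 2 ≤ l * ε ω} ≤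
      ENNReal.ofReal (Real.exp (-(L ^ 2 / 2))) := fun l hl => by
    have h1 := lintegral_mul_exp_le hm l (hint l) (hsub l) (H := 1) measurable_const
    simp only [Pi.one_apply, one_mul, lintegral_const, measure_univ, mul_one] at h1
    have h2 := mul_meas_ge_le_lintegral (μ := μ) (f := fun ω => ENNReal.ofReal
      (Real.exp (l * ε ω))) (Real.measurable_exp.comp (hε.const_mul l)).ennreal_ofReal
      (ENNReal.ofReal (Real.exp (L ^ 2)))
    have h3 : {ω | ENNReal.ofReal (Real.exp (L ^ 2)) ≤ ENNReal.ofReal (Real.exp (l * ε ω))} =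
        {ω | L ^ 2 ≤ l * ε ω} := by
      ext ω
      simp [ENNReal.ofReal_le_ofReal_iff (Real.exp_pos _).le]
    rw [h3] at h2
    have h4 := h2.trans h1
    rw [hl] at h4
    have h5 : ENNReal.ofReal (Real.exp (L ^ 2 / 2)) = ENNReal.ofReal (Real.exp (L ^ 2)) *
        ENNReal.ofReal (Real.exp (-(L ^ 2 / 2))) := by
      rw [← ENNReal.ofReal_mul (Real.exp_pos _).le, ← Real.exp_add]
      congr 2
      ring
    rw [h5] at h4
    exact (ENNReal.mul_le_mul_iff_right (ENNReal.ofReal_pos.2 (Real.exp_pos _)).ne'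
      ENNReal.ofReal_ne_top).1 h4
  have hsubset : {ω | L < |ε ω|} ⊆ {ω | L ^ 2 ≤ L * ε ω} ∪ {ω | L ^ 2 ≤ (-L) * ε ω} := by
    intro ω hω
    have hω' : L < |ε ω| := hω
    rcases lt_abs.1 hω' with h | h
    · left; simp only [mem_ofPred_eq]; nlinarith
    · right; simp only [mem_ofPred_eq]; nlinarith
  calc _ ≤ _ := measure_mono hsubset
    _ ≤ _ := measure_union_le _ _
    _ ≤ ENNReal.ofReal (Real.exp (-(L ^ 2 / 2))) + ENNReal.ofReal (Real.exp (-(L ^ 2 / 2))) :=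
        add_le_add (hone L rfl) (hone (-L) (by ring))
    _ = _ := by
        rw [← ENNReal.ofReal_add (Real.exp_pos _).le (Real.exp_pos _).le, two_mul]

end noise

/-! ### Signal and exponential moments of one gradient step -/

/-- The link function, extended from `[-1, 1]` to `ℝ` by constants. -/
noncomputable def clampedLink (f : ℝ → ℝ) (x : ℝ) : ℝ := f (max (-1) (min 1 x))

theorem clamp_mem (x : ℝ) : max (-1) (min 1 x) ∈ Icc (-1 : ℝ) 1 :=
  ⟨le_max_left _ _, max_le (by norm_num) (min_le_left _ _)⟩

theorem clampedLink_of_mem {f : ℝ → ℝ} {x : ℝ} (hx : x ∈ Icc (-1 : ℝ) 1) :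
    clampedLink f x = f x := by
  rw [clampedLink, min_eq_right hx.2, max_eq_right hx.1]

theorem monotone_clampedLink {f : ℝ → ℝ} (hf : MonotoneOn f (Icc (-1) 1)) :
    Monotone (clampedLink f) := fun x y hxy =>
  hf (clamp_mem x) (clamp_mem y) (max_le_max le_rfl (min_le_min le_rfl hxy))

theorem abs_clampedLink_le {f : ℝ → ℝ} (hf : ∀ x ∈ Icc (-1 : ℝ) 1, |f x| ≤ 1) (x : ℝ) :
    |clampedLink f x| ≤ 1 := hf _ (clamp_mem x)

section drift
variable {d : ℕ} {θ w : EuclideanSpace ℝ (Fin d)} {s q : ℝ}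

theorem abs_action_le_one (hsq : s ^ 2 + q ^ 2 = 1) (hθ : ‖θ‖ = 1) (hw : ‖w‖ = 1)
    {z : EuclideanSpace ℝ (Fin d)} (hz : ‖z‖ = 1) (hθz : inner ℝ θ z = 0) :
    |s * inner ℝ θ w + q * inner ℝ z w| ≤ 1 := by
  have hn : ‖s • θ + q • z‖ = 1 := by
    have h : ‖s • θ + q • z‖ ^ 2 = 1 := by
      rw [norm_add_sq_real, inner_smul_left, inner_smul_right, hθz, norm_smul, norm_smul, hθ, hz]
      simpa using hsq
    nlinarith [norm_nonneg (s • θ + q • z)]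
  have := abs_inner_le_one hn hw
  rwa [inner_add_left, inner_smul_left, inner_smul_left] at this

/-- The contributions of two opposite exploration directions, added up. -/
theorem clampedLink_diff_mul_ge {f : ℝ → ℝ} (hf : MonotoneOn f (Icc (-1) 1)) {κ c x : ℝ}
    (hc : c ∈ Icc (-1 : ℝ) 1) (hκ : ∀ y ∈ Icc c 1, κ * (y - c) ≤ f y - f c) (hq : 0 ≤ q)
    (hx : |c + q * x| ≤ 1) (hx' : |c - q * x| ≤ 1) :
    κ * q * x ^ 2 ≤ (clampedLink f (c + q * x) - clampedLink f (c - q * x)) * x := by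
  have hmono := monotone_clampedLink hf
  -- by symmetry it suffices to treat `x ≥ 0`
  have key : ∀ x : ℝ, 0 ≤ x → |c + q * x| ≤ 1 →
      κ * q * x ≤ clampedLink f (c + q * x) - clampedLink f (c - q * x) := fun x hx0 hx => by
    have hqx : 0 ≤ q * x := mul_nonneg hq hx0
    have h1 := hκ (c + q * x) ⟨by linarith, (abs_le.1 hx).2⟩
    have h2 := hmono (show c - q * x ≤ c by linarith)
    rw [clampedLink_of_mem hc] at h2
    rw [clampedLink_of_mem ⟨(abs_le.1 hx).1, (abs_le.1 hx).2⟩]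
    nlinarith
  rcases le_total 0 x with h | h
  · nlinarith [mul_le_mul_of_nonneg_right (key x h hx) h]
  · have h3 := key (-x) (by linarith) (by simpa [← sub_eq_add_neg] using hx')
    have h4 : c + q * -x = c - q * x := by ring
    have h5 : c - q * -x = c + q * x := by ring
    rw [h4, h5] at h3
    nlinarith [mul_le_mul_of_nonneg_right h3 (show 0 ≤ -x by linarith)]

/-- The signal in the gradient step: symmetrizing in the exploration direction turns the slope
bound of the link to the right of `s * ⟪θ, w⟫` into a correlation of the reward with
`⟪z, w⟫`. With `κ = 0` this says that the signal is never negative. -/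
theorem signal_lower_bound (hd : 3 ≤ d) (hθ : ‖θ‖ = 1) (hw : ‖w‖ = 1)
    (hs : 0 ≤ s) (hq : 0 ≤ q) (hsq : s ^ 2 + q ^ 2 = 1)
    {f : ℝ → ℝ} (hf : MonotoneOn f (Icc (-1) 1)) (hfb : ∀ x ∈ Icc (-1 : ℝ) 1, |f x| ≤ 1) {κ : ℝ}
    (hκ : ∀ y ∈ Icc (s * inner ℝ θ w) 1,
      κ * (y - s * inner ℝ θ w) ≤ f y - f (s * inner ℝ θ w)) (a : ℝ) :
    κ * q * ((1 - inner ℝ θ w ^ 2) / (d - 1)) / 2 ≤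
      ∫ z, (clampedLink f (s * inner ℝ θ w + q * inner ℝ z w) - a) * inner ℝ z w
        ∂(uniformOrthSphere θ) := by
  have hP := isProbabilityMeasure_uniformOrthSphere hd hθ
  have hfm : Measurable (clampedLink f) := (monotone_clampedLink hf).measurable
  set c : ℝ := s * inner ℝ θ w
  have hs1 : s ≤ 1 := by nlinarith [sq_nonneg q]
  have hc : c ∈ Icc (-1 : ℝ) 1 := by
    have h1 := abs_inner_le_one hθ hw
    have : |c| ≤ 1 := by
      rw [abs_mul, abs_of_nonneg hs]
      nlinarith [abs_nonneg (inner ℝ θ w : ℝ)]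
    exact abs_le.1 this
  set F : EuclideanSpace ℝ (Fin d) → ℝ := fun z =>
    clampedLink f (c + q * inner ℝ z w) * inner ℝ z w
  have hFint : Integrable F (uniformOrthSphere θ) :=
    integrable_of_bdd_on_uniformOrthSphere hd hθ (by fun_prop) 1 fun z hz _ => by
      rw [abs_mul]
      exact mul_le_one₀ (abs_clampedLink_le hfb _) (abs_nonneg _) (abs_inner_le_one hz hw)
  have hxint : Integrable (fun z => (inner ℝ z w : ℝ)) (uniformOrthSphere θ) :=
    integrable_of_bdd_on_uniformOrthSphere hd hθ (by fun_prop) 1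
      fun z hz _ => abs_inner_le_one hz hw
  have hFint' : Integrable (fun z => F (-z)) (uniformOrthSphere θ) :=
    integrable_of_bdd_on_uniformOrthSphere hd hθ (by fun_prop) 1 fun z hz _ => by
      rw [abs_mul]
      exact mul_le_one₀ (abs_clampedLink_le hfb _) (abs_nonneg _)
        (abs_inner_le_one (by simpa using hz) hw)
  have h1 : ∫ z, (clampedLink f (c + q * inner ℝ z w) - a) * inner ℝ z w ∂(uniformOrthSphere θ)
      = ∫ z, F z ∂(uniformOrthSphere θ) := by
    simp only [sub_mul]
    rw [integral_sub hFint (hxint.const_mul a), integral_const_mul,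
      integral_inner_uniformOrthSphere]
    simp [F]
  have h2 : ∫ z, (F z + F (-z)) ∂(uniformOrthSphere θ) = 2 * ∫ z, F z ∂(uniformOrthSphere θ) := by
    rw [integral_add hFint hFint', integral_neg_uniformOrthSphere]
    ring
  have h3 : ∫ z, κ * q * inner ℝ z w ^ 2 ∂(uniformOrthSphere θ) ≤
      ∫ z, (F z + F (-z)) ∂(uniformOrthSphere θ) := by
    refine integral_mono_ae ((integrable_sq_inner_uniformOrthSphere hd hθ w).const_mul _)
      (hFint.add hFint') ?_
    filter_upwards [ae_uniformOrthSphere θ] with z hz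
    have hp := abs_action_le_one hsq hθ hw hz.1 hz.2
    have hm := abs_action_le_one (z := -z) hsq hθ hw (by simpa using hz.1)
      (by simpa using hz.2)
    have h4 : s * inner ℝ θ w + q * inner ℝ (-z) w = c - q * inner ℝ z w := by
      rw [inner_neg_left]; ring
    rw [h4] at hm
    have h5 := clampedLink_diff_mul_ge hf hc hκ hq hp hm
    simp only [F, inner_neg_left]
    have h6 : c + q * -inner ℝ z w = c - q * inner ℝ z w := by ring
    rw [h6]
    linarith
  rw [integral_const_mul, integral_sq_inner_uniformOrthSphere hd hθ hw, h2] at h3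
  rw [h1]
  linarith

theorem exp_le_one_add_add_sq {y : ℝ} (hy : |y| ≤ 1) : Real.exp y ≤ 1 + y + y ^ 2 := by
  have := Real.abs_exp_sub_one_sub_id_le hy
  have := (abs_le.1 this).2
  linarith

/-- Exponential moment of the one-step progress over the exploration direction. -/
theorem integral_exp_progress_le (hd : 3 ≤ d) (hθ : ‖θ‖ = 1) (hw : ‖w‖ = 1)
    {b : EuclideanSpace ℝ (Fin d) → ℝ} (hb : Measurable b) (hb2 : ∀ z, |b z| ≤ 2)
    {D ν ρ : ℝ} (hD : D ≤ ∫ z, b z * inner ℝ z w ∂(uniformOrthSphere θ))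
    (hν : 0 ≤ ν) (hρ : 0 ≤ ρ) (hK : 2 * ν + ν ^ 2 / 2 + ρ ≤ 1) :
    ∫⁻ z, ENNReal.ofReal (Real.exp
        (-(ν * (b z * inner ℝ z w)) + ν ^ 2 * inner ℝ z w ^ 2 / 2 + ρ * |inner ℝ z w|))
        ∂(uniformOrthSphere θ) ≤
      ENNReal.ofReal (Real.exp (-(ν * D) + ρ * (1 / √(d - 1 : ℝ)) +
        (ν ^ 2 / 2 + (2 * ν + ν ^ 2 / 2 + ρ) ^ 2) / (d - 1))) := by
  have hP := isProbabilityMeasure_uniformOrthSphere hd hθ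
  have hd1 : (0 : ℝ) < d - 1 := by
    have : (3 : ℝ) ≤ d := by exact_mod_cast hd
    linarith
  set K := 2 * ν + ν ^ 2 / 2 + ρ
  set y : EuclideanSpace ℝ (Fin d) → ℝ := fun z =>
    -(ν * (b z * inner ℝ z w)) + ν ^ 2 * inner ℝ z w ^ 2 / 2 + ρ * |inner ℝ z w|
  have hym : Measurable y := by fun_prop
  have hyK : ∀ z, ‖z‖ = 1 → |y z| ≤ K * |inner ℝ z w| := fun z hz => by
    have hx := abs_inner_le_one hz hw
    set x : ℝ := inner ℝ z w
    have h1 : |ν * (b z * x)| ≤ ν * (2 * |x|) := by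
      rw [abs_mul, abs_mul, abs_of_nonneg hν]
      gcongr
      exact hb2 z
    have h2 : x ^ 2 ≤ |x| := by
      rw [← sq_abs]; nlinarith [abs_nonneg x]
    have h3 : ν ^ 2 * x ^ 2 / 2 ≤ ν ^ 2 / 2 * |x| := by nlinarith [sq_nonneg ν]
    have h4 : 0 ≤ ν ^ 2 * x ^ 2 / 2 := by positivity
    have h5 : 0 ≤ ρ * |x| := by positivity
    have h6 := abs_le.1 h1
    have h7 : K * |x| = ν * (2 * |x|) + ν ^ 2 / 2 * |x| + ρ * |x| := by simp only [K]; ring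
    rw [h7, abs_le]
    have h8 : 0 ≤ ν ^ 2 / 2 * |x| := by positivity
    constructor
    · simp only [y]; linarith [h6.2]
    · simp only [y]; linarith [h6.1]
  have hK0 : 0 ≤ K := by positivity
  have hy1 : ∀ z, ‖z‖ = 1 → |y z| ≤ 1 := fun z hz =>
    (hyK z hz).trans (mul_le_one₀ hK (abs_nonneg _) (abs_inner_le_one hz hw))
  have hexpint : Integrable (fun z => Real.exp (y z)) (uniformOrthSphere θ) :=
    integrable_of_bdd_on_uniformOrthSphere hd hθ (by fun_prop) (Real.exp 1) fun z hz _ => by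
      rw [abs_of_pos (Real.exp_pos _)]
      exact Real.exp_le_exp.2 ((le_abs_self _).trans (hy1 z hz))
  rw [← ofReal_integral_eq_lintegral_ofReal hexpint
    (Filter.Eventually.of_forall fun _ => (Real.exp_pos _).le)]
  refine ENNReal.ofReal_le_ofReal ?_
  have hbx : Integrable (fun z => b z * inner ℝ z w) (uniformOrthSphere θ) :=
    integrable_of_bdd_on_uniformOrthSphere hd hθ (by fun_prop) 2 fun z hz _ => by
      rw [abs_mul]
      nlinarith [hb2 z, abs_inner_le_one hz hw, abs_nonneg (b z),
        abs_nonneg (inner ℝ z w : ℝ)]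
  have hax : Integrable (fun z => |(inner ℝ z w : ℝ)|) (uniformOrthSphere θ) :=
    integrable_of_bdd_on_uniformOrthSphere hd hθ (by fun_prop) 1 fun z hz _ => by
      rw [abs_abs]; exact abs_inner_le_one hz hw
  have hx2 := integrable_sq_inner_uniformOrthSphere hd hθ w
  have hi1 : Integrable (fun z => 1 + -ν * (b z * inner ℝ z w)) (uniformOrthSphere θ) :=
    (integrable_const _).add (hbx.const_mul _)
  have hi2 : Integrable (fun z => 1 + -ν * (b z * inner ℝ z w) + ρ * |inner ℝ z w|)
      (uniformOrthSphere θ) := hi1.add (hax.const_mul _)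
  calc ∫ z, Real.exp (y z) ∂(uniformOrthSphere θ)
      ≤ ∫ z, (1 + -ν * (b z * inner ℝ z w) + ρ * |inner ℝ z w|
          + (ν ^ 2 / 2 + K ^ 2) * inner ℝ z w ^ 2) ∂(uniformOrthSphere θ) := by
        refine integral_mono_ae hexpint (hi2.add (hx2.const_mul _)) ?_
        filter_upwards [ae_uniformOrthSphere θ] with z hz
        have h1 := exp_le_one_add_add_sq (hy1 z hz.1)
        have h2 : y z ^ 2 ≤ K ^ 2 * inner ℝ z w ^ 2 := by
          rw [← mul_pow, ← sq_abs (y z), ← sq_abs (K * _), abs_mul, abs_of_nonneg hK0]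
          exact pow_le_pow_left₀ (abs_nonneg _) (hyK z hz.1) 2
        simp only [y] at h1 h2 ⊢
        linarith
    _ = 1 + -ν * ∫ z, b z * inner ℝ z w ∂(uniformOrthSphere θ)
          + ρ * ∫ z, |inner ℝ z w| ∂(uniformOrthSphere θ)
          + (ν ^ 2 / 2 + K ^ 2) * ((1 - inner ℝ θ w ^ 2) / (d - 1)) := by
        rw [integral_add hi2 (hx2.const_mul _), integral_add hi1 (hax.const_mul _),
          integral_add (integrable_const _) (hbx.const_mul _),
          integral_const_mul, integral_const_mul, integral_const_mul,
          integral_sq_inner_uniformOrthSphere hd hθ hw]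
        simp
    _ ≤ 1 + (-(ν * D) + ρ * (1 / √(d - 1 : ℝ)) + (ν ^ 2 / 2 + K ^ 2) / (d - 1)) := by
        have h1 := mul_le_mul_of_nonneg_left hD hν
        have h2 := mul_le_mul_of_nonneg_left (integral_abs_inner_uniformOrthSphere_le hd hθ hw) hρ
        have h3 : (ν ^ 2 / 2 + K ^ 2) * ((1 - inner ℝ θ w ^ 2) / (d - 1)) ≤
            (ν ^ 2 / 2 + K ^ 2) / (d - 1) := by
          rw [← mul_div_assoc]
          refine div_le_div_of_nonneg_right ?_ hd1.le
          have : 0 ≤ ν ^ 2 / 2 + K ^ 2 := by positivity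
          nlinarith [sq_nonneg (inner ℝ θ w : ℝ)]
        linarith
    _ ≤ _ := by
        rw [add_comm]
        exact Real.add_one_le_exp _

end drift

theorem mul_ofReal_exp_mul (h : ℝ≥0∞) (x y : ℝ) :
    h * ENNReal.ofReal (Real.exp x) * ENNReal.ofReal (Real.exp y) =
      h * ENNReal.ofReal (Real.exp (x + y)) := by
  rw [mul_assoc, ← ENNReal.ofReal_mul (Real.exp_pos _).le, ← Real.exp_add]

section step
variable {d : ℕ} {Ω : Type*} {m mΩ : MeasurableSpace Ω} {μ : Measure Ω}
  [IsProbabilityMeasure μ] {θ Z : Ω → EuclideanSpace ℝ (Fin d)} {ε : Ω → ℝ}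
  {w : EuclideanSpace ℝ (Fin d)}

/-- Exponential supermartingale step. The progress is `α (b + ε) ⟪Z, w⟫ - β |⟪Z, w⟫|`, where
`α` is the effective step size, `b` the noiseless residual and `β |⟪Z, w⟫|` the loss from
normalization; its compensator is `α D - β / √(d - 1)`. -/
theorem lintegral_mul_exp_progress_le (hd : 3 ≤ d) (hm : m ≤ mΩ)
    (hθm : Measurable[m] θ) (hZ : Measurable Z) (hε : Measurable ε)
    (hθ : ∀ᵐ ω ∂μ, ‖θ ω‖ = 1) (hw : ‖w‖ = 1)
    (hlaw : ∀ A : Set Ω, MeasurableSet[m] A → ∀ B : Set (EuclideanSpace ℝ (Fin d)),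
      MeasurableSet B → μ (A ∩ Z ⁻¹' B) = ∫⁻ ω in A, uniformOrthSphere (θ ω) B ∂μ)
    (hint : ∀ l : ℝ, Integrable (fun ω => Real.exp (l * ε ω)) μ)
    (hsub : ∀ l : ℝ, μ[fun ω => Real.exp (l * ε ω) | m ⊔ MeasurableSpace.comap Z inferInstance]
      ≤ᵐ[μ] fun _ => Real.exp (l ^ 2 / 2))
    {b : EuclideanSpace ℝ (Fin d) × EuclideanSpace ℝ (Fin d) → ℝ} (hb : Measurable b)
    (hb2 : ∀ p, |b p| ≤ 2) {D : EuclideanSpace ℝ (Fin d) → ℝ} (hDm : Measurable D)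
    (hD : ∀ x, ‖x‖ = 1 → D x ≤ ∫ z, b (x, z) * inner ℝ z w ∂(uniformOrthSphere x))
    {α β l : ℝ} (hα : 0 ≤ α) (hβ : 0 ≤ β) (hl : 0 ≤ l)
    (hK : 2 * (l * α) + (l * α) ^ 2 / 2 + l * β ≤ 1)
    {H : Ω → ℝ≥0∞} (hH : Measurable[m] H) :
    ∫⁻ ω, H ω * ENNReal.ofReal (Real.exp (-(l * (α * (b (θ ω, Z ω) + ε ω) * inner ℝ (Z ω) w
        - β * |inner ℝ (Z ω) w| - (α * D (θ ω) - β * (1 / √(d - 1 : ℝ))))))) ∂μ ≤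
      ENNReal.ofReal (Real.exp (((l * α) ^ 2 / 2 + (2 * (l * α) + (l * α) ^ 2 / 2 + l * β) ^ 2) /
        (d - 1))) * ∫⁻ ω, H ω ∂μ := by
  set 𝒢 := m ⊔ MeasurableSpace.comap Z inferInstance
  have hZ𝒢 : Measurable[𝒢] Z := (comap_measurable Z).mono le_sup_right le_rfl
  have hθ𝒢 : Measurable[𝒢] θ := hθm.mono le_sup_left le_rfl
  have h𝒢 : 𝒢 ≤ mΩ := sup_le hm hZ.comap_le
  have hwm : Measurable fun z : EuclideanSpace ℝ (Fin d) => (inner ℝ z w : ℝ) := by fun_prop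
  set Φ : (ℝ≥0∞ × EuclideanSpace ℝ (Fin d)) × EuclideanSpace ℝ (Fin d) → ℝ≥0∞ := fun p =>
    p.1.1 * ENNReal.ofReal (Real.exp (l * (α * D p.1.2 - β * (1 / √(d - 1 : ℝ))) +
      (-((l * α) * (b (p.1.2, p.2) * inner ℝ p.2 w)) + (l * β) * |inner ℝ p.2 w|)))
  have hΦ : Measurable Φ := by
    have hb' : Measurable fun p : (ℝ≥0∞ × EuclideanSpace ℝ (Fin d)) × EuclideanSpace ℝ (Fin d) =>
      b (p.1.2, p.2) := hb.comp (by fun_prop)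
    fun_prop
  set Ψ : (ℝ≥0∞ × EuclideanSpace ℝ (Fin d)) × EuclideanSpace ℝ (Fin d) → ℝ≥0∞ := fun p =>
    Φ p * ENNReal.ofReal (Real.exp ((-(l * α) * inner ℝ p.2 w) ^ 2 / 2))
  have hΨ : Measurable Ψ := by fun_prop
  have hHΦ : Measurable[𝒢] fun ω => Φ ((H ω, θ ω), Z ω) :=
    hΦ.comp (((hH.mono le_sup_left le_rfl).prodMk hθ𝒢).prodMk hZ𝒢)
  have hW : Measurable[𝒢] fun ω => -(l * α) * (inner ℝ (Z ω) w : ℝ) :=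
    (hwm.comp hZ𝒢).const_mul _
  calc _ = ∫⁻ ω, Φ ((H ω, θ ω), Z ω) *
        ENNReal.ofReal (Real.exp (-(l * α) * inner ℝ (Z ω) w * ε ω)) ∂μ := by
        refine lintegral_congr fun ω => ?_
        simp only [Φ]
        rw [mul_ofReal_exp_mul]
        congr 3
        ring
    _ ≤ ∫⁻ ω, Ψ ((H ω, θ ω), Z ω) ∂μ :=
        lintegral_mul_exp_mul_le h𝒢 hε hint hsub hHΦ hW
    _ = ∫⁻ ω, ∫⁻ z, Ψ ((H ω, θ ω), z) ∂(uniformOrthSphere (θ ω)) ∂μ :=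
        lintegral_disintegrate hd hm hθm hZ hH hθ hlaw hw hΨ
    _ ≤ ∫⁻ ω, ENNReal.ofReal (Real.exp (((l * α) ^ 2 / 2 +
          (2 * (l * α) + (l * α) ^ 2 / 2 + l * β) ^ 2) / (d - 1))) * H ω ∂μ := by
        refine lintegral_mono_ae ?_
        filter_upwards [hθ] with ω hω
        have h1 := integral_exp_progress_le hd hω hw (b := fun z => b (θ ω, z))
          (hb.comp measurable_prodMk_left) (fun z => hb2 _) (hD _ hω)
          (mul_nonneg hl hα) (mul_nonneg hl hβ) hK
        have h2 : ∀ z, Ψ ((H ω, θ ω), z) = H ω * ENNReal.ofReal (Real.exp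
            (l * (α * D (θ ω) - β * (1 / √(d - 1 : ℝ))))) * ENNReal.ofReal (Real.exp
            (-((l * α) * (b (θ ω, z) * inner ℝ z w)) + (l * α) ^ 2 * inner ℝ z w ^ 2 / 2
              + (l * β) * |inner ℝ z w|)) := fun z => by
          simp only [Ψ, Φ]
          rw [mul_ofReal_exp_mul, mul_ofReal_exp_mul]
          congr 3
          ring
        simp only [h2]
        rw [lintegral_const_mul _ (by
          have : Measurable fun z => b (θ ω, z) := hb.comp measurable_prodMk_left
          fun_prop)]
        refine (mul_le_mul_right h1 _).trans (le_of_eq ?_)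
        rw [mul_ofReal_exp_mul, mul_comm]
        congr 3
        ring
    _ = _ := lintegral_const_mul _ (hH.mono hm le_rfl)

end step

/-! ### Supermartingale deviation bound and the normalized step -/

section supermartingale
variable {Ω : Type*} {mΩ : MeasurableSpace Ω} {μ : Measure Ω} [IsProbabilityMeasure μ]
  {ℱ : Filtration ℕ mΩ} {ξ : ℕ → Ω → ℝ} {v : ℕ → ℝ} {l : ℝ} {T : ℕ}

/-- A product of one-step exponential bounds that hold against every nonnegative observable of the
past. -/
theorem lintegral_exp_neg_sum_le
    (hξ : ∀ i, 1 ≤ i → Measurable[ℱ (i + 1)] (ξ i))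
    (hstep : ∀ i ∈ Finset.Ico 1 T, ∀ H : Ω → ℝ≥0∞, Measurable[ℱ i] H →
      ∫⁻ ω, H ω * ENNReal.ofReal (Real.exp (-(l * ξ i ω))) ∂μ ≤
        ENNReal.ofReal (Real.exp (v i)) * ∫⁻ ω, H ω ∂μ)
    {s t : ℕ} (hs : 1 ≤ s) (hst : s ≤ t) (htT : t ≤ T) :
    Measurable[ℱ t] (fun ω => ∑ i ∈ Finset.Ico s t, ξ i ω) ∧
    ∫⁻ ω, ENNReal.ofReal (Real.exp (-(l * ∑ i ∈ Finset.Ico s t, ξ i ω))) ∂μ ≤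
      ENNReal.ofReal (Real.exp (∑ i ∈ Finset.Ico s t, v i)) := by
  induction t, hst using Nat.le_induction with
  | base => simp
  | succ t hst ih =>
    obtain ⟨hm, hle⟩ := ih (by omega)
    have hH : Measurable[ℱ t] fun ω =>
        ENNReal.ofReal (Real.exp (-(l * ∑ i ∈ Finset.Ico s t, ξ i ω))) :=
      (Real.measurable_exp.comp (hm.const_mul l).neg).ennreal_ofReal
    simp only [Finset.sum_Ico_succ_top hst]
    refine ⟨(hm.mono (ℱ.mono (Nat.le_succ t)) le_rfl).add (hξ t (by omega)), ?_⟩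
    calc _ = ∫⁻ ω, ENNReal.ofReal (Real.exp (-(l * ∑ i ∈ Finset.Ico s t, ξ i ω))) *
          ENNReal.ofReal (Real.exp (-(l * ξ t ω))) ∂μ := by
          refine lintegral_congr fun ω => ?_
          rw [← ENNReal.ofReal_mul (Real.exp_pos _).le, ← Real.exp_add]
          congr 2
          ring
      _ ≤ ENNReal.ofReal (Real.exp (v t)) * _ :=
          hstep t (Finset.mem_Ico.2 ⟨by omega, by omega⟩) _ hH
      _ ≤ ENNReal.ofReal (Real.exp (v t)) *
            ENNReal.ofReal (Real.exp (∑ i ∈ Finset.Ico s t, v i)) := by gcongr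
      _ = _ := by
          rw [← ENNReal.ofReal_mul (Real.exp_pos _).le, ← Real.exp_add, add_comm]

/-- Chernoff bound for the sum of the `ξ i` over a block of rounds. -/
theorem measure_sum_lt_le
    (hξ : ∀ i, 1 ≤ i → Measurable[ℱ (i + 1)] (ξ i)) (hl : 0 ≤ l)
    (hstep : ∀ i ∈ Finset.Ico 1 T, ∀ H : Ω → ℝ≥0∞, Measurable[ℱ i] H →
      ∫⁻ ω, H ω * ENNReal.ofReal (Real.exp (-(l * ξ i ω))) ∂μ ≤
        ENNReal.ofReal (Real.exp (v i)) * ∫⁻ ω, H ω ∂μ)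
    {s t : ℕ} (hs : 1 ≤ s) (hst : s ≤ t) (htT : t ≤ T) (x : ℝ) :
    μ {ω | ∑ i ∈ Finset.Ico s t, ξ i ω < -x} ≤
      ENNReal.ofReal (Real.exp (∑ i ∈ Finset.Ico s t, v i - l * x)) := by
  obtain ⟨hm, hle⟩ := lintegral_exp_neg_sum_le hξ hstep hs hst htT
  have hm' : Measurable (fun ω => ∑ i ∈ Finset.Ico s t, ξ i ω) := hm.mono (ℱ.le t) le_rfl
  have h2 := mul_meas_ge_le_lintegral (μ := μ) (f := fun ω => ENNReal.ofReal
    (Real.exp (-(l * ∑ i ∈ Finset.Ico s t, ξ i ω))))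
    (Real.measurable_exp.comp (hm'.const_mul l).neg).ennreal_ofReal
    (ENNReal.ofReal (Real.exp (l * x)))
  have h4 := h2.trans hle
  have h5 : ENNReal.ofReal (Real.exp (∑ i ∈ Finset.Ico s t, v i)) =
      ENNReal.ofReal (Real.exp (l * x)) *
        ENNReal.ofReal (Real.exp (∑ i ∈ Finset.Ico s t, v i - l * x)) := by
    rw [← ENNReal.ofReal_mul (Real.exp_pos _).le, ← Real.exp_add]
    congr 2
    ring
  rw [h5] at h4
  refine (measure_mono fun ω hω => ?_).trans
    ((ENNReal.mul_le_mul_iff_right (ENNReal.ofReal_pos.2 (Real.exp_pos _)).ne'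
      ENNReal.ofReal_ne_top).1 h4)
  have hω' : ∑ i ∈ Finset.Ico s t, ξ i ω < -x := hω
  refine ENNReal.ofReal_le_ofReal (Real.exp_le_exp.2 ?_)
  nlinarith

end supermartingale

/-- Normalization costs at most a quadratic term in the step length `p`. -/
theorem normalized_step_lower_bound {m x : ℝ} (p : ℝ) (hm : 0 ≤ m) :
    m + p * x - p ^ 2 * (m / 2 + |x|) ≤ (√(1 + p ^ 2))⁻¹ * (m + p * x) := by
  set n := √(1 + p ^ 2)
  have hn2 : n ^ 2 = 1 + p ^ 2 := Real.sq_sqrt (by positivity)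
  have hn0 : 0 < n := Real.sqrt_pos.2 (by positivity)
  have hn1 : 1 ≤ n := by nlinarith [sq_nonneg p]
  have hp : |p| ^ 2 = p ^ 2 := sq_abs p
  have h0 : n⁻¹ ≤ 1 := inv_le_one_of_one_le₀ hn1
  have hmul : n⁻¹ * n = 1 := inv_mul_cancel₀ hn0.ne'
  have hninv : 0 < n⁻¹ := inv_pos.2 hn0
  have h1 : 1 - n⁻¹ ≤ p ^ 2 / 2 := by
    have : n ≤ 1 + p ^ 2 / 2 := by nlinarith [sq_nonneg (p ^ 2)]
    nlinarith [mul_le_mul_of_nonneg_left this hninv.le]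
  have h2 : 1 - n⁻¹ ≤ |p| := by
    have : n ≤ 1 + |p| := by nlinarith [abs_nonneg p]
    nlinarith [mul_le_mul_of_nonneg_left this hninv.le, abs_nonneg p]
  have h3 : (1 - n⁻¹) * (p * x) ≤ |p| * (|p| * |x|) := by
    calc (1 - n⁻¹) * (p * x) ≤ (1 - n⁻¹) * (|p| * |x|) := by
          rw [← abs_mul]
          exact mul_le_mul_of_nonneg_left (le_abs_self _) (by linarith)
      _ ≤ _ := by gcongr
  have h4 : (1 - n⁻¹) * m ≤ p ^ 2 / 2 * m := by gcongr
  have h5 : |p| * (|p| * |x|) = p ^ 2 * |x| := by rw [← hp]; ring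
  linarith

section sgd
variable {d : ℕ} {Ω : Type*} {mΩ : MeasurableSpace Ω} {μ : Measure Ω} {f : ℝ → ℝ}
  {w : EuclideanSpace ℝ (Fin d)} {η : ℕ → ℝ} {γ₀ γ₁ γ₂ : ℝ} {ℱ : Filtration ℕ mΩ}
  {θ Z a : ℕ → Ω → EuclideanSpace ℝ (Fin d)} {ε r : ℕ → Ω → ℝ}

/-- The factor `f'(√(1 - γ₀)) √γ₀` that multiplies learning rate and residual in the gradient
step, whose direction is the exploration direction. -/
noncomputable def stepGain (f : ℝ → ℝ) (γ₀ : ℝ) : ℝ := linkDeriv f √(1 - γ₀) * √γ₀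

/-- The noiseless residual, as a function of the iterate and the exploration direction. -/
noncomputable def signalResidual (f : ℝ → ℝ) (γ₀ : ℝ) (w : EuclideanSpace ℝ (Fin d))
    (p : EuclideanSpace ℝ (Fin d) × EuclideanSpace ℝ (Fin d)) : ℝ :=
  clampedLink f (√(1 - γ₀) * inner ℝ p.1 w + √γ₀ * inner ℝ p.2 w) - f √(1 - γ₀)

theorem sqrt_one_sub_mem (h0 : 0 < γ₀) (h1 : γ₀ ≤ 0.1) :
    √(1 - γ₀) ∈ Icc (1 - γ₀) 1 := by
  constructor
  · refine Real.le_sqrt_of_sq_le ?_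
    norm_num at h1
    nlinarith
  · exact Real.sqrt_le_one.2 (by linarith)

theorem sq_sqrt_add_sq_sqrt (h0 : 0 < γ₀) (h1 : γ₀ ≤ 0.1) : √(1 - γ₀) ^ 2 + √γ₀ ^ 2 = 1 := by
  norm_num at h1
  rw [Real.sq_sqrt (by linarith), Real.sq_sqrt h0.le]
  ring

theorem stepGain_bounds (hL : LinkAssumption f γ₀ γ₁ γ₂) (h0 : 0 < γ₀) (h1 : γ₀ ≤ 0.1)
    (hγ₁ : 0 < γ₁) (hγ₂ : 0 < γ₂) :
    0 < stepGain f γ₀ ∧ γ₁ * √γ₀ ≤ stepGain f γ₀ ∧ stepGain f γ₀ ≤ γ₂ * √γ₀ ∧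
      stepGain f γ₀ ≤ γ₂ := by
  have h := hL.locallyLinear _ (sqrt_one_sub_mem h0 h1)
  have hq : 0 < √γ₀ := Real.sqrt_pos.2 h0
  have hq1 : √γ₀ ≤ 1 := Real.sqrt_le_one.2 (by norm_num at h1; linarith)
  have h2 : stepGain f γ₀ ≤ γ₂ * √γ₀ := mul_le_mul_of_nonneg_right h.2 hq.le
  exact ⟨mul_pos (hγ₁.trans_le h.1) hq, mul_le_mul_of_nonneg_right h.1 hq.le, h2,
    h2.trans (by nlinarith)⟩

theorem measurable_residual (hL : LinkAssumption f γ₀ γ₁ γ₂)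
    (w : EuclideanSpace ℝ (Fin d)) : Measurable (signalResidual f γ₀ w) := by
  have : Measurable (clampedLink f) := (monotone_clampedLink hL.mono).measurable
  unfold signalResidual
  fun_prop

theorem abs_residual_le (hL : LinkAssumption f γ₀ γ₁ γ₂) (h0 : 0 < γ₀) (h1 : γ₀ ≤ 0.1)
    (p : EuclideanSpace ℝ (Fin d) × EuclideanSpace ℝ (Fin d)) : |signalResidual f γ₀ w p| ≤ 2 := by
  have h2 := abs_clampedLink_le hL.bound
    (√(1 - γ₀) * inner ℝ p.1 w + √γ₀ * inner ℝ p.2 w)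
  have h3 := hL.bound √(1 - γ₀) ⟨by linarith [Real.sqrt_nonneg (1 - γ₀)],
    (sqrt_one_sub_mem h0 h1).2⟩
  unfold signalResidual
  rw [abs_le] at h2 h3 ⊢
  constructor <;> linarith

/-- The gradient step moves the iterate along the exploration direction, because the projection
of the action orthogonal to `θ t` is `√γ₀ • Z t`. -/
theorem IsSGD.update_eq (h : IsSGD μ f w η (fun _ => √γ₀) ℱ θ Z a ε r)
    (h0 : 0 < γ₀) (h1 : γ₀ ≤ 0.1) (hw : ‖w‖ = 1) {t : ℕ} (ht : 1 ≤ t) {ω : Ω}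
    (hθ : ‖θ t ω‖ = 1) (hZ : ‖Z t ω‖ = 1) (hθZ : inner ℝ (θ t ω) (Z t ω) = 0) :
    ∃ p, p = η t * stepGain f γ₀ * (signalResidual f γ₀ w (θ t ω, Z t ω) + ε t ω) ∧
      θ (t + 1) ω = ‖θ t ω + p • Z t ω‖⁻¹ • (θ t ω + p • Z t ω) := by
  obtain ⟨θhalf, hhalf, hnext⟩ := h.update t ht ω
  have hact : a t ω = √(1 - γ₀) • θ t ω + √γ₀ • Z t ω := by
    rw [h.action t ht ω, Real.sq_sqrt h0.le]
  have hinner : inner ℝ (θ t ω) (a t ω) = √(1 - γ₀) := by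
    rw [hact, inner_add_right, inner_smul_right, inner_smul_right, hθZ,
      real_inner_self_eq_norm_sq, hθ]
    ring
  have hsig : inner ℝ w (a t ω) = √(1 - γ₀) * inner ℝ (θ t ω) w + √γ₀ * inner ℝ (Z t ω) w := by
    rw [hact, inner_add_right, inner_smul_right, inner_smul_right, real_inner_comm w,
      real_inner_comm w]
  have hmem := abs_le.1 (abs_action_le_one (sq_sqrt_add_sq_sqrt h0 h1) hθ hw hZ hθZ)
  refine ⟨_, rfl, ?_⟩
  rw [hnext]
  have : θhalf = θ t ω + (η t * stepGain f γ₀ *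
      (signalResidual f γ₀ w (θ t ω, Z t ω) + ε t ω)) • Z t ω := by
    rw [hhalf, hinner, h.reward t ht ω, hsig, signalResidual,
      clampedLink_of_mem ⟨hmem.1, hmem.2⟩, hact, add_sub_cancel_left, smul_smul, stepGain,
      sub_eq_add_neg, ← neg_smul]
    congr 2
    ring
  rw [this]

theorem norm_add_smul_of_orth {x z : EuclideanSpace ℝ (Fin d)} (hx : ‖x‖ = 1) (hz : ‖z‖ = 1)
    (hxz : inner ℝ x z = 0) (p : ℝ) : ‖x + p • z‖ = √(1 + p ^ 2) := by
  rw [eq_comm, Real.sqrt_eq_iff_mul_self_eq (by positivity) (norm_nonneg _), ← sq,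
    norm_add_sq_real, inner_smul_right, hxz, norm_smul, hx, hz]
  simp

theorem IsSGD.ae_unit [IsProbabilityMeasure μ] (h : IsSGD μ f w η (fun _ => √γ₀) ℱ θ Z a ε r)
    (hd : 3 ≤ d) (h0 : 0 < γ₀) (h1 : γ₀ ≤ 0.1) (hw : ‖w‖ = 1) {t : ℕ} (ht : 1 ≤ t) :
    ∀ᵐ ω ∂μ, ‖θ t ω‖ = 1 ∧ ‖Z t ω‖ = 1 ∧ inner ℝ (θ t ω) (Z t ω) = 0 := by
  have hdir : ∀ t, 1 ≤ t → (∀ᵐ ω ∂μ, ‖θ t ω‖ = 1) →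
      ∀ᵐ ω ∂μ, ‖Z t ω‖ = 1 ∧ inner ℝ (θ t ω) (Z t ω) = 0 := fun t ht hθ =>
    ae_direction hd (ℱ.le t) (h.measurable_iterate t ht)
      ((h.measurable_direction t ht).mono (ℱ.le _) le_rfl) hθ (h.direction_law t ht) hw
  have hnorm : ∀ᵐ ω ∂μ, ‖θ t ω‖ = 1 := by
    induction t, ht using Nat.le_induction with
    | base => exact h.init_norm
    | succ t ht ih =>
      filter_upwards [ih, hdir t ht ih] with ω h2 h3
      obtain ⟨p, -, hp⟩ := h.update_eq h0 h1 hw ht h2 h3.1 h3.2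
      have hpos : 0 < ‖θ t ω + p • Z t ω‖ := by
        rw [norm_add_smul_of_orth h2 h3.1 h3.2]
        exact Real.sqrt_pos.2 (by positivity)
      rw [hp, norm_smul, norm_inv, norm_norm, inv_mul_cancel₀ hpos.ne']
  filter_upwards [hnorm, hdir t ht hnorm] with ω h2 h3
  exact ⟨h2, h3⟩

/-- One-round lower bound of the new correlation: linear progress minus the normalization loss,
when the squared residual is bounded by `B`. -/
theorem IsSGD.inner_succ_ge (h : IsSGD μ f w η (fun _ => √γ₀) ℱ θ Z a ε r)
    (h0 : 0 < γ₀) (h1 : γ₀ ≤ 0.1) (hw : ‖w‖ = 1) {t : ℕ} (ht : 1 ≤ t) {ω : Ω}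
    (hθ : ‖θ t ω‖ = 1) (hZ : ‖Z t ω‖ = 1) (hθZ : inner ℝ (θ t ω) (Z t ω) = 0)
    (hm : 0 ≤ inner ℝ (θ t ω) w) {B : ℝ}
    (hB : (stepGain f γ₀ * (signalResidual f γ₀ w (θ t ω, Z t ω) + ε t ω)) ^ 2 ≤ B) :
    inner ℝ (θ t ω) w + (η t * stepGain f γ₀ * (signalResidual f γ₀ w (θ t ω, Z t ω) + ε t ω)
      * inner ℝ (Z t ω) w - η t ^ 2 * B * |inner ℝ (Z t ω) w|)
      - η t ^ 2 * B * inner ℝ (θ t ω) w ≤ inner ℝ (θ (t + 1) ω) w := by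
  obtain ⟨p, hp, hnext⟩ := h.update_eq h0 h1 hw ht hθ hZ hθZ
  have hstep := normalized_step_lower_bound (x := inner ℝ (Z t ω) w) p hm
  have hp2 : p ^ 2 ≤ η t ^ 2 * B := by
    rw [hp, mul_assoc, mul_pow]
    gcongr
  rw [hnext, inner_smul_left, inner_add_left, inner_smul_left,
    norm_add_smul_of_orth hθ hZ hθZ]
  simp only [conj_trivial]
  refine le_trans ?_ hstep
  have h2 := mul_le_mul_of_nonneg_right hp2
    (show 0 ≤ inner ℝ (θ t ω) w / 2 + |(inner ℝ (Z t ω) w : ℝ)| by positivity)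
  have h3 : 0 ≤ η t ^ 2 * B := (sq_nonneg p).trans hp2
  rw [hp] at h2 ⊢
  nlinarith [mul_nonneg h3 hm]

end sgd

/-! ### The good event -/

section logs
variable {d : ℕ} {δ : ℝ}

theorem one_le_log_div (hd : 3 ≤ d) (hδ : 0 < δ) (hδ1 : δ < 1) : 1 ≤ Real.log (d / δ) := by
  have hd' : (3 : ℝ) ≤ d := by exact_mod_cast hd
  rw [Real.le_log_iff_exp_le (by positivity)]
  have h1 := Real.exp_one_lt_d9
  have h2 : (d : ℝ) ≤ d / δ := by rw [le_div_iff₀ hδ]; nlinarith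
  linarith

theorem log_four_div_le (hd : 3 ≤ d) (hδ : 0 < δ) (hδ1 : δ < 1) :
    Real.log (4 / δ) ≤ 2 * Real.log (d / δ) := by
  have hd' : (3 : ℝ) ≤ d := by exact_mod_cast hd
  have h : 2 * Real.log (d / δ) = Real.log ((d / δ) ^ 2) := by rw [Real.log_pow]; norm_num
  rw [h]
  refine Real.log_le_log (by positivity) ?_
  rw [div_pow, div_le_div_iff₀ hδ (by positivity)]
  have h2 : (9 : ℝ) ≤ (d : ℝ) ^ 2 := by nlinarith
  nlinarith [mul_pos hδ hδ, mul_le_mul_of_nonneg_right h2 hδ.le]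

theorem exp_neg_three_log (hd : 3 ≤ d) (hδ : 0 < δ) :
    Real.exp (-(3 * Real.log (d / δ))) ≤ δ ^ 3 / 27 := by
  have hd' : (3 : ℝ) ≤ d := by exact_mod_cast hd
  have h : 3 * Real.log (d / δ) = Real.log ((d / δ) ^ 3) := by rw [Real.log_pow]; norm_num
  rw [h, Real.exp_neg, Real.exp_log (by positivity), div_pow, inv_div]
  have : (27 : ℝ) ≤ (d : ℝ) ^ 3 := by
    calc (27 : ℝ) = 3 ^ 3 := by norm_num
      _ ≤ _ := by gcongr
  gcongr

end logs

section good_event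
variable {d : ℕ} {Ω : Type*} {mΩ : MeasurableSpace Ω} {μ : Measure Ω} {f : ℝ → ℝ}
  {w : EuclideanSpace ℝ (Fin d)} {η : ℕ → ℝ} {γ₀ γ₁ γ₂ δ : ℝ} {ℱ : Filtration ℕ mΩ}
  {θ Z a : ℕ → Ω → EuclideanSpace ℝ (Fin d)} {ε r : ℕ → Ω → ℝ} {T : ℕ} {lo κ : ℕ → ℝ}

/-- A lower bound of the signal at the iterate `x`: it is positive on the correlation window
`[b, 1 - γ₀ / 8]`, on which the link has slope at least `k`. -/
noncomputable def windowDrift (γ₀ : ℝ) (w : EuclideanSpace ℝ (Fin d)) (b k : ℝ)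
    (x : EuclideanSpace ℝ (Fin d)) : ℝ :=
  open Classical in
  if b ≤ inner ℝ x w ∧ inner ℝ x w ≤ 1 - γ₀ / 8 then k * √γ₀ * γ₀ / (16 * d) else 0

theorem measurable_windowDrift (γ₀ : ℝ) (w : EuclideanSpace ℝ (Fin d)) (b k : ℝ) :
    Measurable (windowDrift γ₀ w b k) := by
  unfold windowDrift
  refine Measurable.ite ?_ measurable_const measurable_const
  have hx : Measurable fun x : EuclideanSpace ℝ (Fin d) => (inner ℝ x w : ℝ) := by fun_prop
  exact (measurableSet_le measurable_const hx).inter (measurableSet_le hx measurable_const)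

/-- Inside the window this is the slope bound, with `1 - ⟪x, w⟫ ^ 2 ≥ γ₀ / 8`; outside it only
says that the signal of a monotone link is nonnegative. -/
theorem windowDrift_le (hd : 3 ≤ d) (hL : LinkAssumption f γ₀ γ₁ γ₂) (h0 : 0 < γ₀)
    (h1 : γ₀ ≤ 0.1) (hw : ‖w‖ = 1) {b k : ℝ} (hb : 0 ≤ b) (hk : 0 ≤ k)
    (hslope : ∀ x ∈ Icc (√(1 - γ₀) * b) 1, ∀ y ∈ Icc x 1, k * (y - x) ≤ f y - f x)
    {x : EuclideanSpace ℝ (Fin d)} (hx : ‖x‖ = 1) :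
    windowDrift γ₀ w b k x ≤
      ∫ z, signalResidual f γ₀ w (x, z) * inner ℝ z w ∂(uniformOrthSphere x) := by
  have hs0 := Real.sqrt_nonneg (1 - γ₀)
  have hs1 := (sqrt_one_sub_mem h0 h1).2
  have hsig := fun k hk => signal_lower_bound (κ := k) hd hx hw hs0 (Real.sqrt_nonneg γ₀)
    (sq_sqrt_add_sq_sqrt h0 h1) hL.mono hL.bound hk (f √(1 - γ₀))
  have hmle := abs_le.1 (abs_inner_le_one hx hw)
  unfold windowDrift
  split_ifs with h
  · refine le_trans ?_ (hsig k fun y hy => hslope _ ⟨by gcongr; exact h.1, ?_⟩ y hy)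
    · have hd' : (3 : ℝ) ≤ d := by exact_mod_cast hd
      have hm2 : γ₀ / 8 ≤ 1 - inner ℝ x w ^ 2 := by nlinarith [h.1, h.2]
      have h3 : γ₀ / 8 / d ≤ (1 - inner ℝ x w ^ 2) / (d - 1) := by
        rw [div_le_div_iff₀ (by linarith) (by linarith)]
        nlinarith
      calc k * √γ₀ * γ₀ / (16 * d) = k * √γ₀ * (γ₀ / 8 / d) / 2 := by
            field_simp
            ring
        _ ≤ _ := by gcongr
    · nlinarith [h.1]
  · have h2 := hsig 0 fun y hy => by
      have habs : |√(1 - γ₀) * inner ℝ x w| ≤ 1 := by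
        rw [abs_mul, abs_of_nonneg hs0]
        exact mul_le_one₀ hs1 (abs_nonneg _) (abs_inner_le_one hx hw)
      have := hL.mono (abs_le.1 habs) ⟨(abs_le.1 habs).1.trans hy.1, hy.2⟩ hy.1
      linarith
    simp only [zero_mul, zero_div] at h2
    exact h2

/-- The fluctuation of the progress in round `i`: the progress minus its compensator. -/
noncomputable def fluctuation (f : ℝ → ℝ) (γ₀ : ℝ) (w : EuclideanSpace ℝ (Fin d))
    (η B : ℝ) (D : EuclideanSpace ℝ (Fin d) → ℝ) (x z : EuclideanSpace ℝ (Fin d)) (e : ℝ) : ℝ :=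
  η * stepGain f γ₀ * (signalResidual f γ₀ w (x, z) + e) * inner ℝ z w
    - η ^ 2 * B * |inner ℝ z w| - (η * stepGain f γ₀ * D x - η ^ 2 * B * (1 / √(d - 1 : ℝ)))

/-- With the exponent `l = 128 √d Λ / γ₀`, small learning rates satisfy the requirements of the
exponential supermartingale step, at a cost quadratic in the learning rate. -/
theorem step_exponent_bounds (hd : 3 ≤ d) (h0 : 0 < γ₀) (h1 : γ₀ ≤ 0.1) (hγ₂ : 0 < γ₂)
    {Λ G x : ℝ} (hΛ : 1 ≤ Λ) (hG0 : 0 < G) (hG2 : G ≤ γ₂) (hx0 : 0 ≤ x)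
    (hx : √d * Λ * x ≤ γ₀ / (400 * γ₂)) {l : ℝ} (hl : l = 128 * √d * Λ / γ₀) :
    2 * (l * (x * G)) + (l * (x * G)) ^ 2 / 2 + l * (x ^ 2 * (16 * G ^ 2 * Λ)) ≤ 1 ∧
    ((l * (x * G)) ^ 2 / 2 + (2 * (l * (x * G)) + (l * (x * G)) ^ 2 / 2 +
      l * (x ^ 2 * (16 * G ^ 2 * Λ))) ^ 2) / (d - 1) ≤
      245760 * Λ ^ 2 * γ₂ ^ 2 / γ₀ ^ 2 * x ^ 2 := by
  have hd' : (3 : ℝ) ≤ d := by exact_mod_cast hd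
  have hsd : 0 < √(d : ℝ) := Real.sqrt_pos.2 (by linarith)
  have hsd2 : √(d : ℝ) ^ 2 = d := Real.sq_sqrt (by linarith)
  have hsd1 : 1 ≤ √(d : ℝ) := by nlinarith
  have hl0 : 0 ≤ l := by rw [hl]; positivity
  have h2 : l * (x * G) ≤ 1 / 3 := by
    have h3 : l * (x * G) = 128 / γ₀ * (√d * Λ * x) * G := by rw [hl]; ring
    rw [h3]
    calc 128 / γ₀ * (√d * Λ * x) * G ≤ 128 / γ₀ * (γ₀ / (400 * γ₂)) * γ₂ := by gcongr
      _ ≤ 1 / 3 := by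
        have : 128 / γ₀ * (γ₀ / (400 * γ₂)) * γ₂ = 128 / 400 := by field_simp
        rw [this]; norm_num
  have h4 : 0 ≤ l * (x * G) := by positivity
  have h3 : l * (x ^ 2 * (16 * G ^ 2 * Λ)) ≤ l * (x * G) / 2 := by
    have h3 : l * (x ^ 2 * (16 * G ^ 2 * Λ)) = l * (x * G) * (16 * (Λ * x * G)) := by ring
    have h4 : Λ * x * G ≤ γ₀ / (400 * γ₂) * γ₂ := by
      have h5 : Λ * x ≤ √d * Λ * x := by
        have : 0 ≤ Λ * x := mul_nonneg (by linarith) hx0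
        nlinarith
      gcongr
      exact h5.trans hx
    have h6 : γ₀ / (400 * γ₂) * γ₂ = γ₀ / 400 := by field_simp
    rw [h6] at h4
    rw [h3]
    norm_num at h1
    nlinarith
  have h9 : 15 * (l * (x * G)) ^ 2 / d = 245760 * Λ ^ 2 * G ^ 2 / γ₀ ^ 2 * x ^ 2 := by
    have : (l * (x * G)) ^ 2 = 16384 * (√d ^ 2) * Λ ^ 2 / γ₀ ^ 2 * x ^ 2 * G ^ 2 := by
      rw [hl]; ring
    rw [this, hsd2]
    field_simp
    ring
  have h5 : 0 ≤ l * (x ^ 2 * (16 * G ^ 2 * Λ)) := by positivity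
  generalize l * (x ^ 2 * (16 * G ^ 2 * Λ)) = ρ at *
  generalize l * (x * G) = ν at *
  have h6 : 2 * ν + ν ^ 2 / 2 + ρ ≤ 3 * ν := by nlinarith
  refine ⟨by linarith, ?_⟩
  calc (ν ^ 2 / 2 + (2 * ν + ν ^ 2 / 2 + ρ) ^ 2) / (d - 1)
      ≤ (ν ^ 2 / 2 + (3 * ν) ^ 2) / (d - 1) := by
        have : (0 : ℝ) < d - 1 := by linarith
        gcongr
    _ ≤ 15 * ν ^ 2 / d := by
        rw [div_le_div_iff₀ (by linarith) (by linarith)]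
        nlinarith [sq_nonneg ν]
    _ ≤ _ := by
        rw [h9]
        gcongr

/-- Over a fixed block of rounds the fluctuations sum to less than `-γ₀ / (32 √d)` with
probability at most `(δ / 3) ^ 3`, which leaves room for a union bound over the `T ^ 2` blocks. -/
theorem measure_fluctuation_sum_lt [IsProbabilityMeasure μ] (hd : 3 ≤ d)
    (h0 : 0 < γ₀) (h1 : γ₀ ≤ 0.1) (hγ₁ : 0 < γ₁) (hγ₂ : 0 < γ₂) (hδ : 0 < δ) (hδ1 : δ < 1)
    (hL : LinkAssumption f γ₀ γ₁ γ₂) (h : IsSGD μ f w η (fun _ => √γ₀) ℱ θ Z a ε r)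
    (hw : ‖w‖ = 1) (hη0 : ∀ i, 0 ≤ η i)
    (hη1 : ∀ i ∈ Finset.Ico 1 T, √d * Real.log (d / δ) * η i ≤ γ₀ / (400 * γ₂))
    (hη2 : ∑ i ∈ Finset.Ico 1 T, η i ^ 2 ≤ γ₀ ^ 2 / (250000 * γ₂ ^ 2 * Real.log (d / δ)))
    (hlo : ∀ i, 0 ≤ lo i) (hκ : ∀ i, 0 ≤ κ i)
    (hslope : ∀ i ∈ Finset.Ico 1 T, ∀ x ∈ Icc (√(1 - γ₀) * lo i) 1, ∀ y ∈ Icc x 1,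
      κ i * (y - x) ≤ f y - f x)
    {s t : ℕ} (hs : 1 ≤ s) (hst : s ≤ t) (htT : t ≤ T) :
    μ {ω | ∑ i ∈ Finset.Ico s t, fluctuation f γ₀ w (η i)
        (16 * stepGain f γ₀ ^ 2 * Real.log (d / δ)) (windowDrift γ₀ w (lo i) (κ i))
        (θ i ω) (Z i ω) (ε i ω) < -(γ₀ / 32 / √d)} ≤ ENNReal.ofReal (δ ^ 3 / 27) := by
  obtain ⟨hG0, -, -, hG2⟩ := stepGain_bounds hL h0 h1 hγ₁ hγ₂
  have hΛ := one_le_log_div hd hδ hδ1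
  set Λ := Real.log (d / δ)
  have hd' : (3 : ℝ) ≤ d := by exact_mod_cast hd
  have hd1 : (0 : ℝ) < d - 1 := by linarith
  have hsd : 0 < √(d : ℝ) := Real.sqrt_pos.2 (by linarith)
  -- the exponent is chosen so that a deviation `γ₀ / (32 √d)` costs `exp (-4 Λ)`
  obtain ⟨l, hl⟩ : ∃ l : ℝ, l = 128 * √d * Λ / γ₀ := ⟨_, rfl⟩
  have hl0 : 0 ≤ l := by rw [hl]; positivity
  have hexp := fun i hi =>
    step_exponent_bounds hd h0 h1 hγ₂ hΛ hG0 hG2 (hη0 i) (hη1 i hi) hl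
  obtain ⟨B, hB⟩ : ∃ B : ℝ, B = 16 * stepGain f γ₀ ^ 2 * Λ := ⟨_, rfl⟩
  rw [← hB] at hexp ⊢
  have hB0 : 0 ≤ B := by rw [hB]; positivity
  set v : ℕ → ℝ := fun i => ((l * (η i * stepGain f γ₀)) ^ 2 / 2 +
    (2 * (l * (η i * stepGain f γ₀)) + (l * (η i * stepGain f γ₀)) ^ 2 / 2 +
      l * (η i ^ 2 * B)) ^ 2) / (d - 1)
  have hv0 : ∀ i, 0 ≤ v i := fun i => by positivity
  have hV : ∑ i ∈ Finset.Ico s t, v i ≤ Λ := by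
    calc ∑ i ∈ Finset.Ico s t, v i ≤ ∑ i ∈ Finset.Ico 1 T, v i :=
          Finset.sum_le_sum_of_subset_of_nonneg (Finset.Ico_subset_Ico hs htT) fun i _ _ => hv0 i
      _ ≤ ∑ i ∈ Finset.Ico 1 T, 245760 * Λ ^ 2 * γ₂ ^ 2 / γ₀ ^ 2 * η i ^ 2 :=
          Finset.sum_le_sum fun i hi => (hexp i hi).2
      _ ≤ 245760 * Λ ^ 2 * γ₂ ^ 2 / γ₀ ^ 2 * (γ₀ ^ 2 / (250000 * γ₂ ^ 2 * Λ)) := by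
          rw [← Finset.mul_sum]
          gcongr
      _ = 245760 / 250000 * Λ := by field_simp
      _ ≤ Λ := by linarith
  have hbm : Measurable (signalResidual f γ₀ w) := measurable_residual hL w
  have hξ : ∀ i, 1 ≤ i → Measurable[ℱ (i + 1)] (fun ω => fluctuation f γ₀ w (η i) B
      (windowDrift γ₀ w (lo i) (κ i)) (θ i ω) (Z i ω) (ε i ω)) := fun i hi => by
    have hD := measurable_windowDrift γ₀ w (lo i) (κ i)
    have hF : Measurable (fun p : (EuclideanSpace ℝ (Fin d) × EuclideanSpace ℝ (Fin d)) × ℝ =>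
        fluctuation f γ₀ w (η i) B (windowDrift γ₀ w (lo i) (κ i)) p.1.1 p.1.2 p.2) := by
      unfold fluctuation
      fun_prop
    have hθi : Measurable[ℱ (i + 1)] (θ i) :=
      (h.measurable_iterate i hi).mono (ℱ.mono (Nat.le_succ i)) le_rfl
    have hp : Measurable[ℱ (i + 1)] (fun ω => ((θ i ω, Z i ω), ε i ω)) :=
      (hθi.prodMk (h.measurable_direction i hi)).prodMk (h.measurable_noise i hi)
    have hcomp := hF.comp hp
    exact hcomp
  have hstep : ∀ i ∈ Finset.Ico 1 T, ∀ H : Ω → ℝ≥0∞, Measurable[ℱ i] H →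
      ∫⁻ ω, H ω * ENNReal.ofReal (Real.exp (-(l * fluctuation f γ₀ w (η i) B
        (windowDrift γ₀ w (lo i) (κ i)) (θ i ω) (Z i ω) (ε i ω)))) ∂μ ≤
        ENNReal.ofReal (Real.exp (v i)) * ∫⁻ ω, H ω ∂μ := fun i hi H hH => by
    have hi1 : 1 ≤ i := (Finset.mem_Ico.1 hi).1
    have hmain := lintegral_mul_exp_progress_le hd (ℱ.le i) (h.measurable_iterate i hi1)
      ((h.measurable_direction i hi1).mono (ℱ.le _) le_rfl)
      ((h.measurable_noise i hi1).mono (ℱ.le _) le_rfl)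
      ((h.ae_unit hd h0 h1 hw hi1).mono fun _ hω => hω.1) hw (h.direction_law i hi1)
      (h.noise_integrable i hi1) (h.noise_subGaussian i hi1) hbm (abs_residual_le hL h0 h1)
      (measurable_windowDrift γ₀ w (lo i) (κ i))
      (fun x hx => windowDrift_le hd hL h0 h1 hw (hlo i) (hκ i) (hslope i hi) hx)
      (α := η i * stepGain f γ₀) (β := η i ^ 2 * B)
      (mul_nonneg (hη0 i) hG0.le) (by positivity) hl0 (hexp i hi).1 hH
    unfold fluctuation
    exact hmain
  refine (measure_sum_lt_le hξ hl0 hstep hs hst htT _).trans (ENNReal.ofReal_le_ofReal ?_)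
  refine le_trans (Real.exp_le_exp.2 ?_) (exp_neg_three_log hd hδ)
  have hlx : l * (γ₀ / 32 / √d) = 4 * Λ := by
    rw [hl]
    field_simp
    norm_num
  rw [hlx]
  linarith

/-- With probability at least `1 - δ T`, every round makes the expected progress up to a
fluctuation `ξ` whose sums over all blocks of rounds are at least `-γ₀ / (32 √d)`. -/
theorem IsSGD.exists_good_event [IsProbabilityMeasure μ] (hd : 3 ≤ d)
    (h0 : 0 < γ₀) (h1 : γ₀ ≤ 0.1) (hγ₁ : 0 < γ₁) (hγ₂ : 0 < γ₂) (hδ : 0 < δ) (hδ1 : δ < 1)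
    (hL : LinkAssumption f γ₀ γ₁ γ₂) (h : IsSGD μ f w η (fun _ => √γ₀) ℱ θ Z a ε r)
    (hw : ‖w‖ = 1) (hη0 : ∀ i, 0 ≤ η i)
    (hη1 : ∀ i ∈ Finset.Ico 1 T, √d * Real.log (d / δ) * η i ≤ γ₀ / (400 * γ₂))
    (hη2 : ∑ i ∈ Finset.Ico 1 T, η i ^ 2 ≤ γ₀ ^ 2 / (250000 * γ₂ ^ 2 * Real.log (d / δ)))
    (hlo : ∀ i, 0 ≤ lo i) (hκ : ∀ i, 0 ≤ κ i)
    (hslope : ∀ i ∈ Finset.Ico 1 T, ∀ x ∈ Icc (√(1 - γ₀) * lo i) 1, ∀ y ∈ Icc x 1,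
      κ i * (y - x) ≤ f y - f x)
    (hT : δ * T < 1) :
    ∃ S : Set Ω, μ Sᶜ ≤ ENNReal.ofReal (δ * T) ∧ ∀ ω ∈ S, ∃ ξ : ℕ → ℝ,
      (∀ s t, 1 ≤ s → s ≤ t → t ≤ T → -(γ₀ / 32 / √d) ≤ ∑ i ∈ Finset.Ico s t, ξ i) ∧
      ∀ i ∈ Finset.Ico 1 T, lo i ≤ inner ℝ (θ i ω) w →
        (inner ℝ (θ i ω) w ≤ 1 - γ₀ / 8 →
          inner ℝ (θ i ω) w + ξ i + η i * stepGain f γ₀ * (κ i * √γ₀ * γ₀ / (16 * d))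
            - η i ^ 2 * (16 * stepGain f γ₀ ^ 2 * Real.log (d / δ)) *
              (2 / √d + inner ℝ (θ i ω) w) ≤ inner ℝ (θ (i + 1) ω) w) ∧
        inner ℝ (θ i ω) w + ξ i
            - η i ^ 2 * (16 * stepGain f γ₀ ^ 2 * Real.log (d / δ)) *
              (2 / √d + inner ℝ (θ i ω) w) ≤ inner ℝ (θ (i + 1) ω) w := by
  obtain ⟨hG0, -, -, hG2⟩ := stepGain_bounds hL h0 h1 hγ₁ hγ₂
  have hΛ := one_le_log_div hd hδ hδ1
  have hΛ4 := log_four_div_le hd hδ hδ1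
  set Λ := Real.log (d / δ)
  set G := stepGain f γ₀
  have hd' : (3 : ℝ) ≤ d := by exact_mod_cast hd
  -- the noise exceeds `L` in absolute value with probability at most `δ / 2` per round, and
  -- `(2 + L) ^ 2 ≤ 16 Λ` bounds the squared residual otherwise
  set L := √(2 * Real.log (4 / δ))
  have hlog4 : 0 ≤ Real.log (4 / δ) := Real.log_nonneg (by rw [le_div_iff₀ hδ]; linarith)
  have hL2 : L ^ 2 = 2 * Real.log (4 / δ) := Real.sq_sqrt (by linarith)
  set ξ : ℕ → Ω → ℝ := fun i ω => fluctuation f γ₀ w (η i) (16 * G ^ 2 * Λ)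
    (windowDrift γ₀ w (lo i) (κ i)) (θ i ω) (Z i ω) (ε i ω)
  set N₁ : Set Ω := ⋃ i ∈ Finset.Ico 1 T, {ω | L < |ε i ω|}
  set N₂ : Set Ω := ⋃ p ∈ Finset.Icc 1 T ×ˢ Finset.Icc 1 T,
    {ω | ∑ i ∈ Finset.Ico p.1 p.2, ξ i ω < -(γ₀ / 32 / √d)}
  set N₃ : Set Ω := {ω | ¬ ∀ i, 1 ≤ i →
    ‖θ i ω‖ = 1 ∧ ‖Z i ω‖ = 1 ∧ inner ℝ (θ i ω) (Z i ω) = 0}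
  have hN₁ : μ N₁ ≤ ENNReal.ofReal (T * (δ / 2)) := by
    calc μ N₁ ≤ ∑ i ∈ Finset.Ico 1 T, μ {ω | L < |ε i ω|} := measure_biUnion_finset_le _ _
      _ ≤ ∑ i ∈ Finset.Ico 1 T, ENNReal.ofReal (δ / 2) := by
          refine Finset.sum_le_sum fun i hi => ?_
          have hi1 : 1 ≤ i := (Finset.mem_Ico.1 hi).1
          have hZi := (h.measurable_direction i hi1).mono (ℱ.le _) le_rfl
          refine (measure_lt_abs_noise_le (sup_le (ℱ.le i) hZi.comap_le)
            ((h.measurable_noise i hi1).mono (ℱ.le _) le_rfl) (h.noise_integrable i hi1)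
            (h.noise_subGaussian i hi1) (Real.sqrt_nonneg _)).trans
            (ENNReal.ofReal_le_ofReal ?_)
          have : L ^ 2 / 2 = Real.log (4 / δ) := by rw [hL2]; ring
          rw [this, Real.exp_neg, Real.exp_log (by positivity), inv_div]
          linarith
      _ ≤ _ := by
          rw [Finset.sum_const, Nat.card_Ico, nsmul_eq_mul, ← ENNReal.ofReal_natCast,
            ← ENNReal.ofReal_mul (by positivity)]
          refine ENNReal.ofReal_le_ofReal ?_
          have : ((T - 1 : ℕ) : ℝ) ≤ T := by exact_mod_cast Nat.sub_le T 1
          gcongr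
  have hx0 : 0 < γ₀ / 32 / √(d : ℝ) := by positivity
  have hN₂ : μ N₂ ≤ ENNReal.ofReal (T * (δ / 2)) := by
    calc μ N₂ ≤ ∑ p ∈ Finset.Icc 1 T ×ˢ Finset.Icc 1 T,
          μ {ω | ∑ i ∈ Finset.Ico p.1 p.2, ξ i ω < -(γ₀ / 32 / √d)} :=
          measure_biUnion_finset_le _ _
      _ ≤ ∑ p ∈ Finset.Icc 1 T ×ˢ Finset.Icc 1 T, ENNReal.ofReal (δ ^ 3 / 27) := by
          refine Finset.sum_le_sum fun p hp => ?_
          simp only [Finset.mem_product, Finset.mem_Icc] at hp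
          rcases le_total p.1 p.2 with hle | hle
          · exact measure_fluctuation_sum_lt hd h0 h1 hγ₁ hγ₂ hδ hδ1 hL h hw hη0 hη1 hη2 hlo hκ
              hslope hp.1.1 hle hp.2.2
          · rw [Finset.Ico_eq_empty_of_le hle]
            have : {ω : Ω | ∑ i ∈ ∅, ξ i ω < -(γ₀ / 32 / √d)} = ∅ := by
              ext ω
              simp only [Finset.sum_empty, Set.mem_ofPred_eq, mem_empty_iff_false, iff_false]
              linarith
            rw [this, measure_empty]
            exact zero_le
      _ ≤ _ := by
          rw [Finset.sum_const, Finset.card_product, Nat.card_Icc, nsmul_eq_mul,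
            ← ENNReal.ofReal_natCast, ← ENNReal.ofReal_mul (by positivity)]
          refine ENNReal.ofReal_le_ofReal ?_
          simp only [Nat.add_sub_cancel, Nat.cast_mul]
          have h2 : (T : ℝ) * T * (δ ^ 3 / 27) = T * (δ ^ 2 / 27 * (δ * T)) := by ring
          rw [h2]
          refine mul_le_mul_of_nonneg_left ?_ (by positivity)
          have h3 : 0 ≤ δ * T := by positivity
          nlinarith [mul_pos hδ hδ]
  have hN₃ : μ N₃ = 0 := by
    have : ∀ᵐ ω ∂μ, ∀ i, 1 ≤ i →
        ‖θ i ω‖ = 1 ∧ ‖Z i ω‖ = 1 ∧ inner ℝ (θ i ω) (Z i ω) = 0 := by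
      rw [ae_all_iff]
      intro i
      by_cases hi : 1 ≤ i
      · filter_upwards [h.ae_unit hd h0 h1 hw hi] with ω hω _ using hω
      · exact Filter.Eventually.of_forall fun ω hi' => absurd hi' hi
    exact this
  refine ⟨(N₁ ∪ N₂ ∪ N₃)ᶜ, ?_, fun ω hω => ⟨fun i => ξ i ω, ?_, ?_⟩⟩
  · rw [compl_compl]
    calc μ (N₁ ∪ N₂ ∪ N₃) ≤ μ N₁ + μ N₂ + μ N₃ :=
          (measure_union_le _ _).trans (add_le_add (measure_union_le _ _) le_rfl)
      _ ≤ ENNReal.ofReal (T * (δ / 2)) + ENNReal.ofReal (T * (δ / 2)) + 0 :=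
          add_le_add (add_le_add hN₁ hN₂) hN₃.le
      _ = ENNReal.ofReal (δ * T) := by
          rw [add_zero, ← ENNReal.ofReal_add (by positivity) (by positivity)]
          congr 1
          ring
  · intro s t hs hst htT
    have h2 : ω ∉ N₂ := fun hmem => hω (Or.inl (Or.inr hmem))
    by_contra hlt
    refine h2 (mem_iUnion₂.2 ⟨(s, t), ?_, not_le.1 hlt⟩)
    simp only [Finset.mem_product, Finset.mem_Icc]
    omega
  · intro i hi hloi
    have hi1 : 1 ≤ i := (Finset.mem_Ico.1 hi).1
    have h2 : |ε i ω| ≤ L := by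
      by_contra hlt
      exact hω (Or.inl (Or.inl (mem_iUnion₂.2 ⟨i, hi, not_le.1 hlt⟩)))
    have h3 : ∀ i, 1 ≤ i → ‖θ i ω‖ = 1 ∧ ‖Z i ω‖ = 1 ∧ inner ℝ (θ i ω) (Z i ω) = 0 := by
      by_contra hn
      exact hω (Or.inr hn)
    obtain ⟨hθ, hZ, hθZ⟩ := h3 i hi1
    have hm0 : 0 ≤ inner ℝ (θ i ω) w := (hlo i).trans hloi
    have hB : (G * (signalResidual f γ₀ w (θ i ω, Z i ω) + ε i ω)) ^ 2 ≤ 16 * G ^ 2 * Λ := by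
      have hb := abs_le.1 (abs_residual_le (w := w) hL h0 h1 (θ i ω, Z i ω))
      have hε := abs_le.1 h2
      rw [mul_pow]
      have h5 : (signalResidual f γ₀ w (θ i ω, Z i ω) + ε i ω) ^ 2 ≤ (2 + L) ^ 2 := by
        rw [sq_le_sq, abs_of_nonneg (show 0 ≤ 2 + L by positivity), abs_le]
        constructor <;> linarith
      have h6 : (2 + L) ^ 2 ≤ 16 * Λ := by nlinarith [sq_nonneg (2 - L)]
      have h7 : 0 ≤ G ^ 2 := sq_nonneg _
      nlinarith
    have hstep := h.inner_succ_ge h0 h1 hw hi1 hθ hZ hθZ hm0 hB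
    have he : 1 / √(d - 1 : ℝ) ≤ 2 / √(d : ℝ) := by
      have h5 : 0 < √(d - 1 : ℝ) := Real.sqrt_pos.2 (by linarith)
      have h6 : 0 < √(d : ℝ) := Real.sqrt_pos.2 (by linarith)
      rw [div_le_div_iff₀ h5 h6, one_mul]
      refine Real.sqrt_le_iff.2 ⟨by positivity, ?_⟩
      rw [mul_pow, Real.sq_sqrt (by linarith)]
      linarith
    have hloss : η i ^ 2 * (16 * G ^ 2 * Λ) * (1 / √(d - 1 : ℝ)) ≤
        η i ^ 2 * (16 * G ^ 2 * Λ) * (2 / √(d : ℝ)) := by gcongr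
    have hD0 : 0 ≤ windowDrift γ₀ w (lo i) (κ i) (θ i ω) := by
      unfold windowDrift
      have := hκ i
      split_ifs <;> positivity
    have hGD : 0 ≤ η i * G * windowDrift γ₀ w (lo i) (κ i) (θ i ω) :=
      mul_nonneg (mul_nonneg (hη0 i) hG0.le) hD0
    simp only [ξ, fluctuation]
    change _ + (η i * G * _ * _ - _) - _ ≤ _ at hstep
    refine ⟨fun hcap => ?_, by linarith⟩
    have hDeq : windowDrift γ₀ w (lo i) (κ i) (θ i ω) = κ i * √γ₀ * γ₀ / (16 * d) := by
      unfold windowDrift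
      exact if_pos ⟨hloi, hcap⟩
    rw [hDeq]
    linarith

end good_event

/-! ### Deterministic barrier and the constant learning rate -/

/-- A sequence that gains `g i + ξ i` per step while it is above `lo i`, except that it may at any
time be reset to `h i + ξ i`, stays above every `u` that lies below the guaranteed gains since the
start and since each possible reset, when block sums of `ξ` are at least `-x`. -/
theorem barrier_bound {T : ℕ} {m ξ g u lo h : ℕ → ℝ} {x : ℝ}
    (hξ : ∀ s t, 1 ≤ s → s ≤ t → t ≤ T → -x ≤ ∑ i ∈ Finset.Ico s t, ξ i)
    (hstep : ∀ i ∈ Finset.Ico 1 T, lo i ≤ m i →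
      m i + ξ i + g i ≤ m (i + 1) ∨ h i + ξ i ≤ m (i + 1))
    (hu₁ : ∀ t, 1 ≤ t → t ≤ T → u t ≤ m 1 - x + ∑ i ∈ Finset.Ico 1 t, g i)
    (hu₂ : ∀ s t, 1 ≤ s → s < t → t ≤ T → u t ≤ h s - x + ∑ i ∈ Finset.Ico (s + 1) t, g i)
    (hlo : ∀ t ∈ Finset.Ico 1 T, lo t ≤ u t) {t : ℕ} (ht : 1 ≤ t) (htT : t ≤ T) :
    u t ≤ m t := by
  have himp : ∀ t, 1 ≤ t → t ≤ T →
      (m 1 + ∑ i ∈ Finset.Ico 1 t, ξ i + ∑ i ∈ Finset.Ico 1 t, g i ≤ m t ∨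
        ∃ s, 1 ≤ s ∧ s < t ∧
          h s + ∑ i ∈ Finset.Ico s t, ξ i + ∑ i ∈ Finset.Ico (s + 1) t, g i ≤ m t) →
      u t ≤ m t := by
    rintro t ht htT (h1 | ⟨s, hs, hst, h1⟩)
    · linarith [hu₁ t ht htT, hξ 1 t le_rfl ht htT]
    · linarith [hu₂ s t hs hst htT, hξ s t hs hst.le htT]
  refine himp t ht htT ?_
  induction t, ht using Nat.le_induction with
  | base => left; simp
  | succ t ht ih =>
    have hP := ih (by omega)
    have hmem : t ∈ Finset.Ico 1 T := Finset.mem_Ico.2 ⟨ht, by omega⟩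
    rcases hstep t hmem ((hlo t hmem).trans (himp t ht (by omega) hP)) with h1 | h1
    · rcases hP with h2 | ⟨s, hs, hst, h2⟩
      · left
        rw [Finset.sum_Ico_succ_top ht, Finset.sum_Ico_succ_top ht]
        linarith
      · right
        refine ⟨s, hs, by omega, ?_⟩
        rw [Finset.sum_Ico_succ_top hst.le, Finset.sum_Ico_succ_top (by omega)]
        linarith
    · right
      exact ⟨t, ht, by omega, by simpa using h1⟩

section burn_in
variable {d : ℕ} {Ω : Type*} {mΩ : MeasurableSpace Ω} {μ : Measure Ω} {f : ℝ → ℝ}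
  {w : EuclideanSpace ℝ (Fin d)} {η : ℕ → ℝ} {γ₀ γ₁ γ₂ δ : ℝ} {ℱ : Filtration ℕ mΩ}
  {θ Z a : ℕ → Ω → EuclideanSpace ℝ (Fin d)} {ε r : ℕ → Ω → ℝ} {T : ℕ} {lo κ : ℕ → ℝ}

/-- In a single round the relative loss from normalization is at most `γ₀ / 32`. -/
theorem sq_rate_mul_le (hd : 3 ≤ d) (h0 : 0 < γ₀) (h1 : γ₀ ≤ 0.1) (hγ₂ : 0 < γ₂)
    {Λ G x : ℝ} (hΛ : 1 ≤ Λ) (hG0 : 0 < G) (hG2 : G ≤ γ₂) (hx0 : 0 ≤ x)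
    (hx : √d * Λ * x ≤ γ₀ / (400 * γ₂)) : x ^ 2 * (16 * G ^ 2 * Λ) ≤ γ₀ / 32 := by
  have hd' : (3 : ℝ) ≤ d := by exact_mod_cast hd
  have hsd : 0 < √(d : ℝ) := Real.sqrt_pos.2 (by linarith)
  have hsd2 : √(d : ℝ) ^ 2 = d := Real.sq_sqrt (by linarith)
  have hsd1 : 1 ≤ √(d : ℝ) := by nlinarith
  have hxΛ : x * Λ ≤ γ₀ / (400 * γ₂) := by
    have : 0 ≤ Λ * x := mul_nonneg (by linarith) hx0
    nlinarith
  have hx1 : x ≤ γ₀ / (400 * γ₂) := by nlinarith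
  calc x ^ 2 * (16 * G ^ 2 * Λ) = 16 * (x * G) * (x * Λ * G) := by ring
    _ ≤ 16 * (γ₀ / (400 * γ₂) * γ₂) * (γ₀ / (400 * γ₂) * γ₂) := by gcongr
    _ = γ₀ ^ 2 / 10000 := by field_simp; norm_num
    _ ≤ γ₀ / 32 := by norm_num at h1; nlinarith

/-- The burn-in phase for a general schedule. In round `i` the link has slope at least `κ i` to the
right of `√(1 - γ₀) * lo i`, and the drift dominates the loss from normalization as long as the
correlation is in `[lo i, h i]`. -/
theorem IsSGD.burn_in [IsProbabilityMeasure μ] (hd : 3 ≤ d)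
    (h0 : 0 < γ₀) (h1 : γ₀ ≤ 0.1) (hγ₁ : 0 < γ₁) (hγ₂ : 0 < γ₂) (hδ : 0 < δ) (hδ1 : δ < 1)
    (hL : LinkAssumption f γ₀ γ₁ γ₂) (hsgd : IsSGD μ f w η (fun _ => √γ₀) ℱ θ Z a ε r)
    (hw : ‖w‖ = 1) (hinit : ∀ᵐ ω ∂μ, 1 / √(d : ℝ) ≤ inner ℝ (θ 1 ω) w) (hη0 : ∀ i, 0 ≤ η i)
    (hη1 : ∀ i ∈ Finset.Ico 1 T, √d * Real.log (d / δ) * η i ≤ γ₀ / (400 * γ₂))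
    (hη2 : ∑ i ∈ Finset.Ico 1 T, η i ^ 2 ≤ γ₀ ^ 2 / (250000 * γ₂ ^ 2 * Real.log (d / δ)))
    (hlo : ∀ i, 0 ≤ lo i) (hκ : ∀ i, 0 ≤ κ i)
    (hslope : ∀ i ∈ Finset.Ico 1 T, ∀ x ∈ Icc (√(1 - γ₀) * lo i) 1, ∀ y ∈ Icc x 1,
      κ i * (y - x) ≤ f y - f x)
    {h : ℕ → ℝ} (hh0 : ∀ i, 0 ≤ h i) (hh1 : ∀ i, h i ≤ 1 - γ₀ / 8)
    (hloss : ∀ i ∈ Finset.Ico 1 T, η i * (16 * stepGain f γ₀ * Real.log (d / δ)) *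
      (2 / √d + h i) ≤ κ i * √γ₀ * γ₀ / (32 * d))
    {g u : ℕ → ℝ} (hg : ∀ i, g i = η i * stepGain f γ₀ * (κ i * √γ₀ * γ₀ / (32 * d)))
    (hT : 1 ≤ T)
    (hu₁ : ∀ t, 1 ≤ t → t ≤ T → u t ≤ (1 - γ₀ / 32) / √d + ∑ i ∈ Finset.Ico 1 t, g i)
    (hu₂ : ∀ s t, 1 ≤ s → s < t → t ≤ T →
      u t ≤ (1 - γ₀ / 32) * h s - 3 * (γ₀ / 32) / √d + ∑ i ∈ Finset.Ico (s + 1) t, g i)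
    (hlou : ∀ t ∈ Finset.Ico 1 T, lo t ≤ u t) (huT : 1 - γ₀ / 4 ≤ u T) :
    1 - δ * T ≤ μ.real {ω | 1 - γ₀ / 4 ≤ inner ℝ (θ T ω) w} := by
  rcases le_or_gt 1 (δ * T) with hδT | hδT
  · have : 0 ≤ μ.real {ω | 1 - γ₀ / 4 ≤ inner ℝ (θ T ω) w} := measureReal_nonneg
    linarith
  obtain ⟨S, hS, hgood⟩ := hsgd.exists_good_event hd h0 h1 hγ₁ hγ₂ hδ hδ1 hL hw hη0 hη1 hη2 hlo hκ
    hslope hδT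
  obtain ⟨hG0, -, -, hG2⟩ := stepGain_bounds hL h0 h1 hγ₁ hγ₂
  have hΛ := one_le_log_div hd hδ hδ1
  set Λ := Real.log (d / δ)
  set G := stepGain f γ₀
  have hd' : (3 : ℝ) ≤ d := by exact_mod_cast hd
  have hsd : 0 < √(d : ℝ) := Real.sqrt_pos.2 (by linarith)
  have hpath : ∀ ω ∈ S, 1 / √(d : ℝ) ≤ inner ℝ (θ 1 ω) w →
      1 - γ₀ / 4 ≤ inner ℝ (θ T ω) w := by
    intro ω hω h1ω
    obtain ⟨ξ, hξ, hstep⟩ := hgood ω hω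
    refine huT.trans ?_
    refine barrier_bound (m := fun i => inner ℝ (θ i ω) w) (ξ := ξ) (g := g) (lo := lo)
      (h := fun i => (1 - γ₀ / 32) * h i - 2 * (γ₀ / 32) / √d) (x := γ₀ / 32 / √d) hξ ?_ ?_ ?_
      hlou hT le_rfl
    · intro i hi hloi
      obtain ⟨hact, habove⟩ := hstep i hi hloi
      have hB := sq_rate_mul_le hd h0 h1 hγ₂ hΛ hG0 hG2 (hη0 i) (hη1 i hi)
      have hB0 : 0 ≤ η i ^ 2 * (16 * G ^ 2 * Λ) := by positivity
      set x : ℝ := inner ℝ (θ i ω) w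
      rcases le_total x (h i) with hxh | hxh
      · left
        refine le_trans ?_ (hact (hxh.trans (hh1 i)))
        have h2 : η i ^ 2 * (16 * G ^ 2 * Λ) * (2 / √d + x) ≤
            η i * G * (κ i * √γ₀ * γ₀ / (32 * d)) := by
          calc η i ^ 2 * (16 * G ^ 2 * Λ) * (2 / √d + x)
              ≤ η i ^ 2 * (16 * G ^ 2 * Λ) * (2 / √d + h i) := by gcongr
            _ = η i * G * (η i * (16 * G * Λ) * (2 / √d + h i)) := by ring
            _ ≤ _ := by
                have := hη0 i
                exact mul_le_mul_of_nonneg_left (hloss i hi) (by positivity)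
        have h3 : η i * G * (κ i * √γ₀ * γ₀ / (16 * d)) =
            2 * (η i * G * (κ i * √γ₀ * γ₀ / (32 * d))) := by
          field_simp
          ring
        rw [hg i]
        linarith
      · right
        refine le_trans ?_ habove
        generalize η i ^ 2 * (16 * G ^ 2 * Λ) = b at *
        have h2 : (1 - γ₀ / 32) * h i ≤ (1 - b) * x := by
          have : 0 ≤ 1 - b := by norm_num at h1; linarith
          calc (1 - γ₀ / 32) * h i ≤ (1 - b) * h i :=
                mul_le_mul_of_nonneg_right (by linarith) (hh0 i)
            _ ≤ _ := by gcongr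
        have h3 : b * (2 / √d) ≤ 2 * (γ₀ / 32) / √d := by
          rw [mul_comm 2 (γ₀ / 32), mul_div_assoc]
          gcongr
        linarith
    · intro t ht htT
      have := hu₁ t ht htT
      have h2 : (1 - γ₀ / 32) / √d = 1 / √d - γ₀ / 32 / √d := by ring
      linarith
    · intro s t hs hst htT
      have := hu₂ s t hs hst htT
      have h2 : 3 * (γ₀ / 32) / √d = 2 * (γ₀ / 32) / √d + γ₀ / 32 / √d := by ring
      linarith
  have hmeas : MeasurableSet {ω | 1 - γ₀ / 4 ≤ inner ℝ (θ T ω) w} := by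
    have hθ : Measurable (θ T) := (hsgd.measurable_iterate T hT).mono (ℱ.le T) le_rfl
    exact measurableSet_le measurable_const (by fun_prop)
  have hcompl : μ {ω | 1 - γ₀ / 4 ≤ inner ℝ (θ T ω) w}ᶜ ≤ ENNReal.ofReal (δ * T) := by
    calc _ ≤ μ (Sᶜ ∪ {ω | ¬ 1 / √(d : ℝ) ≤ inner ℝ (θ 1 ω) w}) := by
          refine measure_mono fun ω hω => ?_
          by_contra hn
          rw [mem_union, not_or, mem_compl_iff, not_not] at hn
          exact hω (hpath ω hn.1 (not_not.1 hn.2))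
      _ ≤ μ Sᶜ + μ {ω | ¬ 1 / √(d : ℝ) ≤ inner ℝ (θ 1 ω) w} := measure_union_le _ _
      _ = μ Sᶜ := by
          rw [show μ {ω | ¬ 1 / √(d : ℝ) ≤ inner ℝ (θ 1 ω) w} = 0 from hinit, add_zero]
      _ ≤ _ := hS
  have h2 : μ.real {ω | 1 - γ₀ / 4 ≤ inner ℝ (θ T ω) w}ᶜ ≤ δ * T :=
    ENNReal.toReal_le_of_le_ofReal (by positivity) hcompl
  rw [probReal_compl_eq_one_sub hmeas] at h2
  linarith

/-- A lower bound of the derivative on `[b, 1]` is a lower bound of the slopes. -/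
theorem LinkAssumption.slope_ge (hL : LinkAssumption f γ₀ γ₁ γ₂) {b k : ℝ} (hb : 0 ≤ b)
    (hk : ∀ z ∈ Icc b 1, k ≤ linkDeriv f z) :
    ∀ x ∈ Icc b 1, ∀ y ∈ Icc x 1, k * (y - x) ≤ f y - f x := by
  intro x hx y hy
  have hsub : Icc b 1 ⊆ Icc (0 : ℝ) 1 := Icc_subset_Icc hb le_rfl
  have hint : interior (Icc b 1) ⊆ Ioo (0 : ℝ) 1 := by
    rw [interior_Icc]
    exact Ioo_subset_Ioo hb le_rfl
  refine Convex.mul_sub_le_image_sub_of_le_deriv (convex_Icc b 1)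
    (hL.diff.continuousOn.mono hsub) ((hL.diff.mono hsub).mono interior_subset) ?_ x hx y
    ⟨hx.1.trans hy.1, hy.2⟩ hy.1
  intro z hz
  rw [← derivWithin_of_mem_nhds (Icc_mem_nhds (hint hz).1 (hint hz).2)]
  exact hk z (interior_subset hz)

end burn_in

/-- After a return to the cap `1 - x / 8`, relative and absolute losses of order `x / 32` leave the
correlation above `1 - x / 4`. -/
theorem cap_margin {x : ℝ} (hx : 0 ≤ x) :
    1 - x / 4 ≤ (1 - x / 32) * (1 - x / 8) - 3 * (x / 32) := by
  nlinarith

/-- The drift dominates the normalization loss for a constant rate `c / (d Λ ^ 2)` and the cap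
`1 - γ₀ / 8`. -/
theorem constant_rate_loss {d : ℕ} {γ₀ γ₂ c₀ c Λ G : ℝ} (h0 : 0 < γ₀) (h1 : γ₀ ≤ 0.1)
    (hγ₂ : 0 < γ₂) (hc : 0 < c) (hd : 3 ≤ d) (hΛ : 1 ≤ Λ) (hG : G ≤ γ₂ * √γ₀)
    (hc2 : c ≤ c₀ * γ₀ / (1536 * γ₂)) :
    c / (d * Λ ^ 2) * (16 * G * Λ) * (2 / √d + (1 - γ₀ / 8)) ≤ c₀ * √γ₀ * γ₀ / (32 * d) := by
  have hd' : (3 : ℝ) ≤ d := by exact_mod_cast hd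
  have hsd1 : 1 ≤ √(d : ℝ) := by rw [Real.one_le_sqrt]; linarith
  have hq0 : 0 < √γ₀ := Real.sqrt_pos.2 h0
  have h2 : 2 / √(d : ℝ) + (1 - γ₀ / 8) ≤ 3 := by
    have : 2 / √(d : ℝ) ≤ 2 := div_le_self (by norm_num) hsd1
    linarith
  have h3 : 0 ≤ 2 / √(d : ℝ) + (1 - γ₀ / 8) := by
    have : 0 ≤ 2 / √(d : ℝ) := by positivity
    norm_num at h1
    linarith
  calc c / (d * Λ ^ 2) * (16 * G * Λ) * (2 / √d + (1 - γ₀ / 8))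
      ≤ c / (d * Λ ^ 2) * (16 * (γ₂ * √γ₀) * Λ) * 3 := by gcongr
    _ = 48 * γ₂ * √γ₀ * c / d / Λ := by
        field_simp
        norm_num
    _ ≤ 48 * γ₂ * √γ₀ * c / d := div_le_self (by positivity) hΛ
    _ ≤ 48 * γ₂ * √γ₀ * (c₀ * γ₀ / (1536 * γ₂)) / d := by gcongr
    _ = _ := by
        field_simp
        ring

/-- At the constant rate, `T` rounds accumulate a gain of at least one. -/
theorem constant_rate_total_gain {γ₀ γ₁ c₀ c D Λ K x G T g : ℝ} (h0 : 0 < γ₀) (hγ₁ : 0 < γ₁)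
    (hc₀ : 0 < c₀) (hc : 0 < c) (hD : 0 < D) (hΛ : 0 < Λ) (hK : K = 64 / (γ₁ * c₀ * γ₀ ^ 2))
    (hx : x = K / c * D ^ 2 * Λ ^ 2) (hx2 : 2 ≤ x) (hT : x ≤ T) (hG : γ₁ * √γ₀ ≤ G)
    (hg : g = c / (D * Λ ^ 2) * G * (c₀ * √γ₀ * γ₀ / (32 * D))) : 1 ≤ (T - 1) * g := by
  have hq : √γ₀ ^ 2 = γ₀ := Real.sq_sqrt h0.le
  have hq0 : 0 < √γ₀ := Real.sqrt_pos.2 h0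
  calc (1 : ℝ) = x / 2 * (c / (D * Λ ^ 2) * (γ₁ * √γ₀) * (c₀ * √γ₀ * γ₀ / (32 * D))) := by
        have : x / 2 * (c / (D * Λ ^ 2) * (γ₁ * √γ₀) * (c₀ * √γ₀ * γ₀ / (32 * D))) =
          x * c * γ₁ * c₀ * γ₀ * √γ₀ ^ 2 / (64 * D ^ 2 * Λ ^ 2) := by
          field_simp
          norm_num
        rw [this, hq, hx, hK]
        field_simp
    _ ≤ (T - 1) * g := by
        have h2 : x / 2 ≤ T - 1 := by linarith
        have h3 : 0 ≤ T - 1 := by linarith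
        rw [hg]
        gcongr

/-- Burn-in with a constant learning rate when the derivative is bounded below on `[0, 1]`. -/
theorem burn_in_of_linkDeriv_ge {γ₀ γ₁ γ₂ : ℝ} (h0 : 0 < γ₀) (h1 : γ₀ ≤ 0.1) (hγ₁ : 0 < γ₁)
    (hγ₂ : 0 < γ₂) {c₀ : ℝ} (hc₀ : 0 < c₀) : ∃ c C : ℝ, 0 < c ∧ 0 < C ∧
      ∀ (d : ℕ), 3 ≤ d → ∀ δ : ℝ, 0 < δ → δ < 1 →
      ∀ f : ℝ → ℝ, LinkAssumption f γ₀ γ₁ γ₂ → (∀ x ∈ Icc (0 : ℝ) 1, c₀ ≤ linkDeriv f x) →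
      ∀ T : ℕ, T = ⌈C * (d : ℝ) ^ 2 * Real.log (d / δ) ^ 2⌉₊ →
      ∀ (Ω : Type*) (mΩ : MeasurableSpace Ω) (μ : Measure Ω), IsProbabilityMeasure μ →
      ∀ (ℱ : Filtration ℕ mΩ) (θs : EuclideanSpace ℝ (Fin d))
        (θ Z a : ℕ → Ω → EuclideanSpace ℝ (Fin d)) (ε r : ℕ → Ω → ℝ), ‖θs‖ = 1 →
      IsSGD μ f θs (fun _ => c / (d * Real.log (d / δ) ^ 2)) (fun _ => √γ₀) ℱ θ Z a ε r →
      (∀ᵐ ω ∂μ, 1 / √(d : ℝ) ≤ inner ℝ (θ 1 ω) θs) →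
      1 - δ * T ≤ μ.real {ω | 1 - γ₀ / 4 ≤ inner ℝ (θ T ω) θs} := by
  obtain ⟨K, hK⟩ : ∃ K, K = 64 / (γ₁ * c₀ * γ₀ ^ 2) := ⟨_, rfl⟩
  have hK0 : 0 < K := by rw [hK]; positivity
  -- `c` is small enough for the exponential moments, for the drift to dominate the loss from
  -- normalization, for `T` to be at least two, and for the sum of the squared rates
  obtain ⟨c, hc, hc1, hc2, hc3, hc4⟩ : ∃ c : ℝ, 0 < c ∧ c ≤ γ₀ / (400 * γ₂) ∧
      c ≤ c₀ * γ₀ / (1536 * γ₂) ∧ c ≤ K ∧ c ≤ γ₀ ^ 2 / (250000 * γ₂ ^ 2) / K := by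
    refine ⟨min (min (γ₀ / (400 * γ₂)) (c₀ * γ₀ / (1536 * γ₂)))
      (min K (γ₀ ^ 2 / (250000 * γ₂ ^ 2) / K)), ?_, ?_, ?_, ?_, ?_⟩
    · exact lt_min (lt_min (by positivity) (by positivity)) (lt_min hK0 (by positivity))
    · exact (min_le_left _ _).trans (min_le_left _ _)
    · exact (min_le_left _ _).trans (min_le_right _ _)
    · exact (min_le_right _ _).trans (min_le_left _ _)
    · exact (min_le_right _ _).trans (min_le_right _ _)
  refine ⟨c, K / c, hc, by positivity, ?_⟩
  intro d hd δ hδ hδ1 f hL hf T hT Ω mΩ μ hμ ℱ θs θ Z a ε r hw hsgd hinit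
  obtain ⟨hG0, hG1, hG2, -⟩ := stepGain_bounds hL h0 h1 hγ₁ hγ₂
  have hΛ := one_le_log_div hd hδ hδ1
  obtain ⟨Λ, hΛdef⟩ : ∃ Λ, Λ = Real.log (d / δ) := ⟨_, rfl⟩
  rw [← hΛdef] at hΛ hT hsgd
  have hd' : (3 : ℝ) ≤ d := by exact_mod_cast hd
  have hsd : 0 < √(d : ℝ) := Real.sqrt_pos.2 (by linarith)
  have hsd2 : √(d : ℝ) ^ 2 = d := Real.sq_sqrt (by linarith)
  have hsd1 : 1 ≤ √(d : ℝ) := by nlinarith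
  have hq : √γ₀ ^ 2 = γ₀ := Real.sq_sqrt h0.le
  have hq0 : 0 < √γ₀ := Real.sqrt_pos.2 h0
  obtain ⟨x, hx⟩ : ∃ x, x = K / c * (d : ℝ) ^ 2 * Λ ^ 2 := ⟨_, rfl⟩
  rw [← hx] at hT
  have hx2 : 2 ≤ x := by
    have h2 : 1 ≤ K / c := (one_le_div hc).2 hc3
    have h3 : (2 : ℝ) ≤ (d : ℝ) ^ 2 := by nlinarith
    have h4 : 1 ≤ Λ ^ 2 := one_le_pow₀ hΛ
    calc (2 : ℝ) = 1 * 2 * 1 := by norm_num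
      _ ≤ _ := by rw [hx]; gcongr
  have hTx : x ≤ T := by rw [hT]; exact Nat.le_ceil _
  have hTx' : (T : ℝ) < x + 1 := by rw [hT]; exact Nat.ceil_lt_add_one (by linarith)
  have hT1 : 1 ≤ T := by
    have : (1 : ℝ) ≤ T := by linarith
    exact_mod_cast this
  have hΛ2 : Λ ≤ Λ ^ 2 := le_self_pow₀ hΛ two_ne_zero
  have hcard : ((T - 1 : ℕ) : ℝ) = T - 1 := by rw [Nat.cast_sub hT1, Nat.cast_one]
  obtain ⟨g, hg⟩ : ∃ g, g = c / (d * Λ ^ 2) * stepGain f γ₀ * (c₀ * √γ₀ * γ₀ / (32 * d)) :=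
    ⟨_, rfl⟩
  have hg0 : 0 ≤ g := by rw [hg]; positivity
  -- the target is zero until the last round, which the total gain of one carries to `1 - γ₀ / 4`
  have hlin := constant_rate_total_gain (g := g) h0 hγ₁ hc₀ hc (by linarith) (by linarith)
    hK hx (by linarith) hTx hG1 hg
  have hdom := constant_rate_loss (G := stepGain f γ₀) h0 h1 hγ₂ hc hd hΛ hG2 hc2
  refine hsgd.burn_in (lo := fun _ => 0) (κ := fun _ => c₀) (h := fun _ => 1 - γ₀ / 8)
    (g := fun _ => g) (η := fun _ => c / (d * Λ ^ 2))
    (u := fun t => if t < T then 0 else 1 - γ₀ / 4)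
    hd h0 h1 hγ₁ hγ₂ hδ hδ1 hL hw hinit (fun _ => by positivity) ?_ ?_ (fun _ => le_rfl)
    (fun _ => hc₀.le) ?_ (fun _ => by norm_num at h1; linarith) (fun _ => le_rfl) ?_
    (fun _ => hg) hT1 ?_ ?_ ?_ ?_
  · intro i _
    rw [← hΛdef]
    have h2 : √(d : ℝ) ≤ √d ^ 2 := le_self_pow₀ hsd1 two_ne_zero
    rw [hsd2] at h2
    calc √d * Λ * (c / (d * Λ ^ 2)) ≤ d * Λ ^ 2 * (c / (d * Λ ^ 2)) := by gcongr
      _ = c := mul_div_cancel₀ _ (by positivity)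
      _ ≤ _ := hc1
  · rw [← hΛdef, Finset.sum_const, Nat.card_Ico, nsmul_eq_mul, hcard]
    calc ((T : ℝ) - 1) * (c / (d * Λ ^ 2)) ^ 2 ≤ x * (c / (d * Λ ^ 2)) ^ 2 := by
          gcongr
          linarith
      _ = K * c / Λ ^ 2 := by
          rw [hx]
          field_simp
      _ ≤ K * (γ₀ ^ 2 / (250000 * γ₂ ^ 2) / K) / Λ := by
          gcongr
      _ = _ := by field_simp
  · intro i _
    have := hL.slope_ge le_rfl hf
    simpa using this
  · intro i _
    rw [← hΛdef]
    exact hdom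
  · intro t ht htT
    have h2 : 0 ≤ (1 - γ₀ / 32) / √(d : ℝ) := by
      norm_num at h1
      exact div_nonneg (by linarith) hsd.le
    simp only [Finset.sum_const, Nat.card_Ico, nsmul_eq_mul]
    split_ifs with htlt
    · positivity
    · have hteq : t = T := by omega
      rw [hteq, hcard]
      linarith
  · intro s t hs hst htT
    have h2 : 3 * (γ₀ / 32) / √(d : ℝ) ≤ 3 * (γ₀ / 32) := div_le_self (by positivity) hsd1
    have h3 : 0 ≤ ∑ i ∈ Finset.Ico (s + 1) t, g := Finset.sum_nonneg fun _ _ => hg0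
    have h4 := cap_margin h0.le
    norm_num at h1
    split_ifs <;> linarith
  · intro t ht
    rw [if_pos (Finset.mem_Ico.1 ht).2]
  · rw [if_neg (lt_irrefl T)]

/-! ### Correlation levels, epochs and convex links -/

section levels
variable {d : ℕ} {γ₀ : ℝ}

theorem sq_one_sub_bounds (h0 : 0 < γ₀) (h1 : γ₀ ≤ 0.1) :
    0.81 ≤ (1 - γ₀) ^ 2 ∧ (1 - γ₀) ^ 2 ≤ 1 := by
  norm_num at h1
  exact ⟨by norm_num; nlinarith, by nlinarith⟩

theorem epochLevel_nonneg (γ₀ : ℝ) (d k : ℕ) : 0 ≤ epochLevel γ₀ d k := by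
  unfold epochLevel
  positivity

theorem epochLevel_pos (h0 : 0 < γ₀) (h1 : γ₀ ≤ 0.1) (hd : 3 ≤ d) {k : ℕ} (hk : 1 ≤ k) :
    0 < epochLevel γ₀ d k := by
  have h2 := (sq_one_sub_bounds h0 h1).1
  have hk' : (0 : ℝ) < k := by exact_mod_cast hk
  have hd' : (0 : ℝ) < d := by exact_mod_cast (by omega : 0 < d)
  norm_num at h2
  exact mul_pos (by linarith) (Real.sqrt_pos.2 (by positivity))

theorem monotone_epochLevel (γ₀ : ℝ) (d : ℕ) : Monotone (epochLevel γ₀ d) := by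
  intro j k hjk
  unfold epochLevel
  gcongr

theorem epochLevel_sq (γ₀ : ℝ) (d k : ℕ) :
    epochLevel γ₀ d k ^ 2 = ((1 - γ₀) ^ 2) ^ 2 * (k / d) := by
  rw [epochLevel, mul_pow, Real.sq_sqrt (by positivity)]

theorem epochLevel_one (γ₀ : ℝ) (d : ℕ) : epochLevel γ₀ d 1 = (1 - γ₀) ^ 2 * (1 / √d) := by
  rw [epochLevel, Nat.cast_one, Real.sqrt_div zero_le_one, Real.sqrt_one]

theorem epochLevel_self (γ₀ : ℝ) (hd : 3 ≤ d) : epochLevel γ₀ d d = (1 - γ₀) ^ 2 := by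
  have hd' : (d : ℝ) ≠ 0 := by exact_mod_cast (by omega : d ≠ 0)
  rw [epochLevel, div_self hd', Real.sqrt_one, mul_one]

theorem epochLevel_le (hd : 3 ≤ d) {k : ℕ} (hk : k ≤ d) : epochLevel γ₀ d k ≤ (1 - γ₀) ^ 2 :=
  (monotone_epochLevel γ₀ d hk).trans (epochLevel_self γ₀ hd).le

theorem epochLevel_mem (h0 : 0 < γ₀) (h1 : γ₀ ≤ 0.1) (hd : 3 ≤ d) {k : ℕ} (hk : k ≤ d) :
    epochLevel γ₀ d k ∈ Icc (0 : ℝ) 1 :=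
  ⟨epochLevel_nonneg γ₀ d k, (epochLevel_le hd hk).trans (sq_one_sub_bounds h0 h1).2⟩

theorem inv_sqrt_le_epochLevel (h0 : 0 < γ₀) (h1 : γ₀ ≤ 0.1) {k : ℕ} (hk : 1 ≤ k) :
    1 / √(d : ℝ) ≤ 1.25 * epochLevel γ₀ d k := by
  have h2 := monotone_epochLevel γ₀ d hk
  rw [epochLevel_one] at h2
  have h3 := (sq_one_sub_bounds h0 h1).1
  have h4 : 0 ≤ 1 / √(d : ℝ) := by positivity
  generalize 1 / √(d : ℝ) = y at *
  norm_num at h3 ⊢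
  nlinarith

theorem epochLevel_succ_mul (γ₀ : ℝ) (d k : ℕ) :
    (epochLevel γ₀ d (k + 1) - epochLevel γ₀ d k) * (epochLevel γ₀ d (k + 1) + epochLevel γ₀ d k)
      = ((1 - γ₀) ^ 2) ^ 2 / d := by
  have h := epochLevel_sq γ₀ d (k + 1)
  have h' := epochLevel_sq γ₀ d k
  push_cast at h
  have : (epochLevel γ₀ d (k + 1) - epochLevel γ₀ d k) *
      (epochLevel γ₀ d (k + 1) + epochLevel γ₀ d k) =
      epochLevel γ₀ d (k + 1) ^ 2 - epochLevel γ₀ d k ^ 2 := by ring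
  rw [this, h, h']
  ring

theorem epochLevel_succ_le {k : ℕ} (hk : 1 ≤ k) :
    epochLevel γ₀ d (k + 1) ≤ 1.42 * epochLevel γ₀ d k := by
  have hl := epochLevel_nonneg γ₀ d k
  refine (pow_le_pow_iff_left₀ (epochLevel_nonneg γ₀ d _) (by positivity) two_ne_zero).1 ?_
  rw [mul_pow, epochLevel_sq, epochLevel_sq]
  have hk' : (1 : ℝ) ≤ k := by exact_mod_cast hk
  have h2 : ((k + 1 : ℕ) : ℝ) / d ≤ 1.42 ^ 2 * (k / d) := by
    rw [← mul_div_assoc]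
    gcongr
    push_cast
    norm_num
    linarith
  calc ((1 - γ₀) ^ 2) ^ 2 * (((k + 1 : ℕ) : ℝ) / d)
      ≤ ((1 - γ₀) ^ 2) ^ 2 * (1.42 ^ 2 * (k / d)) := by gcongr
    _ = _ := by ring

/-- Together with the lower bound of the same order below, this says that consecutive levels satisfy
`ℓ_k (ℓ_{k+1} - ℓ_k) ≍ 1 / d`, since their squares differ by `(1 - γ₀) ^ 4 / d`. -/
theorem epochLevel_mul_diff_le (h0 : 0 < γ₀) (h1 : γ₀ ≤ 0.1) (k : ℕ) :
    epochLevel γ₀ d k * (epochLevel γ₀ d (k + 1) - epochLevel γ₀ d k) ≤ 1 / (2 * d) := by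
  have h2 := epochLevel_succ_mul γ₀ d k
  have h3 := sub_nonneg.2 (monotone_epochLevel γ₀ d (Nat.le_succ k))
  have h4 := (sq_one_sub_bounds h0 h1).2
  have h5 : ((1 - γ₀) ^ 2) ^ 2 / d ≤ 1 / (d : ℝ) := by
    gcongr
    exact pow_le_one₀ (sq_nonneg _) h4
  have h6 : 1 / (2 * (d : ℝ)) = 1 / d / 2 := by rw [div_div, mul_comm]
  rw [h6]
  nlinarith [mul_nonneg h3 h3]

theorem le_epochLevel_mul_diff (h0 : 0 < γ₀) (h1 : γ₀ ≤ 0.1) {k : ℕ} (hk : 1 ≤ k) :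
    1 / (4 * (d : ℝ)) ≤ epochLevel γ₀ d k * (epochLevel γ₀ d (k + 1) - epochLevel γ₀ d k) := by
  have h2 := epochLevel_succ_mul γ₀ d k
  have h3 := sub_nonneg.2 (monotone_epochLevel γ₀ d (Nat.le_succ k))
  have h4 := (sq_one_sub_bounds h0 h1).1
  have h5 : 0.65 / (d : ℝ) ≤ ((1 - γ₀) ^ 2) ^ 2 / d := by
    gcongr
    norm_num at h4 ⊢
    nlinarith
  have h6 : 1 / (4 * (d : ℝ)) = 0.25 * (1 / d) := by rw [one_div, mul_inv, one_div]; norm_num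
  have h7 : 0.65 / (d : ℝ) = 0.65 * (1 / d) := by ring
  have h8 := epochLevel_succ_le (γ₀ := γ₀) (d := d) hk
  have h9 : 0 ≤ 1 / (d : ℝ) := by positivity
  rw [h6]
  rw [h7] at h5
  rw [← h2] at h5
  have h10 := mul_le_mul_of_nonneg_left h8 h3
  generalize 1 / (d : ℝ) = y at *
  norm_num at h5 h10 ⊢
  nlinarith

theorem epochLevel_diff_div_le (h0 : 0 < γ₀) (h1 : γ₀ ≤ 0.1) (hd : 3 ≤ d) {k : ℕ}
    (hk : 1 ≤ k) :
    (epochLevel γ₀ d (k + 1) - epochLevel γ₀ d k) / epochLevel γ₀ d k ≤ 1 / (2 * k) := by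
  have hpos := epochLevel_pos h0 h1 hd hk
  have h2 := epochLevel_succ_mul γ₀ d k
  have h3 := sub_nonneg.2 (monotone_epochLevel γ₀ d (Nat.le_succ k))
  have hk' : (0 : ℝ) < k := by exact_mod_cast hk
  have h4 : ((1 - γ₀) ^ 2) ^ 2 / d * k = epochLevel γ₀ d k ^ 2 := by
    rw [epochLevel_sq]; ring
  rw [div_le_div_iff₀ hpos (by positivity), one_mul]
  have h5 : (epochLevel γ₀ d (k + 1) - epochLevel γ₀ d k) * (2 * epochLevel γ₀ d k) * k ≤
      epochLevel γ₀ d k * epochLevel γ₀ d k := by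
    rw [← sq, ← h4, ← h2]
    gcongr
    linarith [h3]
  refine le_of_mul_le_mul_right ?_ hpos
  linarith

end levels

section epochs
variable {f : ℝ → ℝ} {γ₀ c C δ : ℝ} {d : ℕ}

theorem epochStart_one : epochStart f γ₀ c C δ d 1 = 1 := by simp [epochStart]

theorem epochStart_succ {k : ℕ} (hk : 1 ≤ k) :
    epochStart f γ₀ c C δ d (k + 1) = epochStart f γ₀ c C δ d k + epochLength f γ₀ c C δ d k := by
  rw [epochStart, Finset.sum_Ico_succ_top hk, epochStart, add_assoc]

theorem monotone_epochStart : Monotone (epochStart f γ₀ c C δ d) := by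
  intro j k hjk
  unfold epochStart
  gcongr

theorem epochIndex_le (t : ℕ) : epochIndex f γ₀ c C δ d t ≤ d - 1 := Nat.findGreatest_le _

theorem epochIndex_eq {k t : ℕ} (hkd : k ≤ d - 1)
    (h1 : epochStart f γ₀ c C δ d k ≤ t) (h2 : t < epochStart f γ₀ c C δ d (k + 1)) :
    epochIndex f γ₀ c C δ d t = k := by
  refine le_antisymm ?_ (Nat.le_findGreatest hkd h1)
  by_contra hlt
  have hspec : epochStart f γ₀ c C δ d (epochIndex f γ₀ c C δ d t) ≤ t :=
    Nat.findGreatest_spec (P := fun k => epochStart f γ₀ c C δ d k ≤ t) hkd h1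
  have := monotone_epochStart (f := f) (γ₀ := γ₀) (c := c) (C := C) (δ := δ) (d := d)
    (Nat.succ_le_of_lt (not_le.1 hlt))
  exact absurd (this.trans hspec) (not_le.2 h2)

theorem epochIndex_spec (hd : 3 ≤ d) {t : ℕ} (ht : 1 ≤ t)
    (htT : t < epochStart f γ₀ c C δ d d) :
    1 ≤ epochIndex f γ₀ c C δ d t ∧ epochStart f γ₀ c C δ d (epochIndex f γ₀ c C δ d t) ≤ t ∧
      t < epochStart f γ₀ c C δ d (epochIndex f γ₀ c C δ d t + 1) := by
  have h1 : epochStart f γ₀ c C δ d 1 ≤ t := by rwa [epochStart_one]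
  have hone : 1 ≤ epochIndex f γ₀ c C δ d t :=
    Nat.le_findGreatest (P := fun k => epochStart f γ₀ c C δ d k ≤ t) (by omega) h1
  refine ⟨hone, Nat.findGreatest_spec (P := fun k => epochStart f γ₀ c C δ d k ≤ t)
    (by omega : 1 ≤ d - 1) h1, ?_⟩
  rcases Nat.lt_or_ge (epochIndex f γ₀ c C δ d t) (d - 1) with hlt | hge
  · exact not_le.1 (Nat.findGreatest_is_greatest
      (P := fun k => epochStart f γ₀ c C δ d k ≤ t) (n := d - 1) (Nat.lt_succ_self _) hlt)
  · have : epochIndex f γ₀ c C δ d t + 1 = d := by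
      have := epochIndex_le (f := f) (γ₀ := γ₀) (c := c) (C := C) (δ := δ) (d := d) t
      omega
    rwa [this]

/-- Sums over rounds of a quantity that depends on the epoch only. -/
theorem sum_epochs (F : ℕ → ℝ) {j k : ℕ} (hj : 1 ≤ j) (hjk : j ≤ k) (hkd : k ≤ d) :
    ∑ i ∈ Finset.Ico (epochStart f γ₀ c C δ d j) (epochStart f γ₀ c C δ d k),
      F (epochIndex f γ₀ c C δ d i) =
    ∑ e ∈ Finset.Ico j k, (epochLength f γ₀ c C δ d e : ℝ) * F e := by
  induction k, hjk using Nat.le_induction with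
  | base => simp
  | succ k hjk ih =>
    rw [Finset.sum_Ico_succ_top hjk, ← ih (by omega),
      ← Finset.sum_Ico_consecutive _ (monotone_epochStart hjk) (monotone_epochStart k.le_succ)]
    congr 1
    rw [Finset.sum_congr rfl (g := fun _ => F k) fun i hi => by
      rw [Finset.mem_Ico] at hi
      rw [epochIndex_eq (by omega) hi.1 hi.2]]
    rw [Finset.sum_const, Nat.card_Ico, epochStart_succ (by omega), Nat.add_sub_cancel_left,
      nsmul_eq_mul]

end epochs

section convex_link
variable {f : ℝ → ℝ} {γ₀ γ₁ γ₂ : ℝ} {d : ℕ}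

theorem LinkAssumption.linkDeriv_nonneg (hL : LinkAssumption f γ₀ γ₁ γ₂) (x : ℝ) :
    0 ≤ linkDeriv f x :=
  (hL.mono.mono (Icc_subset_Icc (by norm_num) le_rfl)).derivWithin_nonneg

theorem LinkAssumption.monotoneOn_linkDeriv (hL : LinkAssumption f γ₀ γ₁ γ₂)
    (hf : ConvexOn ℝ (Icc 0 1) f) : MonotoneOn (linkDeriv f) (Icc 0 1) :=
  hf.monotoneOn_derivWithin hL.diff

theorem LinkAssumption.linkDeriv_le (hL : LinkAssumption f γ₀ γ₁ γ₂)
    (hf : ConvexOn ℝ (Icc 0 1) f) (h0 : 0 < γ₀) {x : ℝ} (hx : x ∈ Icc (0 : ℝ) 1) :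
    linkDeriv f x ≤ γ₂ :=
  (hL.monotoneOn_linkDeriv hf hx ⟨zero_le_one, le_rfl⟩ hx.2).trans
    (hL.locallyLinear 1 ⟨by linarith, le_rfl⟩).2

/-- The grid `1 / (2 √d), ℓ₁, ℓ₂, …` of correlations, with `ℓ_k` the epoch levels. -/
noncomputable def levelGrid (γ₀ : ℝ) (d k : ℕ) : ℝ :=
  if k = 0 then 1 / (2 * √d) else epochLevel γ₀ d k

theorem levelGrid_of_pos {k : ℕ} (hk : 1 ≤ k) : levelGrid γ₀ d k = epochLevel γ₀ d k :=
  if_neg (by omega)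

theorem levelGrid_diff (h0 : 0 < γ₀) (h1 : γ₀ ≤ 0.1) (hd : 3 ≤ d) (k : ℕ) :
    0 < levelGrid γ₀ d k ∧ levelGrid γ₀ d k < levelGrid γ₀ d (k + 1) ∧
      1 / (8 * (d : ℝ)) ≤ levelGrid γ₀ d k * (levelGrid γ₀ d (k + 1) - levelGrid γ₀ d k) := by
  have hd' : (3 : ℝ) ≤ d := by exact_mod_cast hd
  have hmain : 0 < levelGrid γ₀ d k ∧
      1 / (8 * (d : ℝ)) ≤ levelGrid γ₀ d k * (levelGrid γ₀ d (k + 1) - levelGrid γ₀ d k) := by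
    rcases Nat.eq_zero_or_pos k with rfl | hk
    · have hsd : 0 < √(d : ℝ) := Real.sqrt_pos.2 (by linarith)
      have hsd2 : √(d : ℝ) ^ 2 = d := Real.sq_sqrt (by linarith)
      rw [levelGrid_of_pos le_rfl, levelGrid, if_pos rfl, epochLevel_one]
      refine ⟨by positivity, ?_⟩
      have h2 := (sq_one_sub_bounds h0 h1).1
      have h3 : 1 / (2 * √(d : ℝ)) * ((1 - γ₀) ^ 2 * (1 / √d) - 1 / (2 * √d)) =
          ((1 - γ₀) ^ 2 - 1 / 2) / 2 / √d ^ 2 := by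
        field_simp
      rw [h3, hsd2, ← div_div]
      exact div_le_div_of_nonneg_right (by norm_num at h2 ⊢; linarith) (by linarith)
    · rw [levelGrid_of_pos hk, levelGrid_of_pos (by omega)]
      refine ⟨epochLevel_pos h0 h1 hd hk, le_trans ?_ (le_epochLevel_mul_diff h0 h1 hk)⟩
      gcongr
      norm_num
  refine ⟨hmain.1, ?_, hmain.2⟩
  have h3 : 0 < 1 / (8 * (d : ℝ)) := by positivity
  exact sub_pos.1 (pos_of_mul_pos_right (h3.trans_le hmain.2) hmain.1.le)

/-- The integrand of the burn-in integral. -/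
noncomputable def burnInDensity (f : ℝ → ℝ) (m : ℝ) : ℝ≥0∞ :=
  ENNReal.ofReal m / ENNReal.ofReal (linkDeriv f m) ^ 2

/-- On a cell of the grid the integrand of the burn-in integral is at least its value with `m` at
the left end and `f'` at the right end. -/
theorem cell_le_lintegral (hL : LinkAssumption f γ₀ γ₁ γ₂) (hf : ConvexOn ℝ (Icc 0 1) f)
    (h0 : 0 < γ₀) (h1 : γ₀ ≤ 0.1) (hd : 3 ≤ d) {k : ℕ} (hk : k + 1 ≤ d) :
    ENNReal.ofReal (1 / (8 * (d : ℝ))) /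
        ENNReal.ofReal (linkDeriv f (epochLevel γ₀ d (k + 1))) ^ 2 ≤
      ∫⁻ m in Ioc (levelGrid γ₀ d k) (levelGrid γ₀ d (k + 1)), burnInDensity f m := by
  obtain ⟨hpos, hlt, hle⟩ := levelGrid_diff h0 h1 hd k
  set D := ENNReal.ofReal (linkDeriv f (epochLevel γ₀ d (k + 1))) ^ 2
  calc ENNReal.ofReal (1 / (8 * (d : ℝ))) / D
      ≤ ENNReal.ofReal (levelGrid γ₀ d k * (levelGrid γ₀ d (k + 1) - levelGrid γ₀ d k)) / D := by
        gcongr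
    _ = ∫⁻ m in Ioc (levelGrid γ₀ d k) (levelGrid γ₀ d (k + 1)),
          ENNReal.ofReal (levelGrid γ₀ d k) / D := by
        rw [setLIntegral_const, Real.volume_Ioc, ENNReal.ofReal_mul hpos.le,
          div_eq_mul_inv, div_eq_mul_inv]
        ring
    _ ≤ _ := by
        refine setLIntegral_mono' measurableSet_Ioc fun m hm => ?_
        have hmem := epochLevel_mem h0 h1 hd hk
        rw [← levelGrid_of_pos (by omega)] at hmem
        have hm' : m ∈ Icc (0 : ℝ) 1 := ⟨(hpos.trans hm.1).le, hm.2.trans hmem.2⟩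
        refine ENNReal.div_le_div (ENNReal.ofReal_le_ofReal hm.1.le) ?_
        have := hL.monotoneOn_linkDeriv hf hm' hmem hm.2
        rw [levelGrid_of_pos (by omega)] at this
        exact pow_le_pow_left' (ENNReal.ofReal_le_ofReal this) 2

theorem sum_cells_le_burnInIntegral (hL : LinkAssumption f γ₀ γ₁ γ₂)
    (hf : ConvexOn ℝ (Icc 0 1) f) (h0 : 0 < γ₀) (h1 : γ₀ ≤ 0.1) (hd : 3 ≤ d) :
    ∑ k ∈ Finset.range (d - 1), ENNReal.ofReal (1 / (8 * (d : ℝ))) /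
        ENNReal.ofReal (linkDeriv f (epochLevel γ₀ d (k + 1))) ^ 2 ≤ burnInIntegral f γ₀ d := by
  have hgrid := levelGrid_diff h0 h1 hd
  have hmono : Monotone (levelGrid γ₀ d) := monotone_nat_of_le_succ fun k => (hgrid k).2.1.le
  have htele : ∀ n, ∑ k ∈ Finset.range n,
      ∫⁻ m in Ioc (levelGrid γ₀ d k) (levelGrid γ₀ d (k + 1)), burnInDensity f m =
      ∫⁻ m in Ioc (levelGrid γ₀ d 0) (levelGrid γ₀ d n), burnInDensity f m := by
    intro n
    induction n with
    | zero => simp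
    | succ n ih =>
      rw [Finset.sum_range_succ, ih, ← lintegral_union measurableSet_Ioc
        (Ioc_disjoint_Ioc_of_le le_rfl), Ioc_union_Ioc_eq_Ioc (hmono (Nat.zero_le n))
        (hmono n.le_succ)]
  calc _ ≤ ∑ k ∈ Finset.range (d - 1),
        ∫⁻ m in Ioc (levelGrid γ₀ d k) (levelGrid γ₀ d (k + 1)), burnInDensity f m :=
        Finset.sum_le_sum fun k hk => cell_le_lintegral hL hf h0 h1 hd
          (by rw [Finset.mem_range] at hk; omega)
    _ = ∫⁻ m in Ioc (levelGrid γ₀ d 0) (levelGrid γ₀ d (d - 1)), burnInDensity f m := htele _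
    _ ≤ ∫⁻ m in Icc (1 / (2 * √(d : ℝ))) (1 - γ₀ / 4), burnInDensity f m := by
        refine lintegral_mono_set (Ioc_subset_Icc_self.trans (Icc_subset_Icc ?_ ?_))
        · rw [levelGrid, if_pos rfl]
        · rw [levelGrid_of_pos (by omega)]
          refine (epochLevel_le hd (Nat.sub_le d 1)).trans ?_
          norm_num at h1
          nlinarith
    _ = _ := rfl

/-- If `f'(ℓ₁) = 0`, then the first cell already makes the burn-in integral infinite. -/
theorem linkDeriv_epochLevel_pos (hL : LinkAssumption f γ₀ γ₁ γ₂)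
    (hf : ConvexOn ℝ (Icc 0 1) f) (h0 : 0 < γ₀) (h1 : γ₀ ≤ 0.1) (hd : 3 ≤ d)
    (hI : burnInIntegral f γ₀ d < ∞) {k : ℕ} (hk : 1 ≤ k) (hkd : k ≤ d) :
    0 < linkDeriv f (epochLevel γ₀ d k) := by
  have hone : 0 < linkDeriv f (epochLevel γ₀ d 1) := by
    refine lt_of_le_of_ne (hL.linkDeriv_nonneg _) fun heq => ?_
    have h2 := (Finset.single_le_sum (fun _ _ => zero_le) (Finset.mem_range.2
      (by omega : 0 < d - 1))).trans (sum_cells_le_burnInIntegral hL hf h0 h1 hd)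
    have h3 : ENNReal.ofReal (1 / (8 * (d : ℝ))) ≠ 0 := by
      have hd' : (0 : ℝ) < d := by exact_mod_cast (by omega : 0 < d)
      exact (ENNReal.ofReal_pos.2 (by positivity)).ne'
    rw [zero_add, ← heq, ENNReal.ofReal_zero, zero_pow two_ne_zero, ENNReal.div_zero h3] at h2
    exact absurd (top_le_iff.1 h2) hI.ne
  exact hone.trans_le (hL.monotoneOn_linkDeriv hf (epochLevel_mem h0 h1 hd (by omega))
    (epochLevel_mem h0 h1 hd hkd) (monotone_epochLevel γ₀ d hk))

end convex_link

/-! ### Arithmetic of the epoch schedule -/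

section epoch_arithmetic

/-- The drift dominates the normalization loss in an epoch of level `ℓ`, up to the cap `4 ℓ`. -/
theorem epoch_loss_le {γ₀ γ₂ c D ℓ Λ G d y h : ℝ} (h0 : 0 < γ₀) (hγ₂ : 0 < γ₂) (hc : 0 < c)
    (hcγ : c ≤ γ₀ / (4000 * γ₂)) (hD : 0 ≤ D) (hℓ : 0 < ℓ) (hΛ : 1 ≤ Λ) (hd : 0 < d)
    (hG : G ≤ γ₂ * √γ₀) (hy : 1 / y ≤ 1.25 * ℓ) (hh : h ≤ 4 * ℓ) (hyh : 0 ≤ 2 / y + h) :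
    c * D / (Λ ^ 2 * d * ℓ) * (16 * G * Λ) * (2 / y + h) ≤ D * √γ₀ * γ₀ / (32 * d) := by
  have hq0 : 0 < √γ₀ := Real.sqrt_pos.2 h0
  have hΛ0 : 0 < Λ := by linarith
  have h2 : 2 / y + h ≤ 6.5 * ℓ := by
    have : 2 / y = 2 * (1 / y) := by ring
    rw [this]
    norm_num at hy ⊢
    linarith
  calc c * D / (Λ ^ 2 * d * ℓ) * (16 * G * Λ) * (2 / y + h)
      ≤ c * D / (Λ ^ 2 * d * ℓ) * (16 * (γ₂ * √γ₀) * Λ) * (6.5 * ℓ) := by gcongr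
    _ = 104 * c * γ₂ * (D * √γ₀ / d) / Λ := by
        field_simp
        ring
    _ ≤ 104 * c * γ₂ * (D * √γ₀ / d) := div_le_self (by positivity) hΛ
    _ ≤ 104 * (γ₀ / (4000 * γ₂)) * γ₂ * (D * √γ₀ / d) := by gcongr
    _ = 104 / 4000 * (γ₀ * (D * √γ₀ / d)) := by field_simp
    _ ≤ 1 / 32 * (γ₀ * (D * √γ₀ / d)) := by
        refine mul_le_mul_of_nonneg_right (by norm_num) (by positivity)
    _ = _ := by
        field_simp

theorem epoch_rate_le {γ₀ γ₂ c D ℓ Λ d y : ℝ} (hγ₂ : 0 < γ₂) (hc : 0 < c)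
    (hcγ : c ≤ γ₀ / (800 * γ₂ ^ 2)) (hD : 0 ≤ D) (hDγ : D ≤ γ₂) (hℓ : 0 < ℓ) (hΛ : 1 ≤ Λ)
    (hyd : y ^ 2 = d) (hy0 : 0 < y) (hy : 1 / y ≤ 1.25 * ℓ) :
    y * Λ * (c * D / (Λ ^ 2 * d * ℓ)) ≤ γ₀ / (400 * γ₂) := by
  have hΛ0 : 0 < Λ := by linarith
  calc y * Λ * (c * D / (Λ ^ 2 * d * ℓ)) = c * D * (1 / y) / ℓ / Λ := by
        rw [← hyd]
        field_simp
    _ ≤ c * D * (1 / y) / ℓ := div_le_self (by positivity) hΛ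
    _ ≤ c * γ₂ * (1.25 * ℓ) / ℓ := by gcongr
    _ = 1.25 * (c * γ₂) := by field_simp
    _ ≤ 2 * (γ₀ / (800 * γ₂ ^ 2) * γ₂) := by
        have : 0 < c * γ₂ := by positivity
        have : c * γ₂ ≤ γ₀ / (800 * γ₂ ^ 2) * γ₂ := by gcongr
        norm_num
        linarith
    _ = _ := by
        field_simp
        ring

/-- The gain of an epoch is at least four times the distance of the levels. -/
theorem epoch_gain_ge {γ₀ γ₁ C ρ D G d Δ : ℝ} (h0 : 0 < γ₀) (hγ₁ : 0 < γ₁)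
    (hC : C = 128 / (γ₁ * γ₀ ^ 2)) (hρ : 0 < ρ) (hD : 0 < D) (hd : 0 < d) (hΔ : 0 ≤ Δ)
    (hG : γ₁ * √γ₀ ≤ G) :
    4 * Δ ≤ C * d * Δ / (ρ * D) * (ρ * G * (D * √γ₀ * γ₀ / (32 * d))) := by
  have hq : √γ₀ * √γ₀ = γ₀ := Real.mul_self_sqrt h0.le
  have hC0 : 0 < C := by rw [hC]; positivity
  calc 4 * Δ = C * Δ * γ₀ * (γ₁ * (√γ₀ * √γ₀)) / 32 := by
        rw [hC, hq]
        field_simp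
        ring
    _ = C * Δ * γ₀ * √γ₀ * (γ₁ * √γ₀) / 32 := by ring
    _ ≤ C * Δ * γ₀ * √γ₀ * G / 32 := by gcongr
    _ = _ := by field_simp

/-- After a return to the cap of an epoch of level `ℓ`, the gains of the epochs from the next level
`ℓ'` on, collected in `S`, suffice for the target `u` at level `p`. The return costs little: `4 ℓ`
is well above `1.25 ℓ'`. -/
theorem target_le_of_reset {γ₀ ℓ ℓ' p y u S : ℝ} (h0 : 0 < γ₀) (h1 : γ₀ ≤ 0.1) (hℓ : 0 ≤ ℓ)
    (hℓ' : ℓ' ≤ 1.42 * ℓ) (hy1 : 1 / y ≤ 1) (hyℓ : 1 / y ≤ 1.25 * ℓ)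
    (hu1 : u ≤ 1.25 * p) (hu2 : u ≤ 1 - γ₀ / 4) (hS0 : 0 ≤ S) (hS : 4 * (p - ℓ') ≤ S) :
    u ≤ (1 - γ₀ / 32) * min (4 * ℓ) (1 - γ₀ / 8) - 3 * (γ₀ / 32) / y + S := by
  rw [div_eq_mul_one_div (3 * (γ₀ / 32)) y]
  generalize 1 / y = z at *
  rcases min_choice (4 * ℓ) (1 - γ₀ / 8) with h | h <;> rw [h]
  · have h2 : 3.9 * ℓ ≤ (1 - γ₀ / 32) * (4 * ℓ) - 3 * (γ₀ / 32) * z := by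
      norm_num at *
      nlinarith
    norm_num at *
    linarith
  · have h2 := cap_margin h0.le
    nlinarith

end epoch_arithmetic

section epoch_schedule
variable {f : ℝ → ℝ} {γ₀ γ₁ γ₂ c C δ : ℝ} {d : ℕ}

theorem epochRate_nonneg (hL : LinkAssumption f γ₀ γ₁ γ₂) (hc : 0 < c) (k : ℕ) :
    0 ≤ epochRate f γ₀ c δ d k := by
  have h2 := hL.linkDeriv_nonneg (epochLevel γ₀ d k)
  have h3 := epochLevel_nonneg γ₀ d k
  unfold epochRate
  positivity

theorem epochRate_pos (hc : 0 < c) (hd : 3 ≤ d) (hΛ : 1 ≤ Real.log (d / δ)) {k : ℕ}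
    (hℓ : 0 < epochLevel γ₀ d k) (hD : 0 < linkDeriv f (epochLevel γ₀ d k)) :
    0 < epochRate f γ₀ c δ d k := by
  have hd' : (0 : ℝ) < d := by exact_mod_cast (by omega : 0 < d)
  have hΛ0 : 0 < Real.log (d / δ) := by linarith
  unfold epochRate
  positivity

/-- The length of an epoch before rounding. -/
noncomputable def epochDuration (f : ℝ → ℝ) (γ₀ c C δ : ℝ) (d k : ℕ) : ℝ :=
  C * d * (epochLevel γ₀ d (k + 1) - epochLevel γ₀ d k) /
    (epochRate f γ₀ c δ d k * linkDeriv f (epochLevel γ₀ d k))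

theorem epochDuration_eq (hc : 0 < c) (hd : 3 ≤ d) (hΛ : 1 ≤ Real.log (d / δ)) {k : ℕ}
    (hℓ : 0 < epochLevel γ₀ d k) (hD : 0 < linkDeriv f (epochLevel γ₀ d k)) :
    epochDuration f γ₀ c C δ d k = C / c * d ^ 2 * Real.log (d / δ) ^ 2 *
      (epochLevel γ₀ d k * (epochLevel γ₀ d (k + 1) - epochLevel γ₀ d k) /
        linkDeriv f (epochLevel γ₀ d k) ^ 2) := by
  have hd' : (0 : ℝ) < d := by exact_mod_cast (by omega : 0 < d)
  have hΛ0 : 0 < Real.log (d / δ) := by linarith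
  rw [epochDuration, epochRate]
  field_simp

theorem le_epochLength (k : ℕ) :
    epochDuration f γ₀ c C δ d k ≤ epochLength f γ₀ c C δ d k := Nat.le_ceil _

/-- An epoch lasts at least one round before rounding, so that rounding up costs at most a factor of
two. -/
theorem one_le_epochDuration (h0 : 0 < γ₀) (h1 : γ₀ ≤ 0.1) (hγ₂ : 0 < γ₂) (hc : 0 < c)
    (hC : 0 < C) (hcC : c ≤ C / (4 * γ₂ ^ 2)) (hd : 3 ≤ d) (hΛ : 1 ≤ Real.log (d / δ)) {k : ℕ}
    (hk : 1 ≤ k) (hD : 0 < linkDeriv f (epochLevel γ₀ d k))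
    (hDγ : linkDeriv f (epochLevel γ₀ d k) ≤ γ₂) : 1 ≤ epochDuration f γ₀ c C δ d k := by
  have hd' : (3 : ℝ) ≤ d := by exact_mod_cast hd
  rw [epochDuration_eq hc hd hΛ (epochLevel_pos h0 h1 hd hk) hD]
  have h2 := le_epochLevel_mul_diff (d := d) h0 h1 hk
  generalize epochLevel γ₀ d k * (epochLevel γ₀ d (k + 1) - epochLevel γ₀ d k) = y at *
  have hy : 0 ≤ y := le_trans (by positivity) h2
  generalize linkDeriv f (epochLevel γ₀ d k) = D at *
  have h3 : 4 * γ₂ ^ 2 * c ≤ C := by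
    rw [le_div_iff₀ (by positivity)] at hcC
    linarith
  calc (1 : ℝ) ≤ d := by linarith
    _ = 4 * γ₂ ^ 2 * c / c * d ^ 2 * 1 ^ 2 * (1 / (4 * d) / γ₂ ^ 2) := by field_simp
    _ ≤ _ := by gcongr

theorem epochLength_le (hone : 1 ≤ epochDuration f γ₀ c C δ d k) :
    (epochLength f γ₀ c C δ d k : ℝ) ≤ 2 * epochDuration f γ₀ c C δ d k := by
  have h2 : (epochLength f γ₀ c C δ d k : ℝ) < epochDuration f γ₀ c C δ d k + 1 :=
    Nat.ceil_lt_add_one (by unfold epochDuration at hone; linarith)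
  linarith

theorem epochLength_mul_sq_rate_le (h0 : 0 < γ₀) (h1 : γ₀ ≤ 0.1) (hc : 0 < c) (hC : 0 < C)
    (hd : 3 ≤ d) (hΛ : 1 ≤ Real.log (d / δ)) {k : ℕ} (hk : 1 ≤ k)
    (hD : 0 < linkDeriv f (epochLevel γ₀ d k)) (hone : 1 ≤ epochDuration f γ₀ c C δ d k) :
    (epochLength f γ₀ c C δ d k : ℝ) * epochRate f γ₀ c δ d k ^ 2 ≤
      C * c / Real.log (d / δ) ^ 2 * (k : ℝ)⁻¹ := by
  have hd' : (0 : ℝ) < d := by exact_mod_cast (by omega : 0 < d)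
  have hℓ := epochLevel_pos h0 h1 hd hk
  have hdiff := epochLevel_diff_div_le h0 h1 hd hk
  have hk' : (0 : ℝ) < k := by exact_mod_cast hk
  calc (epochLength f γ₀ c C δ d k : ℝ) * epochRate f γ₀ c δ d k ^ 2
      ≤ 2 * epochDuration f γ₀ c C δ d k * epochRate f γ₀ c δ d k ^ 2 := by
        gcongr
        exact epochLength_le hone
    _ = 2 * (C * c / Real.log (d / δ) ^ 2) *
        ((epochLevel γ₀ d (k + 1) - epochLevel γ₀ d k) / epochLevel γ₀ d k) := by
        have hΛ0 : 0 < Real.log (d / δ) := by linarith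
        rw [epochDuration_eq hc hd hΛ hℓ hD, epochRate]
        field_simp
    _ ≤ 2 * (C * c / Real.log (d / δ) ^ 2) * (1 / (2 * k)) := by gcongr
    _ = _ := by field_simp

/-- The sum of the squared learning rates over all rounds is a harmonic sum over the epochs, and the
logarithm it produces is absorbed by `log (d / δ)`. -/
theorem sum_epochLength_mul_sq_rate_le (h0 : 0 < γ₀) (h1 : γ₀ ≤ 0.1) (hc : 0 < c) (hC : 0 < C)
    (hδ : 0 < δ) (hδ1 : δ < 1) (hd : 3 ≤ d) (hΛ : 1 ≤ Real.log (d / δ))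
    (hD : ∀ k, 1 ≤ k → k ≤ d → 0 < linkDeriv f (epochLevel γ₀ d k))
    (hone : ∀ k, 1 ≤ k → k ≤ d → 1 ≤ epochDuration f γ₀ c C δ d k) :
    ∑ e ∈ Finset.Ico 1 d, (epochLength f γ₀ c C δ d e : ℝ) * epochRate f γ₀ c δ d e ^ 2 ≤
      2 * (C * c) / Real.log (d / δ) := by
  have hd' : (3 : ℝ) ≤ d := by exact_mod_cast hd
  have hharm : ∑ e ∈ Finset.Ico 1 d, (e : ℝ)⁻¹ ≤ 2 * Real.log (d / δ) := by
    have h2 := harmonic_le_one_add_log d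
    rw [harmonic_eq_sum_Icc] at h2
    push_cast at h2
    have h3 : ∑ e ∈ Finset.Ico 1 d, (e : ℝ)⁻¹ ≤ ∑ e ∈ Finset.Icc 1 d, (e : ℝ)⁻¹ :=
      Finset.sum_le_sum_of_subset_of_nonneg Finset.Ico_subset_Icc_self fun _ _ _ => by positivity
    have h4 : Real.log d ≤ Real.log (d / δ) :=
      Real.log_le_log (by linarith) (le_div_self (by linarith) hδ hδ1.le)
    linarith
  calc _ ≤ ∑ e ∈ Finset.Ico 1 d, C * c / Real.log (d / δ) ^ 2 * (e : ℝ)⁻¹ := by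
        refine Finset.sum_le_sum fun e he => ?_
        rw [Finset.mem_Ico] at he
        exact epochLength_mul_sq_rate_le h0 h1 hc hC hd hΛ he.1 (hD e he.1 he.2.le)
          (hone e he.1 he.2.le)
    _ ≤ C * c / Real.log (d / δ) ^ 2 * (2 * Real.log (d / δ)) := by
        rw [← Finset.mul_sum]
        gcongr
    _ = _ := by
        have hΛ0 : 0 < Real.log (d / δ) := by linarith
        field_simp

theorem epochStart_self_le (h0 : 0 < γ₀) (h1 : γ₀ ≤ 0.1) (hc : 0 < c) (hC : 0 < C)
    (hd : 3 ≤ d) (hΛ : 1 ≤ Real.log (d / δ))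
    (hD : ∀ k, 1 ≤ k → k ≤ d → 0 < linkDeriv f (epochLevel γ₀ d k))
    (hone : ∀ k, 1 ≤ k → k ≤ d → 1 ≤ epochDuration f γ₀ c C δ d k) :
    (epochStart f γ₀ c C δ d d : ℝ) ≤ 16 * C / c * d ^ 2 * Real.log (d / δ) ^ 2 *
      ∑ k ∈ Finset.range (d - 1),
        1 / (8 * (d : ℝ)) / linkDeriv f (epochLevel γ₀ d (k + 1)) ^ 2 := by
  have hd' : (3 : ℝ) ≤ d := by exact_mod_cast hd
  have hfirst : 1 ≤ ∑ k ∈ Finset.Ico 1 d, (epochLength f γ₀ c C δ d k : ℝ) :=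
    ((hone 1 le_rfl (by omega)).trans (le_epochLength 1)).trans
      (Finset.single_le_sum (f := fun k => (epochLength f γ₀ c C δ d k : ℝ))
        (fun _ _ => Nat.cast_nonneg _) (Finset.mem_Ico.2 ⟨le_rfl, by omega⟩))
  have hsum : ∑ k ∈ Finset.Ico 1 d, (epochLength f γ₀ c C δ d k : ℝ) ≤
      ∑ k ∈ Finset.Ico 1 d, 8 * C / c * d ^ 2 * Real.log (d / δ) ^ 2 *
        (1 / (8 * (d : ℝ)) / linkDeriv f (epochLevel γ₀ d k) ^ 2) := by
    refine Finset.sum_le_sum fun k hk => ?_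
    rw [Finset.mem_Ico] at hk
    have hDk := hD k hk.1 hk.2.le
    have h2 := hone k hk.1 hk.2.le
    refine (epochLength_le h2).trans ?_
    rw [epochDuration_eq hc hd hΛ (epochLevel_pos h0 h1 hd hk.1) hDk]
    calc _ ≤ 2 * (C / c * d ^ 2 * Real.log (d / δ) ^ 2 *
        (1 / (2 * (d : ℝ)) / linkDeriv f (epochLevel γ₀ d k) ^ 2)) := by
          gcongr
          exact epochLevel_mul_diff_le h0 h1 k
      _ = _ := by
          field_simp
  have hshift : ∑ k ∈ Finset.Ico 1 d, 1 / (8 * (d : ℝ)) / linkDeriv f (epochLevel γ₀ d k) ^ 2 =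
      ∑ k ∈ Finset.range (d - 1),
        1 / (8 * (d : ℝ)) / linkDeriv f (epochLevel γ₀ d (k + 1)) ^ 2 := by
    rw [Finset.sum_Ico_eq_sum_range]
    simp only [add_comm 1]
  rw [← Finset.mul_sum, hshift] at hsum
  have hT : (epochStart f γ₀ c C δ d d : ℝ) =
      1 + ∑ k ∈ Finset.Ico 1 d, (epochLength f γ₀ c C δ d k : ℝ) := by
    rw [epochStart]
    push_cast
    rfl
  rw [hT]
  generalize ∑ k ∈ Finset.Ico 1 d, (epochLength f γ₀ c C δ d k : ℝ) = A at *
  calc 1 + A ≤ 2 * A := by linarith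
    _ ≤ 2 * _ := mul_le_mul_of_nonneg_left hsum (by norm_num)
    _ = _ := by ring

/-- The total number of rounds is controlled by the burn-in integral. -/
theorem epochStart_self_le_burnInIntegral (hL : LinkAssumption f γ₀ γ₁ γ₂)
    (hf : ConvexOn ℝ (Icc 0 1) f) (h0 : 0 < γ₀) (h1 : γ₀ ≤ 0.1) (hc : 0 < c) (hC : 0 < C)
    (hd : 3 ≤ d) (hΛ : 1 ≤ Real.log (d / δ))
    (hD : ∀ k, 1 ≤ k → k ≤ d → 0 < linkDeriv f (epochLevel γ₀ d k))
    (hone : ∀ k, 1 ≤ k → k ≤ d → 1 ≤ epochDuration f γ₀ c C δ d k) :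
    (epochStart f γ₀ c C δ d d : ℝ≥0∞) ≤
      ENNReal.ofReal (16 * C / c * d ^ 2 * Real.log (d / δ) ^ 2) * burnInIntegral f γ₀ d := by
  have h2 := epochStart_self_le h0 h1 hc hC hd hΛ hD hone
  have h3 := ENNReal.ofReal_le_ofReal h2
  rw [ENNReal.ofReal_natCast, ENNReal.ofReal_mul (by positivity),
    ENNReal.ofReal_sum_of_nonneg fun _ _ => by positivity] at h3
  refine h3.trans (mul_le_mul_right ?_ _)
  refine le_trans (Finset.sum_le_sum fun k hk => ?_) (sum_cells_le_burnInIntegral hL hf h0 h1 hd)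
  rw [Finset.mem_range] at hk
  have hDk := hD (k + 1) (by omega) (by omega)
  rw [ENNReal.ofReal_div_of_pos (by positivity), ENNReal.ofReal_pow hDk.le]

/-- The expected progress from the first round of epoch `j` to the first round of epoch `p`. -/
theorem epoch_progress {g : ℕ → ℝ} (hg0 : ∀ e, 0 ≤ g e)
    (hg : ∀ e, 1 ≤ e → e ≤ d → 4 * (epochLevel γ₀ d (e + 1) - epochLevel γ₀ d e) ≤
      (epochLength f γ₀ c C δ d e : ℝ) * g e)
    {j p s t : ℕ} (hj : 1 ≤ j) (hpd : p ≤ d) (hs : s ≤ epochStart f γ₀ c C δ d j)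
    (ht : epochStart f γ₀ c C δ d p ≤ t) :
    4 * (epochLevel γ₀ d p - epochLevel γ₀ d j) ≤
      ∑ i ∈ Finset.Ico s t, g (epochIndex f γ₀ c C δ d i) := by
  rcases le_total p j with hpj | hjp
  · have h2 := monotone_epochLevel γ₀ d hpj
    exact le_trans (by linarith) (Finset.sum_nonneg fun _ _ => hg0 _)
  · calc 4 * (epochLevel γ₀ d p - epochLevel γ₀ d j)
        = ∑ e ∈ Finset.Ico j p, 4 * (epochLevel γ₀ d (e + 1) - epochLevel γ₀ d e) := by
          rw [← Finset.mul_sum, Finset.sum_Ico_sub _ hjp]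
      _ ≤ ∑ e ∈ Finset.Ico j p, (epochLength f γ₀ c C δ d e : ℝ) * g e := by
          refine Finset.sum_le_sum fun e he => ?_
          rw [Finset.mem_Ico] at he
          exact hg e (by omega) (by omega)
      _ = ∑ i ∈ Finset.Ico (epochStart f γ₀ c C δ d j) (epochStart f γ₀ c C δ d p),
            g (epochIndex f γ₀ c C δ d i) := (sum_epochs g hj hjp hpd).symm
      _ ≤ _ := Finset.sum_le_sum_of_subset_of_nonneg (Finset.Ico_subset_Ico hs ht)
          fun _ _ _ => hg0 _

end epoch_schedule

/-! ### Burn-in along the epochs -/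

section epoch_target
variable {f : ℝ → ℝ} {γ₀ γ₁ γ₂ c C δ : ℝ} {d : ℕ}

/-- The epoch of round `t`, with the value `d` from round `epochStart d` on. -/
noncomputable def epochPosition (f : ℝ → ℝ) (γ₀ c C δ : ℝ) (d t : ℕ) : ℕ :=
  if t < epochStart f γ₀ c C δ d d then epochIndex f γ₀ c C δ d t else d

/-- The correlation that the iterate of round `t` exceeds: in epoch `k` it is `ℓ_k / √(1 - γ₀)`,
so that the actions have correlation about `ℓ_k`. -/
noncomputable def epochTarget (f : ℝ → ℝ) (γ₀ c C δ : ℝ) (d t : ℕ) : ℝ :=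
  if t < epochStart f γ₀ c C δ d d then
    epochLevel γ₀ d (epochIndex f γ₀ c C δ d t) / √(1 - γ₀) else 1 - γ₀ / 4

theorem epochPosition_spec (hd : 3 ≤ d) {t : ℕ} (ht : 1 ≤ t) :
    1 ≤ epochPosition f γ₀ c C δ d t ∧ epochPosition f γ₀ c C δ d t ≤ d ∧
      epochStart f γ₀ c C δ d (epochPosition f γ₀ c C δ d t) ≤ t := by
  unfold epochPosition
  split_ifs with h
  · obtain ⟨h2, h3, -⟩ := epochIndex_spec hd ht h
    exact ⟨h2, (epochIndex_le t).trans (Nat.sub_le d 1), h3⟩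
  · exact ⟨by omega, le_rfl, not_lt.1 h⟩

theorem sqrt_one_sub_bounds (h0 : 0 < γ₀) (h1 : γ₀ ≤ 0.1) :
    1 - γ₀ ≤ √(1 - γ₀) ∧ 0.9 ≤ √(1 - γ₀) := by
  norm_num at h1
  have h2 : 1 - γ₀ ≤ √(1 - γ₀) := Real.le_sqrt_of_sq_le (by nlinarith)
  exact ⟨h2, by norm_num; linarith⟩

theorem epochTarget_le (h0 : 0 < γ₀) (h1 : γ₀ ≤ 0.1) (hd : 3 ≤ d) (t : ℕ) :
    epochTarget f γ₀ c C δ d t ≤ 1.25 * epochLevel γ₀ d (epochPosition f γ₀ c C δ d t) ∧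
      epochTarget f γ₀ c C δ d t ≤ 1 - γ₀ / 4 := by
  obtain ⟨h2, h3⟩ := sqrt_one_sub_bounds h0 h1
  have h4 := (sq_one_sub_bounds h0 h1).1
  unfold epochTarget epochPosition
  split_ifs with h
  · have h5 := epochLevel_nonneg γ₀ d (epochIndex f γ₀ c C δ d t)
    have h6 := epochLevel_le (γ₀ := γ₀) hd
      ((epochIndex_le (f := f) (γ₀ := γ₀) (c := c) (C := C) (δ := δ) t).trans (Nat.sub_le d 1))
    generalize epochLevel γ₀ d (epochIndex f γ₀ c C δ d t) = ℓ at *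
    generalize √(1 - γ₀) = s at *
    norm_num at *
    rw [div_le_iff₀ (by linarith), div_le_iff₀ (by linarith)]
    constructor <;> nlinarith
  · rw [epochLevel_self γ₀ hd]
    norm_num at *
    linarith

/-- The target stays below the expected progress of an iterate that starts at `1 / √d`. -/
theorem epochTarget_le_of_start (h0 : 0 < γ₀) (h1 : γ₀ ≤ 0.1) (hd : 3 ≤ d) {t : ℕ} (ht : 1 ≤ t)
    {S : ℝ}
    (hS : 4 * (epochLevel γ₀ d (epochPosition f γ₀ c C δ d t) - epochLevel γ₀ d 1) ≤ S) :
    epochTarget f γ₀ c C δ d t ≤ (1 - γ₀ / 32) / √d + S := by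
  obtain ⟨h2, h3⟩ := sqrt_one_sub_bounds h0 h1
  have h4 := (sq_one_sub_bounds h0 h1).1
  have hpos := (epochPosition_spec (f := f) (γ₀ := γ₀) (c := c) (C := C) (δ := δ) hd ht).1
  have hlev := monotone_epochLevel γ₀ d hpos
  have hlev0 := epochLevel_nonneg γ₀ d 1
  have hd' : (3 : ℝ) ≤ d := by exact_mod_cast hd
  have hsd : 1.7 ≤ √(d : ℝ) := Real.le_sqrt_of_sq_le (by norm_num; linarith)
  have hone := epochLevel_one γ₀ d
  have hy : 1 / √(d : ℝ) ≤ 0.6 := by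
    norm_num at hsd
    rw [div_le_iff₀ (by linarith)]
    norm_num
    linarith
  have hy0 : 0 ≤ 1 / √(d : ℝ) := by positivity
  rw [div_eq_mul_one_div (1 - γ₀ / 32)]
  unfold epochTarget
  unfold epochPosition at hS hlev
  split_ifs at hS hlev ⊢ with h
  · generalize epochLevel γ₀ d (epochIndex f γ₀ c C δ d t) = p at *
    generalize epochLevel γ₀ d 1 = ℓ at *
    generalize 1 / √(d : ℝ) = y at *
    have hs : √(1 - γ₀) ≤ 1 := Real.sqrt_le_one.2 (by linarith)
    generalize √(1 - γ₀) = s at *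
    norm_num at h1 h3
    rw [div_le_iff₀ (by linarith)]
    have h5 : ℓ ≤ (1 - γ₀ / 32) * y * s := by
      rw [hone]
      have : (1 - γ₀) * (1 - γ₀) * y ≤ (1 - γ₀ / 32) * s * y :=
        mul_le_mul_of_nonneg_right
          (mul_le_mul (by linarith) h2 (by linarith) (by linarith)) hy0
      linarith
    have h6 : p - ℓ ≤ S * s := by nlinarith
    linarith
  · rw [epochLevel_self γ₀ hd, hone] at hS
    generalize 1 / √(d : ℝ) = y at *
    generalize (1 - γ₀) ^ 2 = q at *
    norm_num at *
    have h5 : 0 ≤ (1 - γ₀ / 32) * y := mul_nonneg (by linarith) hy0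
    nlinarith

end epoch_target

/-- Burn-in with epochs of constant learning rate, for a fixed choice of the constants. -/
theorem burn_in_epochs {γ₀ γ₁ γ₂ c C δ : ℝ} {d : ℕ} {f : ℝ → ℝ} {Ω : Type*}
    {mΩ : MeasurableSpace Ω} {μ : Measure Ω} [IsProbabilityMeasure μ] {ℱ : Filtration ℕ mΩ}
    {w : EuclideanSpace ℝ (Fin d)} {θ Z a : ℕ → Ω → EuclideanSpace ℝ (Fin d)}
    {ε r : ℕ → Ω → ℝ} (h0 : 0 < γ₀) (h1 : γ₀ ≤ 0.1) (hγ₁ : 0 < γ₁) (hγ₂ : 0 < γ₂)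
    (hC : C = 128 / (γ₁ * γ₀ ^ 2)) (hc : 0 < c) (hc1 : c ≤ γ₀ / (800 * γ₂ ^ 2))
    (hc2 : c ≤ γ₀ ^ 2 / (500000 * γ₂ ^ 2) / C) (hc3 : c ≤ γ₀ / (4000 * γ₂))
    (hd : 3 ≤ d) (hδ : 0 < δ) (hδ1 : δ < 1)
    (hL : LinkAssumption f γ₀ γ₁ γ₂) (hf : ConvexOn ℝ (Icc 0 1) f)
    (hD : ∀ k, 1 ≤ k → k ≤ d → 0 < linkDeriv f (epochLevel γ₀ d k))
    (hone : ∀ k, 1 ≤ k → k ≤ d → 1 ≤ epochDuration f γ₀ c C δ d k) (hw : ‖w‖ = 1)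
    (hsgd : IsSGD μ f w (epochSchedule f γ₀ c C δ d) (fun _ => √γ₀) ℱ θ Z a ε r)
    (hinit : ∀ᵐ ω ∂μ, 1 / √(d : ℝ) ≤ inner ℝ (θ 1 ω) w) :
    1 - δ * epochStart f γ₀ c C δ d d ≤
      μ.real {ω | 1 - γ₀ / 4 ≤ inner ℝ (θ (epochStart f γ₀ c C δ d d) ω) w} := by
  obtain ⟨hG0, hG1, hG2, -⟩ := stepGain_bounds hL h0 h1 hγ₁ hγ₂
  have hΛ := one_le_log_div hd hδ hδ1
  have hC0 : 0 < C := by rw [hC]; positivity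
  have hd' : (3 : ℝ) ≤ d := by exact_mod_cast hd
  have hsd : 0 < √(d : ℝ) := Real.sqrt_pos.2 (by linarith)
  have hsd2 : √(d : ℝ) ^ 2 = d := Real.sq_sqrt (by linarith)
  have hsd1 : 1 ≤ √(d : ℝ) := by nlinarith
  have hy1 : 1 / √(d : ℝ) ≤ 1 := div_le_self zero_le_one hsd1
  have hs : 0 < √(1 - γ₀) := Real.sqrt_pos.2 (by norm_num at h1; linarith)
  have hidx : ∀ i ∈ Finset.Ico 1 (epochStart f γ₀ c C δ d d),
      1 ≤ epochIndex f γ₀ c C δ d i ∧ epochIndex f γ₀ c C δ d i ≤ d := fun i hi =>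
    ⟨(epochIndex_spec hd (Finset.mem_Ico.1 hi).1 (Finset.mem_Ico.1 hi).2).1,
      (epochIndex_le i).trans (Nat.sub_le d 1)⟩
  have hDγ : ∀ k ≤ d, linkDeriv f (epochLevel γ₀ d k) ≤ γ₂ := fun k hk =>
    hL.linkDeriv_le hf h0 (epochLevel_mem h0 h1 hd hk)
  obtain ⟨g, hgdef⟩ : ∃ g : ℕ → ℝ, g = fun e => epochRate f γ₀ c δ d e * stepGain f γ₀ *
      (linkDeriv f (epochLevel γ₀ d e) * √γ₀ * γ₀ / (32 * d)) := ⟨_, rfl⟩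
  have hg0 : ∀ e, 0 ≤ g e := by
    intro e
    have h2 := hL.linkDeriv_nonneg (epochLevel γ₀ d e)
    have h3 := epochRate_nonneg (d := d) (δ := δ) hL hc e
    rw [hgdef]
    positivity
  have hg : ∀ e, 1 ≤ e → e ≤ d → 4 * (epochLevel γ₀ d (e + 1) - epochLevel γ₀ d e) ≤
      (epochLength f γ₀ c C δ d e : ℝ) * g e := by
    intro e he hed
    refine le_trans ?_ (mul_le_mul_of_nonneg_right (le_epochLength e) (hg0 e))
    rw [hgdef]
    exact epoch_gain_ge h0 hγ₁ hC
      (epochRate_pos hc hd hΛ (epochLevel_pos h0 h1 hd he) (hD e he hed)) (hD e he hed)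
      (by linarith) (sub_nonneg.2 (monotone_epochLevel γ₀ d e.le_succ)) hG1
  refine hsgd.burn_in (T := epochStart f γ₀ c C δ d d)
    (lo := fun i => epochLevel γ₀ d (epochIndex f γ₀ c C δ d i) / √(1 - γ₀))
    (κ := fun i => linkDeriv f (epochLevel γ₀ d (epochIndex f γ₀ c C δ d i)))
    (h := fun i => min (4 * epochLevel γ₀ d (epochIndex f γ₀ c C δ d i)) (1 - γ₀ / 8))
    (g := fun i => g (epochIndex f γ₀ c C δ d i)) (u := epochTarget f γ₀ c C δ d)
    hd h0 h1 hγ₁ hγ₂ hδ hδ1 hL hw hinit (fun _ => epochRate_nonneg hL hc _) ?_ ?_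
    (fun _ => div_nonneg (epochLevel_nonneg _ _ _) hs.le) (fun _ => hL.linkDeriv_nonneg _) ?_
    (fun _ => le_min (mul_nonneg (by norm_num) (epochLevel_nonneg _ _ _))
      (by norm_num at h1; linarith))
    (fun _ => min_le_right _ _) ?_ (fun i => by rw [hgdef]; rfl) (Nat.le_add_right 1 _)
    ?_ ?_ ?_ ?_
  · intro i hi
    obtain ⟨hk, hkd⟩ := hidx i hi
    exact epoch_rate_le hγ₂ hc hc1 (hL.linkDeriv_nonneg _) (hDγ _ hkd)
      (epochLevel_pos h0 h1 hd hk) hΛ hsd2 hsd (inv_sqrt_le_epochLevel h0 h1 hk)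
  · have h2 := sum_epochs (f := f) (γ₀ := γ₀) (c := c) (C := C) (δ := δ)
      (fun e => epochRate f γ₀ c δ d e ^ 2) le_rfl (by omega : 1 ≤ d) le_rfl
    rw [epochStart_one] at h2
    refine (h2.le.trans (sum_epochLength_mul_sq_rate_le h0 h1 hc hC0 hδ hδ1 hd hΛ hD hone)).trans ?_
    have h3 : 2 * (C * c) ≤ γ₀ ^ 2 / (250000 * γ₂ ^ 2) := by
      calc 2 * (C * c) ≤ 2 * (C * (γ₀ ^ 2 / (500000 * γ₂ ^ 2) / C)) := by gcongr
        _ = _ := by field_simp; norm_num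
    rw [← div_div]
    gcongr
  · intro i hi
    obtain ⟨hk, hkd⟩ := hidx i hi
    have hmem := epochLevel_mem h0 h1 hd hkd
    rw [mul_div_cancel₀ _ hs.ne']
    exact hL.slope_ge hmem.1 fun z hz =>
      hL.monotoneOn_linkDeriv hf hmem ⟨hmem.1.trans hz.1, hz.2⟩ hz.1
  · intro i hi
    obtain ⟨hk, hkd⟩ := hidx i hi
    refine epoch_loss_le h0 hγ₂ hc hc3 (hL.linkDeriv_nonneg _) (epochLevel_pos h0 h1 hd hk) hΛ
      (by linarith) hG2 (inv_sqrt_le_epochLevel h0 h1 hk) (min_le_left _ _) ?_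
    refine add_nonneg (by positivity) (le_min (mul_nonneg (by norm_num) (epochLevel_nonneg _ _ _))
      (by norm_num at h1; linarith))
  · intro t ht htT
    obtain ⟨-, hpd, hst⟩ := epochPosition_spec (f := f) (γ₀ := γ₀) (c := c) (C := C) (δ := δ) hd ht
    exact epochTarget_le_of_start h0 h1 hd ht
      (epoch_progress hg0 hg le_rfl hpd epochStart_one.ge hst)
  · intro s t hs1 hst htT
    obtain ⟨-, hpd, hpt⟩ := epochPosition_spec (f := f) (γ₀ := γ₀) (c := c) (C := C) (δ := δ) hd
      (by omega : 1 ≤ t)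
    obtain ⟨hj, -, hjs⟩ := epochIndex_spec hd hs1 (hst.trans_le htT)
    obtain ⟨hu1, hu2⟩ := epochTarget_le (f := f) (c := c) (C := C) (δ := δ) h0 h1 hd t
    exact target_le_of_reset h0 h1 (epochLevel_nonneg γ₀ d _) (epochLevel_succ_le hj) hy1
      (inv_sqrt_le_epochLevel h0 h1 hj) hu1 hu2 (Finset.sum_nonneg fun _ _ => hg0 _)
      (epoch_progress hg0 hg (by omega) hpd hjs hpt)
  · intro t ht
    rw [epochTarget, if_pos (Finset.mem_Ico.1 ht).2]
  · rw [epochTarget, if_neg (lt_irrefl _)]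

theorem theorem2 (γ₀ γ₁ γ₂ : ℝ) (hγ₀ : 0 < γ₀) (hγ₀' : γ₀ ≤ 0.1) (hγ₁ : 0 < γ₁) (hγ₂ : 0 < γ₂) :
    -- derivative bounded below on `[0,1]`: constant learning rate
    (∀ c₀ : ℝ, 0 < c₀ → ∃ c C : ℝ, 0 < c ∧ 0 < C ∧
      ∀ (d : ℕ), 3 ≤ d → ∀ δ : ℝ, 0 < δ → δ < 1 →
      ∀ f : ℝ → ℝ, LinkAssumption f γ₀ γ₁ γ₂ → (∀ x ∈ Icc (0 : ℝ) 1, c₀ ≤ linkDeriv f x) →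
      ∀ T : ℕ, T = ⌈C * (d : ℝ) ^ 2 * Real.log (d / δ) ^ 2⌉₊ →
      ∀ (Ω : Type*) (mΩ : MeasurableSpace Ω) (μ : Measure Ω), IsProbabilityMeasure μ →
      ∀ (ℱ : Filtration ℕ mΩ) (θs : EuclideanSpace ℝ (Fin d))
        (θ Z a : ℕ → Ω → EuclideanSpace ℝ (Fin d)) (ε r : ℕ → Ω → ℝ), ‖θs‖ = 1 →
      IsSGD μ f θs (fun _ => c / (d * Real.log (d / δ) ^ 2)) (fun _ => √γ₀) ℱ θ Z a ε r →
      (∀ᵐ ω ∂μ, 1 / √(d : ℝ) ≤ inner ℝ (θ 1 ω) θs) →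
      1 - δ * T ≤ μ.real {ω | 1 - γ₀ / 4 ≤ inner ℝ (θ T ω) θs}) ∧
    -- convex on `[0,1]`: learning rate constant on each epoch
    (∃ c C K : ℝ, 0 < c ∧ 0 < C ∧ 0 < K ∧
      ∀ (d : ℕ), 3 ≤ d → ∀ δ : ℝ, 0 < δ → δ < 1 →
      ∀ f : ℝ → ℝ, LinkAssumption f γ₀ γ₁ γ₂ → ConvexOn ℝ (Icc 0 1) f →
      burnInIntegral f γ₀ d < ∞ →
      ∀ T : ℕ, T = epochStart f γ₀ c C δ d d →
      (T : ℝ≥0∞) ≤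
          ENNReal.ofReal (K * (d : ℝ) ^ 2 * Real.log (d / δ) ^ 2) * burnInIntegral f γ₀ d ∧
      ∀ (Ω : Type*) (mΩ : MeasurableSpace Ω) (μ : Measure Ω), IsProbabilityMeasure μ →
      ∀ (ℱ : Filtration ℕ mΩ) (θs : EuclideanSpace ℝ (Fin d))
        (θ Z a : ℕ → Ω → EuclideanSpace ℝ (Fin d)) (ε r : ℕ → Ω → ℝ), ‖θs‖ = 1 →
      IsSGD μ f θs (epochSchedule f γ₀ c C δ d) (fun _ => √γ₀) ℱ θ Z a ε r →
      (∀ᵐ ω ∂μ, 1 / √(d : ℝ) ≤ inner ℝ (θ 1 ω) θs) →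
      1 - δ * T ≤ μ.real {ω | 1 - γ₀ / 4 ≤ inner ℝ (θ T ω) θs}) := by
  refine ⟨fun c₀ hc₀ => burn_in_of_linkDeriv_ge hγ₀ hγ₀' hγ₁ hγ₂ hc₀, ?_⟩
  obtain ⟨C, hC⟩ : ∃ C, C = 128 / (γ₁ * γ₀ ^ 2) := ⟨_, rfl⟩
  have hC0 : 0 < C := by rw [hC]; positivity
  -- `C` makes the gain of each epoch four times the distance of its levels; `c` is small enough for
  -- the exponential moments, for the sum of the squared rates, for the drift to dominate the loss
  -- from normalization, and for each epoch to last at least one round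
  obtain ⟨c, hc, hc1, hc2, hc3, hc4⟩ : ∃ c : ℝ, 0 < c ∧ c ≤ γ₀ / (800 * γ₂ ^ 2) ∧
      c ≤ γ₀ ^ 2 / (500000 * γ₂ ^ 2) / C ∧ c ≤ γ₀ / (4000 * γ₂) ∧ c ≤ C / (4 * γ₂ ^ 2) := by
    refine ⟨min (min (γ₀ / (800 * γ₂ ^ 2)) (γ₀ ^ 2 / (500000 * γ₂ ^ 2) / C))
      (min (γ₀ / (4000 * γ₂)) (C / (4 * γ₂ ^ 2))), ?_, ?_, ?_, ?_, ?_⟩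
    · exact lt_min (lt_min (by positivity) (by positivity))
        (lt_min (by positivity) (by positivity))
    · exact (min_le_left _ _).trans (min_le_left _ _)
    · exact (min_le_left _ _).trans (min_le_right _ _)
    · exact (min_le_right _ _).trans (min_le_left _ _)
    · exact (min_le_right _ _).trans (min_le_right _ _)
  refine ⟨c, C, 16 * C / c, hc, hC0, by positivity, ?_⟩
  intro d hd δ hδ hδ1 f hL hf hI T hT
  have hΛ := one_le_log_div hd hδ hδ1
  have hD : ∀ k, 1 ≤ k → k ≤ d → 0 < linkDeriv f (epochLevel γ₀ d k) := fun k hk hkd =>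
    linkDeriv_epochLevel_pos hL hf hγ₀ hγ₀' hd hI hk hkd
  have hone : ∀ k, 1 ≤ k → k ≤ d → 1 ≤ epochDuration f γ₀ c C δ d k := fun k hk hkd =>
    one_le_epochDuration hγ₀ hγ₀' hγ₂ hc hC0 hc4 hd hΛ hk (hD k hk hkd)
      (hL.linkDeriv_le hf hγ₀ (epochLevel_mem hγ₀ hγ₀' hd hkd))
  rw [hT]
  refine ⟨epochStart_self_le_burnInIntegral hL hf hγ₀ hγ₀' hc hC0 hd hΛ hD hone, ?_⟩
  intro Ω mΩ μ hμ ℱ θs θ Z a ε r hw hsgd hinit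
  exact burn_in_epochs hγ₀ hγ₀' hγ₁ hγ₂ hC hc hc1 hc2 hc3 hd hδ hδ1 hL hf hD hone hw hsgd hinit
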